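/- Let $k$ be a finite field of characteristic $p$, and let $W_2(k)$ be its ring of Witt vectors of length $2$. \textbf{The cube construction.} For a $k$-vector space $V$ and $n\ge 0$, an $n$-cube in $V$ is a map $f:\{0,1\}^n\to V$. Let $\overline{Q}_n(V)$ be the $k$-vector space spanned by symbols $[f]$, $f$ an $n$-cube in $V$, modulo the relations $[0]=0$; $[\lambda f]=\lambda[f]$ for $\lambda\in k^*$; and $[f]=0$ whenever $f$ is supported on one of the $2n$ faces $\{x_j=\varepsilon\}$. For $n\geq 1$ the differential $d:\overline{Q}_n(V)\to\overline{Q}_{n-1}(V)$ is $d[f]=\sum_{j=1}^{n}(-1)^j\bigl([f|_{x_j=0}+f|_{x_j=1}]-[f|_{x_j=0}]-[f|_{x_j=1}]\bigr)$. If $A$ is an associative unital $k$-algebra, $\overline{Q}_\bullet(A)$ is a DG algebra over $k$ with product $[f]\cdot[g]=[(x,y)\mapsto f(x)g(y)]$ and unit $[1]$, and there is an augmentation $\overline{Q}_\bullet(A)\to A$, given by $[v]\mapsto v$ in degree $0$. Let $V^\flat_\bullet$ be the two-term quotient complex $V^\flat_1=\overline{Q}_1(V)/\operatorname{Im} d\to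 V^\flat_0=\overline{Q}_0(V)$, and let $\overline{Q}_{\le 1}(V)$ be the quotient of $\overline{Q}_\bullet(V)$ with terms $\overline{Q}_0(V)$, $\overline{Q}_1(V)$, $\overline{Q}_2(V)/\operatorname{Ker} d$ in degrees $0,1,2$ and zero above. For $V=A$ both are quotient DG algebras of $\overline{Q}_\bullet(A)$, and the augmentation factors through $\overline{Q}_{\le 1}(A)\to A$. \textbf{Splittings.} A \emph{splitting} of a two-term complex $d:K_1\to K_0$ of $k$-vector spaces is a $k$-vector space $K_{01}$ with a surjection $a:K_{01}\to K_0$ and an injection $b:K_1\to K_{01}$ such that $ab=d$, $b$ induces an isomorphism $\operatorname{Ker} d\to\operatorname{Ker} a$, and $a$ induces an isomorphism $\operatorname{Coker} b\to\operatorname{Coker} d$; if $K_\bullet$ is a DG algebra, the splitting is \emph{multiplicative} if $K_{01}$ is a $k$-algebra, $a$ is an algebra map, and $b$ is a map of $K_{01}$-bimodules. With isomorphisms compatible with $a$ and $b$ (and, in the second case, with the products), these form groupoids $\operatorname{Spl}(K_\bullet)$ and $\operatorname{Spl}^{\mathrm{mult}}(K_\bullet)$. A \emph{DG splitting} of a DG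 algebra map $B'_\bullet\to B_\bullet$ is a DG algebra map $s:\widetilde{B}_\bullet\to B'_\bullet$ such that the composition $\widetilde{B}_\bullet\to B_\bullet$ is a surjective quasi-isomorphism. \textbf{Liftings.} Let $\operatorname{Lift}(V)$ be the groupoid of flat $W_2(k)$-modules $V'$ equipped with an isomorphism $V'/p\cong V$ of $k$-vector spaces. For a $k$-algebra $A$, let $\operatorname{Lift}^{\mathrm{alg}}(A)$ be the groupoid of flat $W_2(k)$-algebras $A'$ equipped with an isomorphism $A'/p\cong A$ of $k$-algebras. All algebras are associative and unital. \textbf{Statement.} \begin{enumerate} \item There are equivalences of groupoids $e_V:\operatorname{Lift}(V)\cong\operatorname{Spl}(V^\flat_\bullet)$ for all $k$-vector spaces $V$. They are functorial in $V$: a $W_2(k)$-linear map $V'\to W'$ of flat liftings over a $k$-linear map $f:V\to W$ induces a map $e_V(V')\to e_W(W')$ compatible with $a$, $b$ and $f^\flat:V^\flat_\bullet\to W^\flat_\bullet$; this respects compositions, and for isomorphisms over $\operatorname{id}_V$ it is the action of the functor $e_V$ on morphisms. \item For every $k$-algebra $A$, the equivalence $e_A$ identifies flat algebra liftings with multiplicative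 splittings: there is an equivalence $\operatorname{Lift}^{\mathrm{alg}}(A)\cong\operatorname{Spl}^{\mathrm{mult}}(A^\flat_\bullet)$ that is compatible, up to a natural isomorphism, with $e_A$ and with the functors forgetting the products. \item To every pair of a $k$-algebra $A$ and a flat algebra lifting $A'$ of $A$ to $W_2(k)$ one can associate a DG splitting $A_\bullet\to\overline{Q}_{\le 1}(A)$ of the projection $\overline{Q}_{\le 1}(A)\to A$, functorially in the pair $(A,A')$ (with respect to all pairs of compatible algebra maps $A\to B$, $A'\to B'$). \end{enumerate} -/

import Mathlib

open CategoryTheory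

universe u

noncomputable section

namespace CubeConstruction

/-- An `n`-cube in `V`: a family of vectors indexed by the vertices of the cube `{0,1}ⁿ`. -/
abbrev Cube (V : Type u) (n : ℕ) : Type u := (Fin n → Bool) → V

/-- The restriction of a cube to the face on which the `j`-th coordinate is `b`. -/
def Cube.face {V : Type u} {n : ℕ} (j : Fin (n + 1)) (b : Bool) (f : Cube V (n + 1)) : Cube V n :=
  fun x => f (Fin.insertNth (α := fun _ => Bool) j b x)

/-- A slab: a cube supported on a single face of codimension one. -/
def Cube.IsSlab {V : Type u} [Zero V] {n : ℕ} (f : Cube V n) : Prop :=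
  ∃ (i : Fin n) (b : Bool), ∀ x, x i ≠ b → f x = 0

section QBar

variable (k : Type u) [Field k] (V : Type u) [AddCommGroup V] [Module k V] (n : ℕ)

/-- The relations imposed on the `k`-linear span of the `n`-cubes in `V`: the zero cube vanishes
(reduced span), slabs vanish (normalization), and `[λ f] = λ [f]` for `λ ∈ kˣ` (coinvariants of
the action `λ · a [f] = λ⁻¹ a [λ f]` of `kˣ`). -/
def QBar.rel : Submodule k (Cube V n →₀ k) :=
  Submodule.span k
    ({Finsupp.single 0 1} ∪ {r | ∃ f : Cube V n, f.IsSlab ∧ r = Finsupp.single f 1} ∪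
      {r | ∃ (c : kˣ) (f : Cube V n),
        r = Finsupp.single ((c : k) • f) 1 - (c : k) • Finsupp.single f 1})

/-- The degree `n` term of the cube construction `Q̄(V)`. -/
abbrev QBar : Type u := (Cube V n →₀ k) ⧸ QBar.rel k V n

end QBar

namespace QBar

variable {k : Type u} [Field k] {V W A : Type u} [AddCommGroup V] [Module k V]
  [AddCommGroup W] [Module k W] [Ring A] [Algebra k A] {n : ℕ}

variable (k) in
/-- The class of a cube. -/
def mk (f : Cube V n) : QBar k V n := Submodule.Quotient.mk (Finsupp.single f 1)

theorem mk_zero : mk k (0 : Cube V n) = 0 :=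
  (Submodule.Quotient.mk_eq_zero _).2 (Submodule.subset_span (Or.inl (Or.inl rfl)))

theorem mk_slab {f : Cube V n} (hf : f.IsSlab) : mk k f = 0 :=
  (Submodule.Quotient.mk_eq_zero _).2 (Submodule.subset_span (Or.inl (Or.inr ⟨f, hf, rfl⟩)))

theorem mk_units_smul (c : kˣ) (f : Cube V n) : mk k ((c : k) • f) = (c : k) • mk k f := by
  rw [mk, mk, ← Submodule.Quotient.mk_smul]
  exact (Submodule.Quotient.eq _).2 (Submodule.subset_span (Or.inr ⟨c, f, rfl⟩))

theorem mk_smul (c : k) (f : Cube V n) : mk k (c • f) = c • mk k f := by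
  by_cases hc : c = 0
  · subst hc; rw [zero_smul, zero_smul, mk_zero]
  · exact mk_units_smul (Units.mk0 c hc) f

/-- The universal property of `Q̄ₙ(V)`. -/
def lift {M : Type u} [AddCommGroup M] [Module k M] (φ : Cube V n → M) (h0 : φ 0 = 0)
    (hslab : ∀ f : Cube V n, f.IsSlab → φ f = 0)
    (hsmul : ∀ (c : kˣ) (f : Cube V n), φ ((c : k) • f) = (c : k) • φ f) : QBar k V n →ₗ[k] M :=
  (rel k V n).liftQ (Finsupp.linearCombination k φ) <| by
    rw [rel, Submodule.span_le]
    rintro r ((rfl | ⟨f, hf, rfl⟩) | ⟨c, f, rfl⟩)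
    · simp [h0]
    · simp [hslab f hf]
    · simp [hsmul c f]

@[simp]
theorem lift_mk {M : Type u} [AddCommGroup M] [Module k M] (φ : Cube V n → M) (h0 : φ 0 = 0)
    (hslab : ∀ f : Cube V n, f.IsSlab → φ f = 0)
    (hsmul : ∀ (c : kˣ) (f : Cube V n), φ ((c : k) • f) = (c : k) • φ f) (f : Cube V n) :
    lift φ h0 hslab hsmul (mk k f) = φ f := by
  simp [lift, mk]

theorem hom_ext {M : Type u} [AddCommGroup M] [Module k M] {φ ψ : QBar k V n →ₗ[k] M}
    (h : ∀ f, φ (mk k f) = ψ (mk k f)) : φ = ψ := by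
  refine Submodule.linearMap_qext _ (Finsupp.lhom_ext' fun f => LinearMap.ext_ring ?_)
  exact h f

/-- Functoriality of `Q̄ₙ(V)` in `V`. -/
def map (g : V →ₗ[k] W) (n : ℕ) : QBar k V n →ₗ[k] QBar k W n :=
  lift (fun f => mk k (fun x => g (f x)))
    (by
      have h : (fun x => g ((0 : Cube V n) x)) = 0 := by funext x; simp
      rw [h, mk_zero])
    (by
      rintro f ⟨i, b, h⟩
      exact mk_slab ⟨i, b, fun x hx => by simp [h x hx]⟩)
    (by
      intro c f
      rw [← mk_units_smul]
      congr 1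
      funext x
      simp)

@[simp]
theorem map_mk (g : V →ₗ[k] W) (f : Cube V n) : map g n (mk k f) = mk k (fun x => g (f x)) :=
  lift_mk ..

theorem Cube.face_eq_zero {f : Cube V (n + 1)} {i : Fin (n + 1)} {b : Bool}
    (h : ∀ x, x i ≠ b → f x = 0) {c : Bool} (hc : c ≠ b) : f.face i c = 0 := by
  funext x
  exact h _ (by simpa using hc)

/-- The `j`-th partial differential: `[f₀ + f₁] - [f₀] - [f₁]`, where `f₀`, `f₁` are the
restrictions of the cube `f` to the two faces orthogonal to the `j`-th coordinate. -/
def partialD (k : Type u) [Field k] (V : Type u) [AddCommGroup V] [Module k V] {n : ℕ}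
    (j : Fin (n + 1)) : QBar k V (n + 1) →ₗ[k] QBar k V n :=
  lift (fun f => mk k (f.face j false + f.face j true) - mk k (f.face j false)
      - mk k (f.face j true))
    (by
      have h : ∀ b, (0 : Cube V (n + 1)).face j b = 0 := fun b => rfl
      simp [h, mk_zero])
    (by
      rintro f ⟨i, b, h⟩
      by_cases hij : i = j
      · subst hij
        cases b
        · rw [Cube.face_eq_zero h (c := true) (by simp)]; simp [mk_zero]
        · rw [Cube.face_eq_zero h (c := false) (by simp)]; simp [mk_zero]
      · obtain ⟨i', rfl⟩ := Fin.exists_succAbove_eq hij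
        have h' : ∀ c x, x i' ≠ b → f.face j c x = 0 :=
          fun c x hx => h _ (by simpa using hx)
        rw [mk_slab (f := f.face j false) ⟨i', b, h' _⟩,
          mk_slab (f := f.face j true) ⟨i', b, h' _⟩,
          mk_slab ⟨i', b, fun x hx => by simp [h' _ x hx]⟩]
        simp)
    (by
      intro c f
      have h : ∀ b, ((c : k) • f).face j b = (c : k) • f.face j b := fun b => rfl
      rw [h, h, ← smul_add, mk_units_smul, mk_units_smul, mk_units_smul, smul_sub, smul_sub])

theorem partialD_mk (j : Fin (n + 1)) (f : Cube V (n + 1)) :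
    partialD k V j (mk k f) = mk k (f.face j false + f.face j true) - mk k (f.face j false)
      - mk k (f.face j true) :=
  lift_mk ..

/-- The differential of the cube construction. With coordinates numbered from `1`, it is the
alternating sum of the partial differentials with signs `(-1) ^ j`; in particular
`d [v, w] = [v] + [w] - [v + w]` in degree one. -/
def d (k : Type u) [Field k] (V : Type u) [AddCommGroup V] [Module k V] (n : ℕ) :
    QBar k V (n + 1) →ₗ[k] QBar k V n :=
  ∑ j : Fin (n + 1), (-1 : k) ^ ((j : ℕ) + 1) • partialD k V j

theorem insertNth_insertNth {i j : Fin (n + 1)} (hij : i ≤ j) (b c : Bool) (x : Fin n → Bool) :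
    Fin.insertNth (α := fun _ => Bool) j.succ c (Fin.insertNth (α := fun _ => Bool) i b x) =
      Fin.insertNth (α := fun _ => Bool) i.castSucc b
        (Fin.insertNth (α := fun _ => Bool) j c x) := by
  rw [Fin.insertNth_eq_iff]
  constructor
  · have : j.succ = i.castSucc.succAbove j := by
      rw [Fin.succAbove_castSucc_of_le _ _ hij]
    rw [this]; simp
  · funext q
    simp only [Fin.removeNth]
    by_cases hq : q = i
    · subst hq
      have : j.succ.succAbove q = q.castSucc := Fin.succAbove_succ_of_le _ _ hij
      rw [this]; simp
    · obtain ⟨q', rfl⟩ := Fin.exists_succAbove_eq hq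
      have : j.succ.succAbove (i.succAbove q') = i.castSucc.succAbove (j.succAbove q') := by
        ext
        simp only [Fin.succAbove, Fin.lt_def]
        rw [Fin.le_def] at hij
        split_ifs <;> simp at * <;> omega
      rw [this]; simp

theorem partialD_partialD {i j : Fin (n + 1)} (hij : i ≤ j) :
    partialD k V i ∘ₗ partialD k V j.succ = partialD k V j ∘ₗ partialD k V i.castSucc := by
  refine hom_ext fun f => ?_
  have h : ∀ b c, (f.face j.succ c).face i b = (f.face i.castSucc b).face j c := by
    intro b c
    funext x
    simp only [Cube.face, insertNth_insertNth hij]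
  have ha : ∀ (m : ℕ) (q : Fin (m + 1)) (b : Bool) (f g : Cube V (m + 1)),
    (f + g).face q b = f.face q b + g.face q b := fun _ _ _ _ _ => rfl
  simp only [LinearMap.comp_apply, partialD_mk, map_sub, ha, h]
  have e : (f.face i.castSucc false).face j false + (f.face i.castSucc false).face j true +
      ((f.face i.castSucc true).face j false + (f.face i.castSucc true).face j true) =
      (f.face i.castSucc false).face j false + (f.face i.castSucc true).face j false +
      ((f.face i.castSucc false).face j true + (f.face i.castSucc true).face j true) :=
    add_add_add_comm _ _ _ _
  rw [e]
  abel

theorem d_comp_d (n : ℕ) : d k V n ∘ₗ d k V (n + 1) = 0 := by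
  refine LinearMap.ext fun y => ?_
  simp only [d, LinearMap.comp_apply, LinearMap.sum_apply, map_sum, LinearMap.smul_apply,
    map_smul, LinearMap.zero_apply, Finset.smul_sum]
  simp only [← Finset.sum_product']
  let P := Fin (n + 2) × Fin (n + 1)
  let S : Finset P := {ij : P | (ij.1 : ℕ) ≤ (ij.2 : ℕ)}
  rw [Finset.univ_product_univ, ← Finset.sum_add_sum_compl S, ← eq_neg_iff_add_eq_zero,
    ← Finset.sum_neg_distrib]
  let φ : ∀ ij : P, ij ∈ S → P := fun ij hij =>
    (ij.2.succ, Fin.castLT ij.1 (lt_of_le_of_lt (Finset.mem_filter.mp hij).right (Fin.is_lt ij.2)))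
  apply Finset.sum_bij φ
  · intro ij hij
    simp_rw [S, φ, Finset.compl_filter, Finset.mem_filter_univ, Fin.val_succ,
      Fin.val_castLT] at hij ⊢
    omega
  · rintro ⟨i, j⟩ hij ⟨i', j'⟩ hij' h
    rw [Prod.mk_inj] at h ⊢
    refine ⟨?_, Fin.succ_injective _ h.1⟩
    have := congrArg Fin.val h.2
    exact Fin.ext this
  · rintro ⟨i', j'⟩ hij'
    simp_rw [S, Finset.compl_filter, Finset.mem_filter_univ, not_le] at hij'
    have h0 : i' ≠ 0 := by
      rintro rfl
      simp at hij'
    refine ⟨(Fin.castSucc j', i'.pred h0), ?_, ?_⟩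
    · simp only [S, Finset.mem_filter_univ, Fin.val_castSucc, Fin.val_pred]
      omega
    · simp only [φ, Fin.castLT_castSucc, Fin.succ_pred]
  · rintro ⟨i, j⟩ hij
    have hij' : (i : ℕ) ≤ j := (Finset.mem_filter.mp hij).right
    have hi : (i : ℕ) < n + 1 := lt_of_le_of_lt hij' j.2
    have := LinearMap.congr_fun
      (partialD_partialD (k := k) (V := V) (i := i.castLT hi) (j := j) hij') y
    simp only [LinearMap.comp_apply, Fin.castSucc_castLT] at this
    simp only [φ, this, Fin.castSucc_castLT,
      Fin.val_succ, Fin.val_castLT, smul_smul, ← neg_smul]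
    congr 1
    ring

/-- The external product of cubes: `(f × g) (x, y) = f x * g y`. -/
def Cube.mul {i j n : ℕ} (h : i + j = n) (f : Cube A i) (g : Cube A j) : Cube A n :=
  fun x => f (fun q => x (Fin.cast h (Fin.castAdd j q))) *
    g (fun q => x (Fin.cast h (Fin.natAdd i q)))

/-- The product on the cube construction of an algebra. -/
def mul (k : Type u) [Field k] (A : Type u) [Ring A] [Algebra k A] {i j n : ℕ} (h : i + j = n) :
    QBar k A i →ₗ[k] QBar k A j →ₗ[k] QBar k A n :=
  lift (fun f => lift (fun g => mk k (Cube.mul h f g))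
      (by
        have : Cube.mul h f (0 : Cube A j) = 0 := by funext x; simp [Cube.mul]
        rw [this, mk_zero])
      (by
        rintro g ⟨q, b, hg⟩
        exact mk_slab ⟨Fin.cast h (Fin.natAdd i q), b, fun x hx => by
          simp only [Cube.mul]; rw [hg _ hx, mul_zero]⟩)
      (by
        intro c g
        rw [← mk_units_smul]
        congr 1
        funext x
        simp [Cube.mul]))
    (by
      refine hom_ext fun g => ?_
      have : Cube.mul h (0 : Cube A i) g = 0 := by funext x; simp [Cube.mul]
      rw [lift_mk, this, mk_zero, LinearMap.zero_apply])
    (by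
      rintro f ⟨q, b, hf⟩
      refine hom_ext fun g => ?_
      rw [lift_mk, LinearMap.zero_apply]
      exact mk_slab ⟨Fin.cast h (Fin.castAdd j q), b, fun x hx => by
          simp only [Cube.mul]; rw [hf _ hx, zero_mul]⟩)
    (by
      intro c f
      refine hom_ext fun g => ?_
      rw [LinearMap.smul_apply, lift_mk, lift_mk, ← mk_units_smul]
      congr 1
      funext x
      simp [Cube.mul])

@[simp]
theorem mul_mk {i j n : ℕ} (h : i + j = n) (f : Cube A i) (g : Cube A j) :
    mul k A h (mk k f) (mk k g) = mk k (Cube.mul h f g) := by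
  rw [mul, lift_mk, lift_mk]

theorem hom_ext₂ {B : Type u} [AddCommGroup B] [Module k B] {m : ℕ}
    {M : Type u} [AddCommGroup M] [Module k M]
    {φ ψ : QBar k V n →ₗ[k] QBar k B m →ₗ[k] M}
    (h : ∀ f g, φ (mk k f) (mk k g) = ψ (mk k f) (mk k g)) : φ = ψ :=
  hom_ext fun f => hom_ext fun g => h f g

@[elab_as_elim]
theorem induction_on {P : QBar k V n → Prop} (x : QBar k V n) (hmk : ∀ f, P (mk k f))
    (hadd : ∀ x y, P x → P y → P (x + y)) (hsmul : ∀ (c : k) x, P x → P (c • x)) : P x := by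
  obtain ⟨x, rfl⟩ := Submodule.Quotient.mk_surjective _ x
  induction x using Finsupp.induction_linear with
  | zero => simpa using hsmul 0 _ (hmk 0)
  | add f g hf hg => exact hadd _ _ hf hg
  | single f c =>
    have := hsmul c _ (hmk f)
    rwa [mk, ← Submodule.Quotient.mk_smul, Finsupp.smul_single_one] at this

theorem mul_assoc' {i j l ij jl n : ℕ} (h₁ : i + j = ij) (h₂ : j + l = jl) (h₃ : ij + l = n)
    (h₄ : i + jl = n) (x : QBar k A i) (y : QBar k A j) (z : QBar k A l) :
    mul k A h₃ (mul k A h₁ x y) z = mul k A h₄ x (mul k A h₂ y z) := by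
  induction x using induction_on with
  | hadd a b ha hb => simp only [map_add, LinearMap.add_apply, ha, hb]
  | hsmul c a ha => simp only [map_smul, LinearMap.smul_apply, ha]
  | hmk f =>
  induction y using induction_on with
  | hadd a b ha hb => simp only [map_add, LinearMap.add_apply, ha, hb]
  | hsmul c a ha => simp only [map_smul, LinearMap.smul_apply, ha]
  | hmk g =>
  induction z using induction_on with
  | hadd a b ha hb => simp only [map_add, LinearMap.add_apply, ha, hb]
  | hsmul c a ha => simp only [map_smul, LinearMap.smul_apply, ha]
  | hmk e =>
  rw [mul_mk, mul_mk, mul_mk, mul_mk]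
  congr 1
  funext x
  subst h₁ h₂ h₃
  simp only [Cube.mul, mul_assoc]
  congr 2
  congr 1
  all_goals
    congr 1
    funext q
    congr 1
    ext
    simp [add_assoc]

theorem one_mul' {n : ℕ} (h : 0 + n = n) (x : QBar k A n) :
    mul k A h (mk k (fun _ => 1)) x = x := by
  induction x using induction_on with
  | hadd a b ha hb => simp only [map_add, LinearMap.add_apply, ha, hb]
  | hsmul c a ha => simp only [map_smul, LinearMap.smul_apply, ha]
  | hmk f =>
  rw [mul_mk]
  congr 1
  funext x
  simp only [Cube.mul, one_mul]
  congr 1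
  funext q
  congr 1
  ext
  simp

theorem mul_one' {n : ℕ} (h : n + 0 = n) (x : QBar k A n) :
    mul k A h x (mk k (fun _ => 1)) = x := by
  induction x using induction_on with
  | hadd a b ha hb => simp only [map_add, LinearMap.add_apply, ha, hb]
  | hsmul c a ha => simp only [map_smul, LinearMap.smul_apply, ha]
  | hmk f =>
  rw [mul_mk]
  congr 1
  funext x
  simp only [Cube.mul, mul_one]
  congr 1

theorem partialD_mul_left {i j n : ℕ} (h : i + 1 + j = n + 1) (h' : i + j = n) (p : Fin (i + 1))
    (x : QBar k A (i + 1)) (y : QBar k A j) :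
    partialD k A (Fin.cast h (Fin.castAdd j p)) (mul k A h x y) =
      mul k A h' (partialD k A p x) y := by
  induction x using induction_on with
  | hadd a b ha hb => simp only [map_add, LinearMap.add_apply, ha, hb]
  | hsmul c a ha => simp only [map_smul, LinearMap.smul_apply, ha]
  | hmk f =>
  induction y using induction_on with
  | hadd a b ha hb => simp only [map_add, LinearMap.add_apply, ha, hb]
  | hsmul c a ha => simp only [map_smul, LinearMap.smul_apply, ha]
  | hmk g =>
  have hf : ∀ b, (Cube.mul h f g).face (Fin.cast h (Fin.castAdd j p)) b =
      Cube.mul h' (f.face p b) g := by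
    intro b
    funext x
    simp only [Cube.mul, Cube.face]
    congr 1
    · congr 1
      funext q
      by_cases hq : q = p
      · subst hq; simp
      · obtain ⟨q', rfl⟩ := Fin.exists_succAbove_eq hq
        have : Fin.cast h (Fin.castAdd j (p.succAbove q')) =
            (Fin.cast h (Fin.castAdd j p)).succAbove (Fin.cast h' (Fin.castAdd j q')) := by
          ext
          simp only [Fin.succAbove, Fin.lt_def]
          split_ifs <;> simp at * <;> omega
        rw [this, Fin.insertNth_apply_succAbove, Fin.insertNth_apply_succAbove]
    · congr 1
      funext q
      have : Fin.cast h (Fin.natAdd (i + 1) q) =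
            (Fin.cast h (Fin.castAdd j p)).succAbove (Fin.cast h' (Fin.natAdd i q)) := by
          ext
          simp only [Fin.succAbove, Fin.lt_def]
          split_ifs <;> simp at * <;> omega
      rw [this, Fin.insertNth_apply_succAbove]
  have ha : ∀ f f' : Cube A i, Cube.mul h' (f + f') g = Cube.mul h' f g + Cube.mul h' f' g := by
    intro f f'
    funext x
    simp [Cube.mul, add_mul]
  rw [mul_mk, partialD_mk, partialD_mk, hf, hf, ← ha]
  simp

theorem partialD_mul_right {i j n : ℕ} (h : i + (j + 1) = n + 1) (h' : i + j = n)
    (p : Fin (j + 1)) (x : QBar k A i) (y : QBar k A (j + 1)) :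
    partialD k A (Fin.cast h (Fin.natAdd i p)) (mul k A h x y) =
      mul k A h' x (partialD k A p y) := by
  induction x using induction_on with
  | hadd a b ha hb => simp only [map_add, LinearMap.add_apply, ha, hb]
  | hsmul c a ha => simp only [map_smul, LinearMap.smul_apply, ha]
  | hmk f =>
  induction y using induction_on with
  | hadd a b ha hb => simp only [map_add, LinearMap.add_apply, ha, hb]
  | hsmul c a ha => simp only [map_smul, LinearMap.smul_apply, ha]
  | hmk g =>
  have hf : ∀ b, (Cube.mul h f g).face (Fin.cast h (Fin.natAdd i p)) b =
      Cube.mul h' f (g.face p b) := by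
    intro b
    funext x
    simp only [Cube.mul, Cube.face]
    congr 1
    · congr 1
      funext q
      have : Fin.cast h (Fin.castAdd (j + 1) q) =
            (Fin.cast h (Fin.natAdd i p)).succAbove (Fin.cast h' (Fin.castAdd j q)) := by
          ext
          simp only [Fin.succAbove, Fin.lt_def]
          split_ifs <;> simp at * <;> omega
      rw [this, Fin.insertNth_apply_succAbove]
    · congr 1
      funext q
      by_cases hq : q = p
      · subst hq; simp
      · obtain ⟨q', rfl⟩ := Fin.exists_succAbove_eq hq
        have : Fin.cast h (Fin.natAdd i (p.succAbove q')) =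
            (Fin.cast h (Fin.natAdd i p)).succAbove (Fin.cast h' (Fin.natAdd i q')) := by
          ext
          simp only [Fin.succAbove, Fin.lt_def]
          split_ifs <;> simp at * <;> omega
        rw [this, Fin.insertNth_apply_succAbove, Fin.insertNth_apply_succAbove]
  have ha : ∀ g g' : Cube A j, Cube.mul h' f (g + g') = Cube.mul h' f g + Cube.mul h' f g' := by
    intro f f'
    funext x
    simp [Cube.mul, mul_add]
  rw [mul_mk, partialD_mk, partialD_mk, hf, hf, ← ha]
  simp

theorem sum_fin_cast {M : Type u} [AddCommMonoid M] {a b : ℕ} (h : a = b) (F : Fin b → M) :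
    ∑ q : Fin b, F q = ∑ q : Fin a, F (Fin.cast h q) := by
  subst h; rfl

theorem d_mul_zero {i n : ℕ} (h : i + 1 + 0 = n + 1) (h' : i + 0 = n)
    (x : QBar k A (i + 1)) (y : QBar k A 0) :
    d k A n (mul k A h x y) = mul k A h' (d k A i x) y := by
  simp only [d, LinearMap.sum_apply, LinearMap.smul_apply, map_sum, map_smul]
  rw [sum_fin_cast h]
  refine Finset.sum_congr rfl fun q _ => ?_
  rw [← partialD_mul_left h h' q x y]
  rfl

theorem d_zero_mul {j n : ℕ} (h : 0 + (j + 1) = n + 1) (h' : 0 + j = n)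
    (x : QBar k A 0) (y : QBar k A (j + 1)) :
    d k A n (mul k A h x y) = mul k A h' x (d k A j y) := by
  simp only [d, LinearMap.sum_apply, LinearMap.smul_apply, map_sum, map_smul]
  rw [sum_fin_cast h, Fin.sum_univ_add]
  simp only [Finset.univ_eq_empty, Finset.sum_empty, zero_add]
  refine Finset.sum_congr rfl fun q _ => ?_
  rw [← partialD_mul_right h h' q x y]
  simp

theorem d_mul {i j n : ℕ} (h : i + 1 + (j + 1) = n + 1) (h₁ : i + (j + 1) = n)
    (h₂ : i + 1 + j = n) (x : QBar k A (i + 1)) (y : QBar k A (j + 1)) :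
    d k A n (mul k A h x y) =
      mul k A h₁ (d k A i x) y + (-1 : k) ^ (i + 1) • mul k A h₂ x (d k A j y) := by
  simp only [d, LinearMap.sum_apply, LinearMap.smul_apply, map_sum, map_smul, Finset.smul_sum]
  rw [sum_fin_cast h, Fin.sum_univ_add]
  congr 1
  · refine Finset.sum_congr rfl fun q _ => ?_
    rw [← partialD_mul_left h h₁ q x y]
    rfl
  · refine Finset.sum_congr rfl fun q _ => ?_
    rw [← partialD_mul_right h h₂ q x y, smul_smul]
    congr 1
    simp only [Fin.val_cast, Fin.val_natAdd]
    ring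

end QBar

/-! ### Differential graded algebras -/

/-- A DG algebra over `k` (homological grading, concentrated in non-negative degrees): a chain
complex with an associative unital product that satisfies the graded Leibniz rule. -/
structure DGAlg (k : Type u) [Field k] where
  /-- the underlying complex -/
  cx : ChainComplex (ModuleCat.{u} k) ℕ
  /-- the unit -/
  one : cx.X 0
  /-- the product of homogeneous elements -/
  mul : ∀ {i j n : ℕ}, i + j = n → (cx.X i →ₗ[k] cx.X j →ₗ[k] cx.X n)
  one_mul : ∀ {n : ℕ} (h : 0 + n = n) (x : cx.X n), mul h one x = x
  mul_one : ∀ {n : ℕ} (h : n + 0 = n) (x : cx.X n), mul h x one = x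
  mul_assoc : ∀ {i j l ij jl n : ℕ} (h₁ : i + j = ij) (h₂ : j + l = jl) (h₃ : ij + l = n)
    (h₄ : i + jl = n) (x : cx.X i) (y : cx.X j) (z : cx.X l),
    mul h₃ (mul h₁ x y) z = mul h₄ x (mul h₂ y z)
  d_mul : ∀ {i j n : ℕ} (h : i + 1 + (j + 1) = n + 1) (h₁ : i + (j + 1) = n) (h₂ : i + 1 + j = n)
    (x : cx.X (i + 1)) (y : cx.X (j + 1)),
    (cx.d (n + 1) n).hom (mul h x y) = mul h₁ ((cx.d (i + 1) i).hom x) y +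
      (-1 : k) ^ (i + 1) • mul h₂ x ((cx.d (j + 1) j).hom y)
  d_mul_zero : ∀ {i n : ℕ} (h : i + 1 + 0 = n + 1) (h' : i + 0 = n) (x : cx.X (i + 1))
    (y : cx.X 0), (cx.d (n + 1) n).hom (mul h x y) = mul h' ((cx.d (i + 1) i).hom x) y
  d_zero_mul : ∀ {j n : ℕ} (h : 0 + (j + 1) = n + 1) (h' : 0 + j = n) (x : cx.X 0)
    (y : cx.X (j + 1)), (cx.d (n + 1) n).hom (mul h x y) = mul h' x ((cx.d (j + 1) j).hom y)

namespace DGAlg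

variable {k : Type u} [Field k]

/-- Morphisms of DG algebras. -/
@[ext]
structure Hom (B C : DGAlg k) where
  /-- the underlying map of complexes -/
  f : B.cx ⟶ C.cx
  map_one : (f.f 0).hom B.one = C.one
  map_mul : ∀ {i j n : ℕ} (h : i + j = n) (x : B.cx.X i) (y : B.cx.X j),
    (f.f n).hom (B.mul h x y) = C.mul h ((f.f i).hom x) ((f.f j).hom y)

instance : Category (DGAlg k) where
  Hom := Hom
  id B := ⟨𝟙 _, by simp, by simp⟩
  comp φ ψ := ⟨φ.f ≫ ψ.f, by simp [φ.map_one, ψ.map_one], by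
    intro i j n h x y
    simp [φ.map_mul, ψ.map_mul]⟩

@[ext]
theorem hom_ext {B C : DGAlg k} {φ ψ : B ⟶ C} (h : φ.f = ψ.f) : φ = ψ := Hom.ext h

@[simp]
theorem id_f (B : DGAlg k) : Hom.f (𝟙 B) = 𝟙 B.cx := rfl

@[simp]
theorem comp_f {B C D : DGAlg k} (φ : B ⟶ C) (ψ : C ⟶ D) : (φ ≫ ψ).f = φ.f ≫ ψ.f := rfl

/-- A map `s : B̃ ⟶ B'` is a DG splitting of `q : B' ⟶ B` if the composition `B̃ ⟶ B` is a
surjective quasi-isomorphism. -/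
def IsDGSplitting {B₁ B' B : DGAlg k} (s : B₁ ⟶ B') (q : B' ⟶ B) : Prop :=
  (∀ n, Function.Surjective ((s ≫ q).f.f n).hom) ∧ QuasiIso (s ≫ q).f

variable (k) in
/-- The terms of the complex `A` concentrated in degree `0`. -/
def singleX (A : Type u) [Ring A] [Algebra k A] : ℕ → ModuleCat.{u} k
  | 0 => ModuleCat.of k A
  | _ + 1 => ModuleCat.of k PUnit

instance (A : Type u) [Ring A] [Algebra k A] (n : ℕ) : Subsingleton (singleX k A (n + 1)) :=
  inferInstanceAs (Subsingleton PUnit)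

variable (k) in
/-- The product on `A`, placed in degree `0`. -/
def singleMul (A : Type u) [Ring A] [Algebra k A] : ∀ (i j n : ℕ), i + j = n →
    (singleX k A i →ₗ[k] singleX k A j →ₗ[k] singleX k A n)
  | 0, 0, 0, _ => LinearMap.mul k A
  | _, _, _, _ => 0

variable (k) in
/-- An algebra considered as a DG algebra concentrated in degree `0`. -/
def single (A : Type u) [Ring A] [Algebra k A] : DGAlg k where
  cx := { X := singleX k A, d := fun _ _ => 0 }
  one := (1 : A)
  mul {i j n} h := singleMul k A i j n h
  one_mul {n} h x := by
    cases n with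
    | zero => exact _root_.one_mul (M := A) x
    | succ n => exact Subsingleton.elim _ _
  mul_one {n} h x := by
    cases n with
    | zero => exact _root_.mul_one (M := A) x
    | succ n => exact Subsingleton.elim _ _
  mul_assoc {i j l ij jl n} h₁ h₂ h₃ h₄ x y z := by
    cases n with
    | zero =>
      obtain ⟨rfl, rfl⟩ : ij = 0 ∧ l = 0 := by omega
      obtain ⟨rfl, rfl⟩ : i = 0 ∧ j = 0 := by omega
      obtain rfl : jl = 0 := by omega
      exact _root_.mul_assoc (G := A) x y z
    | succ n => exact Subsingleton.elim _ _
  d_mul {i j n} h h₁ h₂ x y := by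
    obtain ⟨m, rfl⟩ : ∃ m, n = m + 1 := ⟨i + j, by omega⟩
    exact Subsingleton.elim _ _
  d_mul_zero {i n} h h' x y := by
    change 0 = singleMul k A i 0 n h' 0 y
    simp
  d_zero_mul {i n} h h' x y := by
    change 0 = singleMul k A 0 i n h' x 0
    simp

end DGAlg

/-! ### Quotients, truncations -/

/-- The quotient of a complex by a subcomplex. -/
def quotCx {k : Type u} [Field k] (C : ChainComplex (ModuleCat.{u} k) ℕ)
    (I : ∀ n, Submodule k (C.X n)) (hI : ∀ i j, I i ≤ (I j).comap (C.d i j).hom) :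
    ChainComplex (ModuleCat.{u} k) ℕ where
  X n := ModuleCat.of k (C.X n ⧸ I n)
  d i j := ModuleCat.ofHom (Submodule.mapQ (I i) (I j) (C.d i j).hom (hI i j))
  shape i j h := by
    ext x
    simp [C.shape i j h]
  d_comp_d' i j l _ _ := by
    ext x
    simp [← ModuleCat.comp_apply]

/-- The map of quotients induced by a map of complexes. -/
def quotCxMap {k : Type u} [Field k] {C D : ChainComplex (ModuleCat.{u} k) ℕ} (f : C ⟶ D)
    {I : ∀ n, Submodule k (C.X n)} (hI : ∀ i j, I i ≤ (I j).comap (C.d i j).hom)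
    {J : ∀ n, Submodule k (D.X n)} (hJ : ∀ i j, J i ≤ (J j).comap (D.d i j).hom)
    (hf : ∀ n, I n ≤ (J n).comap (f.f n).hom) : quotCx C I hI ⟶ quotCx D J hJ where
  f n := ModuleCat.ofHom (Submodule.mapQ (I n) (J n) (f.f n).hom (hf n))
  comm' i j _ := by
    refine ModuleCat.hom_ext (Submodule.linearMap_qext _ (LinearMap.ext fun x => ?_))
    exact congrArg (fun g => (Submodule.Quotient.mk (g.hom x) : D.X j ⧸ J j)) (f.comm i j)

namespace DGAlg

variable {k : Type u} [Field k]

/-- A two-sided DG ideal. -/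
structure DGIdeal (B : DGAlg k) where
  /-- the homogeneous components -/
  I : ∀ n, Submodule k (B.cx.X n)
  d_mem : ∀ i j, I i ≤ (I j).comap (B.cx.d i j).hom
  mul_left : ∀ {i j n : ℕ} (h : i + j = n) (x : B.cx.X i) (y : B.cx.X j), y ∈ I j →
    B.mul h x y ∈ I n
  mul_right : ∀ {i j n : ℕ} (h : i + j = n) (x : B.cx.X i) (y : B.cx.X j), x ∈ I i →
    B.mul h x y ∈ I n

/-- The product on the quotient by a DG ideal. -/
def quotMul {B : DGAlg k} (J : DGIdeal B) {i j n : ℕ} (h : i + j = n) :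
    (B.cx.X i ⧸ J.I i) →ₗ[k] (B.cx.X j ⧸ J.I j) →ₗ[k] (B.cx.X n ⧸ J.I n) :=
  (J.I i).liftQ
    { toFun := fun x => (J.I j).mapQ (J.I n) (B.mul h x) (fun y hy => J.mul_left h x y hy)
      map_add' := fun x y => by
        refine Submodule.linearMap_qext _ (LinearMap.ext fun z => ?_)
        simp
      map_smul' := fun c x => by
        refine Submodule.linearMap_qext _ (LinearMap.ext fun z => ?_)
        simp }
    (by
      intro x hx
      refine Submodule.linearMap_qext _ (LinearMap.ext fun z => ?_)
      simpa using J.mul_right h x z hx)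

/-- The quotient of a DG algebra by a DG ideal. -/
def quot (B : DGAlg k) (J : DGIdeal B) : DGAlg k where
  cx := quotCx B.cx J.I J.d_mem
  one := Submodule.Quotient.mk B.one
  mul h := quotMul J h
  one_mul {n} h x := by
    obtain ⟨x, rfl⟩ := Submodule.Quotient.mk_surjective _ x
    exact congrArg Submodule.Quotient.mk (B.one_mul h x)
  mul_one {n} h x := by
    obtain ⟨x, rfl⟩ := Submodule.Quotient.mk_surjective _ x
    exact congrArg Submodule.Quotient.mk (B.mul_one h x)
  mul_assoc h₁ h₂ h₃ h₄ x y z := by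
    obtain ⟨x, rfl⟩ := Submodule.Quotient.mk_surjective _ x
    obtain ⟨y, rfl⟩ := Submodule.Quotient.mk_surjective _ y
    obtain ⟨z, rfl⟩ := Submodule.Quotient.mk_surjective _ z
    exact congrArg Submodule.Quotient.mk (B.mul_assoc h₁ h₂ h₃ h₄ x y z)
  d_mul h h₁ h₂ x y := by
    obtain ⟨x, rfl⟩ := Submodule.Quotient.mk_surjective _ x
    obtain ⟨y, rfl⟩ := Submodule.Quotient.mk_surjective _ y
    exact congrArg Submodule.Quotient.mk (B.d_mul h h₁ h₂ x y)
  d_mul_zero h h' x y := by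
    obtain ⟨x, rfl⟩ := Submodule.Quotient.mk_surjective _ x
    obtain ⟨y, rfl⟩ := Submodule.Quotient.mk_surjective _ y
    exact congrArg Submodule.Quotient.mk (B.d_mul_zero h h' x y)
  d_zero_mul h h' x y := by
    obtain ⟨x, rfl⟩ := Submodule.Quotient.mk_surjective _ x
    obtain ⟨y, rfl⟩ := Submodule.Quotient.mk_surjective _ y
    exact congrArg Submodule.Quotient.mk (B.d_zero_mul h h' x y)

/-- The map of quotients induced by a DG algebra map. -/
def quotMap {B C : DGAlg k} (φ : B ⟶ C) (I : DGIdeal B) (J : DGIdeal C)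
    (h : ∀ n, I.I n ≤ (J.I n).comap (φ.f.f n).hom) : B.quot I ⟶ C.quot J :=
  Hom.mk (quotCxMap φ.f I.d_mem J.d_mem h)
    (congrArg Submodule.Quotient.mk φ.map_one)
    (by
      intro i j n hij x y
      obtain ⟨x, rfl⟩ := Submodule.Quotient.mk_surjective _ x
      obtain ⟨y, rfl⟩ := Submodule.Quotient.mk_surjective _ y
      exact congrArg Submodule.Quotient.mk (φ.map_mul hij x y))

/-- The map from a quotient induced by a DG algebra map that kills the ideal. -/
def quotLift {B C : DGAlg k} (φ : B ⟶ C) (I : DGIdeal B)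
    (h : ∀ n, I.I n ≤ LinearMap.ker (φ.f.f n).hom) : B.quot I ⟶ C :=
  Hom.mk
    { f := fun n => ModuleCat.ofHom ((I.I n).liftQ (φ.f.f n).hom (h n))
      comm' := fun i j _ => by
        refine ModuleCat.hom_ext (Submodule.linearMap_qext _ (LinearMap.ext fun x => ?_))
        exact congrArg (fun g => g.hom x) (φ.f.comm i j) }
    (by exact φ.map_one)
    (by
      intro i j n hij x y
      obtain ⟨x, rfl⟩ := Submodule.Quotient.mk_surjective _ x
      obtain ⟨y, rfl⟩ := Submodule.Quotient.mk_surjective _ y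
      exact φ.map_mul hij x y)

end DGAlg

/-- The subcomplex by which one divides to get the `l`-th canonical truncation: it is `0` in
degrees `≤ l`, the kernel of the differential in degree `l + 1`, everything above. -/
def truncSub {k : Type u} [Field k] (C : ChainComplex (ModuleCat.{u} k) ℕ) (l n : ℕ) :
    Submodule k (C.X n) :=
  if n ≤ l then ⊥ else if n = l + 1 then LinearMap.ker (C.d n l).hom else ⊤

/-- The subcomplex by which one divides `C` to get the two-term complex
`C₁ / Im d → C₀`. -/
def flatSub {k : Type u} [Field k] (C : ChainComplex (ModuleCat.{u} k) ℕ) (n : ℕ) :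
    Submodule k (C.X n) :=
  if n = 0 then ⊥ else if n = 1 then LinearMap.range (C.d 2 n).hom else ⊤

section

variable {k : Type u} [Field k]

theorem d_d_apply (C : ChainComplex (ModuleCat.{u} k) ℕ) (i j l : ℕ) (x : C.X i) :
    (C.d j l).hom ((C.d i j).hom x) = 0 :=
  congrArg (fun g => g.hom x) (C.d_comp_d i j l)

theorem d_eq_zero (C : ChainComplex (ModuleCat.{u} k) ℕ) {i j : ℕ} (h : j + 1 ≠ i) (x : C.X i) :
    (C.d i j).hom x = 0 := by
  rw [C.shape i j h]; rfl

theorem truncSub_d (C : ChainComplex (ModuleCat.{u} k) ℕ) (l i j : ℕ) :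
    truncSub C l i ≤ (truncSub C l j).comap (C.d i j).hom := by
  intro x hx
  rw [Submodule.mem_comap]
  by_cases hij : j + 1 = i
  · subst hij
    unfold truncSub at hx ⊢
    split_ifs at hx ⊢ with h₁ h₂ h₃ h₄ h₅ h₆ h₇
    all_goals first | omega | skip
    · rw [(Submodule.mem_bot k).1 hx, map_zero]; exact Submodule.zero_mem _
    · obtain rfl : j = l := by omega
      exact hx
    · subst h₄
      exact d_d_apply C _ _ _ x
    · trivial
  · rw [d_eq_zero C hij]; exact Submodule.zero_mem _

theorem flatSub_d (C : ChainComplex (ModuleCat.{u} k) ℕ) (i j : ℕ) :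
    flatSub C i ≤ (flatSub C j).comap (C.d i j).hom := by
  intro x hx
  rw [Submodule.mem_comap]
  by_cases hij : j + 1 = i
  · subst hij
    rcases j with _ | _ | j
    · obtain ⟨y, rfl⟩ : x ∈ LinearMap.range (C.d 2 1).hom := hx
      rw [d_d_apply]; exact Submodule.zero_mem _
    · exact ⟨x, rfl⟩
    · trivial
  · rw [d_eq_zero C hij]; exact Submodule.zero_mem _

theorem truncSub_map {C D : ChainComplex (ModuleCat.{u} k) ℕ} (f : C ⟶ D) (l n : ℕ) :
    truncSub C l n ≤ (truncSub D l n).comap (f.f n).hom := by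
  intro x hx
  rw [Submodule.mem_comap]
  unfold truncSub at hx ⊢
  split_ifs at hx ⊢ with h₁ h₂
  · rw [(Submodule.mem_bot k).1 hx, map_zero]; exact Submodule.zero_mem _
  · have := congrArg (fun g => g.hom x) (f.comm n l)
    have hx' : (C.d n l).hom x = 0 := hx
    simp only [ModuleCat.hom_comp, LinearMap.comp_apply, hx', map_zero] at this
    exact this
  · trivial

theorem flatSub_map {C D : ChainComplex (ModuleCat.{u} k) ℕ} (f : C ⟶ D) (n : ℕ) :
    flatSub C n ≤ (flatSub D n).comap (f.f n).hom := by
  intro x hx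
  rw [Submodule.mem_comap]
  unfold flatSub at hx ⊢
  split_ifs at hx ⊢ with h₁ h₂
  · rw [(Submodule.mem_bot k).1 hx, map_zero]; exact Submodule.zero_mem _
  · obtain ⟨y, rfl⟩ := hx
    exact ⟨(f.f 2).hom y, congrArg (fun g => g.hom y) (f.comm 2 n)⟩
  · trivial

/-- The two-term quotient `C₁ / Im d → C₀` of a complex. -/
def flatCx (C : ChainComplex (ModuleCat.{u} k) ℕ) : ChainComplex (ModuleCat.{u} k) ℕ :=
  quotCx C (flatSub C) (flatSub_d C)

/-- Functoriality of the two-term quotient. -/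
def flatCxMap {C D : ChainComplex (ModuleCat.{u} k) ℕ} (f : C ⟶ D) : flatCx C ⟶ flatCx D :=
  quotCxMap f _ _ (flatSub_map f)

/-- The DG ideal that defines the `l`-th canonical truncation of a DG algebra. -/
def DGAlg.truncIdeal (B : DGAlg k) (l : ℕ) : DGAlg.DGIdeal B where
  I := truncSub B.cx l
  d_mem := truncSub_d B.cx l
  mul_left {i j n} h x y hy := by
    unfold truncSub at hy ⊢
    split_ifs at hy ⊢ with h₁ h₂ h₃ h₄ h₅ h₆ h₇
    all_goals first | omega | trivial | skip
    · rw [(Submodule.mem_bot k).1 hy, map_zero]; exact Submodule.zero_mem _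
    · rw [(Submodule.mem_bot k).1 hy, map_zero]; exact Submodule.zero_mem _
    · obtain rfl : i = 0 := by omega
      subst h₆
      obtain rfl : n = l + 1 := by omega
      have hy' : (B.cx.d (l + 1) l).hom y = 0 := hy
      rw [LinearMap.mem_ker, B.d_zero_mul h (by omega), hy', map_zero]
  mul_right {i j n} h x y hx := by
    unfold truncSub at hx ⊢
    split_ifs at hx ⊢ with h₁ h₂ h₃ h₄ h₅ h₆ h₇
    all_goals first | omega | trivial | skip
    · rw [(Submodule.mem_bot k).1 hx, map_zero]; exact Submodule.zero_mem _
    · rw [(Submodule.mem_bot k).1 hx, map_zero]; exact Submodule.zero_mem _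
    · obtain rfl : j = 0 := by omega
      subst h₆
      obtain rfl : n = l + 1 := by omega
      have hx' : (B.cx.d (l + 1) l).hom x = 0 := hx
      rw [LinearMap.mem_ker, B.d_mul_zero h (by omega), hx', map_zero]; rfl

/-- The DG ideal that defines the two-term quotient of a DG algebra. -/
def DGAlg.flatIdeal (B : DGAlg k) : DGAlg.DGIdeal B where
  I := flatSub B.cx
  d_mem := flatSub_d B.cx
  mul_left {i j n} h x y hy := by
    rcases n with _ | _ | n
    · obtain ⟨rfl, rfl⟩ : i = 0 ∧ j = 0 := by omega
      rw [(Submodule.mem_bot k).1 hy, map_zero]; exact Submodule.zero_mem _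
    · rcases j with _ | _ | j
      · rw [(Submodule.mem_bot k).1 hy, map_zero]; exact Submodule.zero_mem _
      · obtain rfl : i = 0 := by omega
        obtain ⟨z, rfl⟩ : y ∈ LinearMap.range (B.cx.d 2 1).hom := hy
        exact ⟨B.mul (by omega) x z, B.d_zero_mul (by omega) h x z⟩
      · omega
    · trivial
  mul_right {i j n} h x y hx := by
    rcases n with _ | _ | n
    · obtain ⟨rfl, rfl⟩ : i = 0 ∧ j = 0 := by omega
      rw [(Submodule.mem_bot k).1 hx, map_zero]; exact Submodule.zero_mem _
    · rcases i with _ | _ | i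
      · rw [(Submodule.mem_bot k).1 hx, map_zero]; exact Submodule.zero_mem _
      · obtain rfl : j = 0 := by omega
        obtain ⟨z, rfl⟩ : x ∈ LinearMap.range (B.cx.d 2 1).hom := hx
        exact ⟨B.mul (by omega) z y, B.d_mul_zero (by omega) h z y⟩
      · omega
    · trivial

/-- The `l`-th canonical truncation of a DG algebra. -/
def DGAlg.trunc (B : DGAlg k) (l : ℕ) : DGAlg k := B.quot (B.truncIdeal l)

/-- The two-term quotient of a DG algebra. -/
def DGAlg.flat (B : DGAlg k) : DGAlg k := B.quot B.flatIdeal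

end

/-! ### The cube construction as a complex and as a DG algebra -/

section

variable (k : Type u) [Field k]

/-- The complex `Q̄(V)`. -/
def QBarCx (V : Type u) [AddCommGroup V] [Module k V] : ChainComplex (ModuleCat.{u} k) ℕ :=
  ChainComplex.of (fun n => ModuleCat.of k (QBar k V n)) (fun n => ModuleCat.ofHom (QBar.d k V n))
    (fun n => by rw [← ModuleCat.ofHom_comp, QBar.d_comp_d]; rfl)

theorem QBarCx_d (V : Type u) [AddCommGroup V] [Module k V] (n : ℕ) :
    (QBarCx k V).d (n + 1) n = ModuleCat.ofHom (QBar.d k V n) :=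
  ChainComplex.of_d (fun n => ModuleCat.of k (QBar k V n))
    (fun n => ModuleCat.ofHom (QBar.d k V n)) n

theorem QBarCx_d_apply (V : Type u) [AddCommGroup V] [Module k V] (n : ℕ) (x : QBar k V (n + 1)) :
    ((QBarCx k V).d (n + 1) n).hom x = QBar.d k V n x := by
  rw [QBarCx_d]; rfl

variable {k} in
theorem QBar.map_d {V W : Type u} [AddCommGroup V] [Module k V] [AddCommGroup W] [Module k W]
    (g : V →ₗ[k] W) (n : ℕ) : QBar.d k W n ∘ₗ QBar.map g (n + 1) = QBar.map g n ∘ₗ QBar.d k V n := by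
  refine QBar.hom_ext fun f => ?_
  simp only [LinearMap.comp_apply, QBar.d, LinearMap.sum_apply, LinearMap.smul_apply, map_sum,
    map_smul, QBar.map_mk, QBar.partialD_mk, map_sub]
  refine Finset.sum_congr rfl fun j _ => ?_
  congr 3
  congr 1
  funext x
  exact (map_add g _ _).symm

variable {k} in
/-- Functoriality of the complex `Q̄(V)`. -/
def QBarCxMap {V W : Type u} [AddCommGroup V] [Module k V] [AddCommGroup W] [Module k W]
    (g : V →ₗ[k] W) : QBarCx k V ⟶ QBarCx k W where
  f n := ModuleCat.ofHom (QBar.map g n)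
  comm' i j h := by
    obtain rfl : j + 1 = i := h
    rw [QBarCx_d, QBarCx_d]
    ext x
    exact LinearMap.congr_fun (QBar.map_d g j) x

/-- The two-term complex `V♭`: `V♭₀ = Q̄₀(V)`, `V♭₁ = Q̄₁(V) / Im d`. -/
abbrev flatV (V : Type u) [AddCommGroup V] [Module k V] : ChainComplex (ModuleCat.{u} k) ℕ :=
  flatCx (QBarCx k V)

variable {k} in
/-- Functoriality of `V♭`. -/
abbrev flatVMap {V W : Type u} [AddCommGroup V] [Module k V] [AddCommGroup W] [Module k W]
    (g : V →ₗ[k] W) : flatV k V ⟶ flatV k W :=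
  flatCxMap (QBarCxMap g)

/-- The DG algebra `Q̄(A)`; its unit is the class of `1 ∈ A`. -/
def QBarAlg (A : Type u) [Ring A] [Algebra k A] : DGAlg k where
  cx := QBarCx k A
  one := QBar.mk k (fun _ => 1)
  mul h := QBar.mul k A h
  one_mul h x := QBar.one_mul' h x
  mul_one h x := QBar.mul_one' h x
  mul_assoc h₁ h₂ h₃ h₄ x y z := QBar.mul_assoc' h₁ h₂ h₃ h₄ x y z
  d_mul h h₁ h₂ x y := by
    rw [QBarCx_d, QBarCx_d, QBarCx_d]
    exact QBar.d_mul h h₁ h₂ x y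
  d_mul_zero h h' x y := by
    rw [QBarCx_d, QBarCx_d]
    exact QBar.d_mul_zero h h' x y
  d_zero_mul h h' x y := by
    rw [QBarCx_d, QBarCx_d]
    exact QBar.d_zero_mul h h' x y

variable {k} in
theorem QBar.map_mul {A B : Type u} [Ring A] [Algebra k A] [Ring B] [Algebra k B] (g : A →ₐ[k] B)
    {i j n : ℕ} (h : i + j = n) (x : QBar k A i) (y : QBar k A j) :
    QBar.map g.toLinearMap n (QBar.mul k A h x y) =
      QBar.mul k B h (QBar.map g.toLinearMap i x) (QBar.map g.toLinearMap j y) := by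
  induction x using QBar.induction_on with
  | hadd a b ha hb => simp only [map_add, LinearMap.add_apply, ha, hb]
  | hsmul c a ha => simp only [map_smul, LinearMap.smul_apply, ha]
  | hmk f =>
  induction y using QBar.induction_on with
  | hadd a b ha hb => simp only [map_add, ha, hb]
  | hsmul c a ha => simp only [map_smul, ha]
  | hmk e =>
  rw [QBar.mul_mk, QBar.map_mk, QBar.map_mk, QBar.map_mk, QBar.mul_mk]
  congr 1
  funext x
  exact _root_.map_mul g _ _

variable {k} in
/-- Functoriality of the DG algebra `Q̄(A)`. -/
def QBarAlgMap {A B : Type u} [Ring A] [Algebra k A] [Ring B] [Algebra k B] (g : A →ₐ[k] B) :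
    QBarAlg k A ⟶ QBarAlg k B :=
  DGAlg.Hom.mk (QBarCxMap g.toLinearMap)
    (by
      refine (QBar.map_mk _ _).trans ?_
      change QBar.mk k _ = QBar.mk k _
      congr 1
      funext x
      exact map_one g)
    (fun h x y => QBar.map_mul g h x y)

/-- The degree `0` part of the augmentation, `[v] ↦ v`. -/
def QBar.aug₀ (V : Type u) [AddCommGroup V] [Module k V] : QBar k V 0 →ₗ[k] V :=
  QBar.lift (fun f => f Fin.elim0) rfl (fun _ ⟨i, _⟩ => i.elim0) (fun _ _ => rfl)

/-- The terms of the augmentation `Q̄(A) → A`. -/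
def augTerm (A : Type u) [Ring A] [Algebra k A] : ∀ n : ℕ, QBar k A n →ₗ[k] DGAlg.singleX k A n
  | 0 => QBar.aug₀ k A
  | _ + 1 => 0

theorem QBar.aug₀_d (V : Type u) [AddCommGroup V] [Module k V] :
    QBar.aug₀ k V ∘ₗ QBar.d k V 0 = 0 := by
  refine QBar.hom_ext fun f => ?_
  simp [QBar.aug₀, QBar.d, QBar.partialD_mk]

theorem QBar.aug₀_one (A : Type u) [Ring A] [Algebra k A] :
    QBar.aug₀ k A (QBar.mk k (fun _ => 1)) = 1 :=
  QBar.lift_mk ..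

theorem QBar.aug₀_mul (A : Type u) [Ring A] [Algebra k A] (h : 0 + 0 = 0) (x y : QBar k A 0) :
    QBar.aug₀ k A (QBar.mul k A h x y) = QBar.aug₀ k A x * QBar.aug₀ k A y := by
  induction x using QBar.induction_on with
  | hadd a b ha hb => simp only [map_add, LinearMap.add_apply, ha, hb, add_mul]
  | hsmul c a ha => simp only [map_smul, LinearMap.smul_apply, ha, smul_mul_assoc]
  | hmk f =>
  induction y using QBar.induction_on with
  | hadd a b ha hb => simp only [map_add, ha, hb, mul_add]
  | hsmul c a ha => simp only [map_smul, ha, mul_smul_comm]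
  | hmk g =>
  rw [QBar.mul_mk, QBar.aug₀, QBar.lift_mk, QBar.lift_mk, QBar.lift_mk, QBar.Cube.mul]
  congr 1

/-- The augmentation `Q̄(A) → A`. -/
def aug (A : Type u) [Ring A] [Algebra k A] : QBarAlg k A ⟶ DGAlg.single k A :=
  DGAlg.Hom.mk
    { f := fun n => ModuleCat.ofHom (augTerm k A n)
      comm' := fun i j h => by
        obtain rfl : j + 1 = i := h
        refine ModuleCat.hom_ext (LinearMap.ext fun x => ?_)
        cases j with
        | zero =>
          refine ((congrArg (QBar.aug₀ k A) (QBarCx_d_apply k A 0 x)).trans ?_).symm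
          exact LinearMap.congr_fun (QBar.aug₀_d k A) x
        | succ j => rfl }
    (QBar.aug₀_one k A)
    (by
      intro i j n h x y
      cases n with
      | succ n => exact Subsingleton.elim (α := DGAlg.singleX k A (n + 1)) _ _
      | zero =>
        obtain ⟨rfl, rfl⟩ : i = 0 ∧ j = 0 := by omega
        exact QBar.aug₀_mul k A h x y)

theorem QBar.map_id (V : Type u) [AddCommGroup V] [Module k V] (n : ℕ) :
    QBar.map (LinearMap.id : V →ₗ[k] V) n = LinearMap.id :=
  QBar.hom_ext fun f => by simp

variable {k} in
theorem QBar.map_comp {U V W : Type u} [AddCommGroup U] [Module k U] [AddCommGroup V] [Module k V]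
    [AddCommGroup W] [Module k W] (f : U →ₗ[k] V) (g : V →ₗ[k] W) (n : ℕ) :
    QBar.map (g ∘ₗ f) n = QBar.map g n ∘ₗ QBar.map f n :=
  QBar.hom_ext fun f => by simp

/-- The truncation `Q̄_{≤ l}(A)`, as a functor of the algebra `A`. -/
def QBarLE (l : ℕ) : AlgCat.{u} k ⥤ DGAlg k where
  obj A := (QBarAlg k A).trunc l
  map g := DGAlg.quotMap (QBarAlgMap g.hom) _ _ (fun n => truncSub_map _ l n)
  map_id A := by
    refine DGAlg.hom_ext (HomologicalComplex.hom_ext _ _ fun n => ?_)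
    refine ModuleCat.hom_ext (Submodule.linearMap_qext _ (LinearMap.ext fun x => ?_))
    exact congrArg Submodule.Quotient.mk (LinearMap.congr_fun (QBar.map_id k A n) x)
  map_comp f g := by
    refine DGAlg.hom_ext (HomologicalComplex.hom_ext _ _ fun n => ?_)
    refine ModuleCat.hom_ext (Submodule.linearMap_qext _ (LinearMap.ext fun x => ?_))
    exact congrArg Submodule.Quotient.mk
      (LinearMap.congr_fun (QBar.map_comp f.hom.toLinearMap g.hom.toLinearMap n) x)

/-- The augmentation `Q̄_{≤ l}(A) → A`. -/
def augLE (l : ℕ) (A : Type u) [Ring A] [Algebra k A] : (QBarAlg k A).trunc l ⟶ DGAlg.single k A :=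
  DGAlg.quotLift (aug k A) _ (fun n x hx => by
    cases n with
    | zero =>
      have hx' : x ∈ truncSub (QBarCx k A) l 0 := hx
      rw [truncSub, if_pos (Nat.zero_le l)] at hx'
      have hx0 : x = 0 := hx'
      subst hx0
      exact Submodule.zero_mem _
    | succ n => exact Subsingleton.elim (α := DGAlg.singleX k A (n + 1)) _ _)

/-- The two-term DG algebra `A♭`. -/
abbrev flatA (A : Type u) [Ring A] [Algebra k A] : DGAlg k := (QBarAlg k A).flat

end

/-! ### Splittings of two-term complexes -/

/-- The maps `a : K₀₁ → K₀` and `b : K₁ → K₀₁` make `K₀₁` a splitting of the two-term complex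
`d : K₁ → K₀`. -/
structure IsSplitting {k : Type u} [Field k] {K₁ K₀ K₀₁ : Type u} [AddCommGroup K₁] [Module k K₁]
    [AddCommGroup K₀] [Module k K₀] [AddCommGroup K₀₁] [Module k K₀₁] (d : K₁ →ₗ[k] K₀)
    (a : K₀₁ →ₗ[k] K₀) (b : K₁ →ₗ[k] K₀₁) : Prop where
  surjective : Function.Surjective a
  injective : Function.Injective b
  comp : a ∘ₗ b = d
  /-- `b` induces an isomorphism `Ker d → Ker a` -/
  ker : Set.BijOn b (LinearMap.ker d) (LinearMap.ker a)
  /-- `a` induces an isomorphism `Coker b → Coker d` -/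
  coker : Function.Bijective ((LinearMap.range b).mapQ (LinearMap.range d) a (by
    rintro _ ⟨x, rfl⟩
    exact ⟨x, by rw [← comp]; rfl⟩))

/-- A splitting of a complex `C` of `k`-vector spaces concentrated in degrees `0` and `1`. -/
structure Spl {k : Type u} [Field k] (C : ChainComplex (ModuleCat.{u} k) ℕ) where
  /-- the object `K₀₁` -/
  carrier : Type u
  [addCommGroup : AddCommGroup carrier]
  [module : Module k carrier]
  /-- the map `K₀₁ → K₀` -/
  a : carrier →ₗ[k] C.X 0
  /-- the map `K₁ → K₀₁` -/
  b : C.X 1 →ₗ[k] carrier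
  isSplitting : IsSplitting (C.d 1 0).hom a b

attribute [instance] Spl.addCommGroup Spl.module

namespace Spl

variable {k : Type u} [Field k]

/-- Isomorphisms of splittings. -/
@[ext]
structure Hom {C : ChainComplex (ModuleCat.{u} k) ℕ} (S T : Spl C) where
  /-- the underlying isomorphism -/
  e : S.carrier ≃ₗ[k] T.carrier
  comm_a : ∀ x, T.a (e x) = S.a x
  comm_b : ∀ y, e (S.b y) = T.b y

/-- The groupoid of splittings of `C`. -/
instance (C : ChainComplex (ModuleCat.{u} k) ℕ) : Groupoid (Spl C) where
  Hom := Hom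
  id S := ⟨LinearEquiv.refl k _, fun _ => rfl, fun _ => rfl⟩
  comp φ ψ := ⟨φ.e.trans ψ.e, by simp [φ.comm_a, ψ.comm_a], by simp [φ.comm_b, ψ.comm_b]⟩
  inv φ := ⟨φ.e.symm, fun x => by rw [← φ.comm_a]; simp, fun y => by rw [← φ.comm_b]; simp⟩
  inv_comp φ := Hom.ext (LinearEquiv.ext fun x => by simp)
  comp_inv φ := Hom.ext (LinearEquiv.ext fun x => by simp)

/-- Maps from a splitting of `C` to a splitting of `D` over a map of complexes `f : C ⟶ D`. -/
@[ext]
structure HomOver {C D : ChainComplex (ModuleCat.{u} k) ℕ} (f : C ⟶ D) (S : Spl C) (T : Spl D) where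
  /-- the underlying linear map -/
  φ : S.carrier →ₗ[k] T.carrier
  comm_a : ∀ x, T.a (φ x) = (f.f 0).hom (S.a x)
  comm_b : ∀ y, φ (S.b y) = T.b ((f.f 1).hom y)

end Spl

/-- A multiplicative splitting of a DG algebra `B` concentrated in degrees `0` and `1`: the
splitting `K₀₁` is an algebra, `a` is an algebra map, and `b` is a map of `K₀₁`-bimodules. -/
structure MulSpl {k : Type u} [Field k] (B : DGAlg k) where
  /-- the algebra `K₀₁` -/
  carrier : Type u
  [ring : Ring carrier]
  [algebra : Algebra k carrier]
  /-- the map `K₀₁ → K₀` -/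
  a : carrier →ₗ[k] B.cx.X 0
  /-- the map `K₁ → K₀₁` -/
  b : B.cx.X 1 →ₗ[k] carrier
  isSplitting : IsSplitting (B.cx.d 1 0).hom a b
  map_one : a 1 = B.one
  map_mul : ∀ x y, a (x * y) = B.mul (zero_add 0) (a x) (a y)
  left : ∀ x m, b (B.mul (zero_add 1) (a x) m) = x * b m
  right : ∀ x m, b (B.mul (add_zero 1) m (a x)) = b m * x

attribute [instance] MulSpl.ring MulSpl.algebra

namespace MulSpl

variable {k : Type u} [Field k] {B : DGAlg k}

/-- Isomorphisms of multiplicative splittings. -/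
@[ext]
structure Hom (S T : MulSpl B) where
  /-- the underlying isomorphism -/
  e : S.carrier ≃ₐ[k] T.carrier
  comm_a : ∀ x, T.a (e x) = S.a x
  comm_b : ∀ y, e (S.b y) = T.b y

/-- The groupoid of multiplicative splittings of `B`. -/
instance : Groupoid (MulSpl B) where
  Hom := Hom
  id S := ⟨AlgEquiv.refl, fun _ => rfl, fun _ => rfl⟩
  comp φ ψ := ⟨φ.e.trans ψ.e, by simp [φ.comm_a, ψ.comm_a], by simp [φ.comm_b, ψ.comm_b]⟩
  inv φ := ⟨φ.e.symm, fun x => by rw [← φ.comm_a]; simp, fun y => by rw [← φ.comm_b]; simp⟩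
  inv_comp φ := Hom.ext (AlgEquiv.ext fun x => by simp)
  comp_inv φ := Hom.ext (AlgEquiv.ext fun x => by simp)

/-- Forget the product. -/
def forget (B : DGAlg k) : MulSpl B ⥤ Spl B.cx where
  obj S := { carrier := S.carrier, a := S.a, b := S.b, isSplitting := S.isSplitting }
  map φ := Spl.Hom.mk φ.e.toLinearEquiv φ.comm_a φ.comm_b

end MulSpl

/-- Multiplicative splittings of `A♭` are splittings of the underlying complex `A♭`. -/
def forgetFlat (k : Type u) [Field k] (A : Type u) [Ring A] [Algebra k A] :
    MulSpl (flatA k A) ⥤ Spl (flatV k A) :=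
  MulSpl.forget (flatA k A)

/-! ### Liftings to the second Witt vectors -/

/-- The ring `W₂(k)` of Witt vectors of length two. -/
abbrev W₂ (p : ℕ) (k : Type u) : Type u := TruncatedWittVector p 2 k

/-- The reduction map `W₂(k) → k`, `(x₀, x₁) ↦ x₀`. -/
def residue (p : ℕ) [Fact p.Prime] (k : Type u) [CommRing k] : W₂ p k →+* k where
  toFun x := x.coeff 0
  map_one' := by
    have h := WittVector.coeff_truncate (p := p) (n := 2) (1 : WittVector p k) 0
    rw [_root_.map_one] at h
    simpa using h
  map_zero' := by simp
  map_mul' x y := by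
    obtain ⟨x, rfl⟩ := WittVector.truncate_surjective p 2 k x
    obtain ⟨y, rfl⟩ := WittVector.truncate_surjective p 2 k y
    rw [← _root_.map_mul]
    simp only [WittVector.coeff_truncate]
    exact WittVector.mul_coeff_zero x y
  map_add' x y := by
    obtain ⟨x, rfl⟩ := WittVector.truncate_surjective p 2 k x
    obtain ⟨y, rfl⟩ := WittVector.truncate_surjective p 2 k y
    rw [← map_add]
    simp only [WittVector.coeff_truncate]
    exact WittVector.add_coeff_zero x y

/-- A flat lifting of the `k`-vector space `V` to `W₂(k)`: a flat `W₂(k)`-module `V'` with an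
identification `V' / p ≅ V`, given as a surjective map `V' → V`, linear over `W₂(k) → k`, with
kernel `p V'`. -/
structure Lift (p : ℕ) [Fact p.Prime] (k : Type u) [Field k] (V : Type u) [AddCommGroup V]
    [Module k V] where
  /-- the lifting `V'` -/
  carrier : Type u
  [addCommGroup : AddCommGroup carrier]
  [module : Module (W₂ p k) carrier]
  flat : Module.Flat (W₂ p k) carrier
  /-- the reduction `V' → V` -/
  proj : carrier →ₛₗ[residue p k] V
  surjective : Function.Surjective proj
  ker : ∀ x, proj x = 0 ↔ ∃ y : carrier, x = (p : W₂ p k) • y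

attribute [instance] Lift.addCommGroup Lift.module

namespace Lift

variable {p : ℕ} [Fact p.Prime] {k : Type u} [Field k] {V W : Type u} [AddCommGroup V]
  [Module k V] [AddCommGroup W] [Module k W]

/-- Isomorphisms of liftings. -/
@[ext]
structure Hom (L M : Lift p k V) where
  /-- the underlying isomorphism -/
  e : L.carrier ≃ₗ[W₂ p k] M.carrier
  comm : ∀ x, M.proj (e x) = L.proj x

/-- The groupoid of flat liftings of `V`. -/
instance : Groupoid (Lift p k V) where
  Hom := Hom
  id L := ⟨LinearEquiv.refl _ _, fun _ => rfl⟩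
  comp φ ψ := ⟨φ.e.trans ψ.e, by simp [φ.comm, ψ.comm]⟩
  inv φ := ⟨φ.e.symm, fun x => by rw [← φ.comm]; simp⟩
  inv_comp φ := Hom.ext (LinearEquiv.ext fun x => by simp)
  comp_inv φ := Hom.ext (LinearEquiv.ext fun x => by simp)

/-- Maps from a lifting of `V` to a lifting of `W` over a linear map `f : V → W`. -/
@[ext]
structure HomOver (f : V →ₗ[k] W) (L : Lift p k V) (M : Lift p k W) where
  /-- the underlying linear map -/
  φ : L.carrier →ₗ[W₂ p k] M.carrier
  comm : ∀ x, M.proj (φ x) = f (L.proj x)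

/-- An isomorphism of liftings of `V`, as a map over the identity of `V`. -/
def Hom.toHomOver {L M : Lift p k V} (g : L ⟶ M) : HomOver LinearMap.id L M :=
  ⟨g.e.toLinearMap, g.comm⟩

/-- Composition of maps of liftings. -/
def HomOver.comp {U : Type u} [AddCommGroup U] [Module k U] {f : U →ₗ[k] V} {g : V →ₗ[k] W}
    {L : Lift p k U} {M : Lift p k V} {N : Lift p k W} (ψ : HomOver g M N) (φ : HomOver f L M) :
    HomOver (g ∘ₗ f) L N :=
  ⟨ψ.φ ∘ₗ φ.φ, fun x => by simp [ψ.comm, φ.comm]⟩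

end Lift

/-- A flat lifting of the `k`-algebra `A` to `W₂(k)`: a flat `W₂(k)`-algebra `A'` with an
identification of algebras `A' / p ≅ A`. -/
structure AlgLift (p : ℕ) [Fact p.Prime] (k : Type u) [Field k] (A : Type u) [Ring A]
    [Algebra k A] where
  /-- the lifting `A'` -/
  carrier : Type u
  [ring : Ring carrier]
  [algebra : Algebra (W₂ p k) carrier]
  flat : Module.Flat (W₂ p k) carrier
  /-- the reduction `A' → A` -/
  proj : carrier →+* A
  proj_algebraMap : ∀ w, proj (algebraMap (W₂ p k) carrier w) = algebraMap k A (residue p k w)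
  surjective : Function.Surjective proj
  ker : ∀ x, proj x = 0 ↔ ∃ y : carrier, x = (p : W₂ p k) • y

attribute [instance] AlgLift.ring AlgLift.algebra

namespace AlgLift

variable {p : ℕ} [Fact p.Prime] {k : Type u} [Field k] {A : Type u} [Ring A] [Algebra k A]

/-- Isomorphisms of algebra liftings. -/
@[ext]
structure Hom (L M : AlgLift p k A) where
  /-- the underlying isomorphism -/
  e : L.carrier ≃ₐ[W₂ p k] M.carrier
  comm : ∀ x, M.proj (e x) = L.proj x

/-- The groupoid of flat algebra liftings of `A`. -/
instance : Groupoid (AlgLift p k A) where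
  Hom := Hom
  id L := ⟨AlgEquiv.refl, fun _ => rfl⟩
  comp φ ψ := ⟨φ.e.trans ψ.e, by simp [φ.comm, ψ.comm]⟩
  inv φ := ⟨φ.e.symm, fun x => by rw [← φ.comm]; simp⟩
  inv_comp φ := Hom.ext (AlgEquiv.ext fun x => by simp)
  comp_inv φ := Hom.ext (AlgEquiv.ext fun x => by simp)

/-- Forget the product. -/
def forget (p : ℕ) [Fact p.Prime] (k : Type u) [Field k] (A : Type u) [Ring A] [Algebra k A] :
    AlgLift p k A ⥤ Lift p k A where
  obj L :=
    { carrier := L.carrier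
      flat := L.flat
      proj :=
        { toFun := L.proj
          map_add' := map_add L.proj
          map_smul' := fun w x => by
            rw [Algebra.smul_def, _root_.map_mul, L.proj_algebraMap, ← Algebra.smul_def] }
      surjective := L.surjective
      ker := L.ker }
  map φ := Lift.Hom.mk φ.e.toLinearEquiv φ.comm

end AlgLift

/-- The category of pairs `(A, A')` of a `k`-algebra `A` and a flat lifting `A'` of `A` to `W₂(k)`
(with arbitrary algebra maps as morphisms). -/
structure AlgWithLift (p : ℕ) [Fact p.Prime] (k : Type u) [Field k] where
  /-- the algebra `A` -/
  base : AlgCat.{u} k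
  /-- the lifting `A'` -/
  lift : AlgLift p k base

namespace AlgWithLift

variable {p : ℕ} [Fact p.Prime] {k : Type u} [Field k]

/-- A map of algebras together with a map of their liftings over it. -/
@[ext]
structure Hom (X Y : AlgWithLift p k) where
  /-- the map `A → B` -/
  base : X.base ⟶ Y.base
  /-- the map `A' → B'` -/
  lift : X.lift.carrier →ₐ[W₂ p k] Y.lift.carrier
  comm : ∀ x, Y.lift.proj (lift x) = base.hom (X.lift.proj x)

instance : Category (AlgWithLift p k) where
  Hom := Hom
  id X := ⟨𝟙 _, AlgHom.id _ _, fun _ => rfl⟩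
  comp φ ψ := ⟨φ.base ≫ ψ.base, ψ.lift.comp φ.lift, by simp [φ.comm, ψ.comm]⟩

variable (p k) in
/-- The projection `(A, A') ↦ A`. -/
def toAlg : AlgWithLift p k ⥤ AlgCat.{u} k where
  obj X := X.base
  map φ := φ.base

end AlgWithLift

end CubeConstruction

end

/-!
A flat lifting `V'` of `V` is sent to the space of symbols `[x]`, `x ∈ V'`, modulo
`[τ(c) x] = c [x]`, for the Teichmüller representative `τ(c)` of `c ∈ kˣ`, and
`[x + p y] = [x] + [p y]`. The map `a` is `[x] ↦ [x mod p]`. The term `V♭₁` classifies the symmetric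
`2`-cocycles on `V` that are homogeneous with respect to `kˣ`, and `b` is given by the cocycle
`[v, w] ↦ [x] + [y] - [x + y]`, where `x` and `y` lift `v` and `w`.

The kernel of `d : V♭₁ → V♭₀` consists of the values of multiplication by `p` on the extension
defined by the universal cocycle. Indeed, if the extension defined by a homogeneous cocycle is
annihilated by `p`, then it splits, and averaging over `kˣ`, whose order is `-1` in `k`, makes the
splitting homogeneous. Averaging also gives a homogeneous retraction of the symbols onto
`pV' ≅ V`. Hence `b` is injective, and so is `x ↦ [x]`, whose image consists of the `z` with
`a z = [v]` for some `v ∈ V`. This recovers `V'` from its splitting, and, if `V'` is an algebra, the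
product `[x] [y] = [x y]` on the splitting recovers that on `V'`. Conversely, a product on the
splitting defines one on `V'`, which is additive since `b` is a map of bimodules. As all splittings
of a two-term complex of vector spaces are isomorphic, this gives the equivalences.

The DG splitting of `Q̄_{≤ 1}(A) → A` is obtained from `Q̄_{≤ 1}(A)` by replacing its term of degree
`0` with the splitting `K₀₁` of `A♭`.
-/

noncomputable section

namespace CubeConstruction

section Teichmuller

variable {p : ℕ} [Fact p.Prime] {k : Type*} [CommRing k]

/-- The Teichmüller representatives in `W₂(k)`. -/
def teich (p : ℕ) [Fact p.Prime] {k : Type*} [CommRing k] : k →* W₂ p k :=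
  (WittVector.truncate 2 : WittVector p k →+* W₂ p k).toMonoidHom.comp (WittVector.teichmuller p)

theorem teich_apply (c : k) : teich p c = WittVector.truncate 2 (WittVector.teichmuller p c) := rfl

theorem residue_truncate (w : WittVector p k) :
    residue p k (WittVector.truncate 2 w) = w.coeff 0 :=
  WittVector.coeff_truncate w 0

@[simp]
theorem residue_teich (c : k) : residue p k (teich p c) = c := by
  rw [teich_apply, residue_truncate, WittVector.teichmuller_coeff_zero]

@[simp]
theorem teich_zero : teich p (0 : k) = 0 := by
  rw [teich_apply, WittVector.teichmuller_zero, map_zero]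

theorem residue_surjective : Function.Surjective (residue p k) := fun c =>
  ⟨teich p c, residue_teich c⟩

theorem residue_natCast_self [CharP k p] : residue p k (p : W₂ p k) = 0 := by
  rw [map_natCast, CharP.cast_eq_zero]

theorem natCast_mul_truncate (w : WittVector p k) :
    (p : W₂ p k) * WittVector.truncate 2 w = WittVector.truncate 2 (w * (p : WittVector p k)) := by
  rw [map_mul, map_natCast, mul_comm]

theorem natCast_mul_eq_zero_iff [CharP k p] [IsReduced k] {w : W₂ p k} :
    (p : W₂ p k) * w = 0 ↔ residue p k w = 0 := by
  obtain ⟨w, rfl⟩ := WittVector.truncate_surjective p 2 k w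
  rw [natCast_mul_truncate, residue_truncate, TruncatedWittVector.ext_iff, Fin.forall_fin_two]
  simp only [WittVector.coeff_truncate, TruncatedWittVector.coeff_zero, Fin.val_zero, Fin.val_one,
    WittVector.mul_charP_coeff_zero, WittVector.mul_charP_coeff_succ w 0, true_and]
  exact pow_eq_zero_iff (NeZero.ne p)

theorem natCast_mul_natCast [CharP k p] [IsReduced k] : (p : W₂ p k) * p = 0 :=
  natCast_mul_eq_zero_iff.2 residue_natCast_self

theorem eq_natCast_mul_teich [CharP k p] [PerfectRing k p] {w : W₂ p k} (hw : residue p k w = 0) :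
    w = p * teich p ((frobeniusEquiv k p).symm (w.coeff 1)) := by
  rw [teich_apply, natCast_mul_truncate]
  ext i
  rw [WittVector.coeff_truncate]
  fin_cases i
  · exact hw.trans (WittVector.mul_charP_coeff_zero _).symm
  · simp [WittVector.mul_charP_coeff_succ _ 0, WittVector.teichmuller_coeff_zero]

theorem exists_eq_teich_add [CharP k p] [PerfectRing k p] (w : W₂ p k) :
    ∃ x y : k, w = teich p x + p * teich p y :=
  ⟨residue p k w, _, sub_eq_iff_eq_add'.1 <| eq_natCast_mul_teich (by simp)⟩

theorem map_smul_of_map_teich_smul [CharP k p] [PerfectRing k p] {M N : Type*} [AddCommGroup M]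
    [Module (W₂ p k) M] [AddCommGroup N] [Module (W₂ p k) N] (φ : M →+ N)
    (hφ : ∀ (c : k) x, φ (teich p c • x) = teich p c • φ x) (w : W₂ p k) (x : M) :
    φ (w • x) = w • φ x := by
  obtain ⟨a, b, rfl⟩ := exists_eq_teich_add w
  simp only [add_smul, mul_smul, map_add, hφ, Nat.cast_smul_eq_nsmul, map_nsmul]

end Teichmuller

section Homogenize

variable {k S X Y N : Type*} [Field k] [Monoid S] [MulAction S X] [MulAction S Y]
  [AddCommGroup N] [Module k N] [Fintype kˣ] (χ : kˣ →* S)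

/-- The averaging projection onto the functions that are homogeneous for the action of `kˣ` on
their domain given by `χ`. The sign is the inverse of `|kˣ| = -1` in `k`. -/
def homogenize : (X → N) →ₗ[k] X → N where
  toFun f x := -∑ t : kˣ, t⁻¹ • f (χ t • x)
  map_add' f g := by
    ext x
    simp only [Pi.add_apply, smul_add, Finset.sum_add_distrib, neg_add]
  map_smul' c f := by
    ext x
    simp only [Pi.smul_apply, smul_comm _ c, ← Finset.smul_sum, smul_neg, RingHom.id_apply]

theorem homogenize_apply (f : X → N) (x : X) :
    homogenize χ f x = -∑ t : kˣ, t⁻¹ • f (χ t • x) := rfl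

theorem homogenize_smul (f : X → N) (c : kˣ) (x : X) :
    homogenize χ f (χ c • x) = c • homogenize χ f x := by
  rw [homogenize_apply, homogenize_apply, smul_neg, Finset.smul_sum]
  refine congrArg Neg.neg (Fintype.sum_equiv (Equiv.mulRight c) _ _ fun t => ?_)
  rw [Equiv.coe_mulRight, map_mul, mul_smul, mul_inv_rev, mul_smul, smul_inv_smul]

theorem homogenize_comp (f : Y → N) {π : X → Y} (hπ : ∀ (s : S) x, π (s • x) = s • π x) :
    homogenize χ (f ∘ π) = homogenize χ f ∘ π := by
  ext x
  simp only [homogenize_apply, Function.comp_apply, hπ]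

theorem homogenize_eq_self [Finite k] {f : X → N} (hf : ∀ (t : kˣ) x, f (χ t • x) = t • f x) :
    homogenize χ f = f := by
  classical
  have := Fintype.ofFinite k
  have card_units : ∑ _t : kˣ, (1 : k) = -1 := by
    convert FiniteField.sum_pow_units k 0 using 1
    · simp only [pow_zero]
      congr!
    · rw [if_pos (dvd_zero _)]
  ext x
  simp only [homogenize_apply, hf, inv_smul_smul]
  rw [Finset.sum_congr rfl fun _ _ => (one_smul k (f x)).symm, ← Finset.sum_smul, card_units,
    neg_one_smul, neg_neg]

end Homogenize

namespace Lift

variable {p : ℕ} [Fact p.Prime] {k : Type u} [Field k] {V : Type u}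
  [AddCommGroup V] [Module k V] (L : Lift p k V)

theorem proj_teich_smul (c : k) (x : L.carrier) : L.proj (teich p c • x) = c • L.proj x := by
  rw [LinearMap.map_smulₛₗ, residue_teich]

theorem proj_natCast_smul (x : L.carrier) : L.proj ((p : W₂ p k) • x) = 0 :=
  (L.ker _).2 ⟨x, rfl⟩

theorem natCast_smul_eq_zero_iff [CharP k p] (x : L.carrier) :
    (p : W₂ p k) • x = 0 ↔ L.proj x = 0 := by
  constructor
  · intro h
    have := L.flat
    obtain ⟨κ, a, y, hx, ha⟩ := Module.Flat.isTrivialRelation_of_sum_smul_eq_zero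
      (f := fun _ : Fin 1 => (p : W₂ p k)) (x := fun _ => x) (by simpa using h)
    have residue_a : ∀ j, residue p k (a 0 j) = 0 := fun j =>
      natCast_mul_eq_zero_iff.1 (by simpa using ha j)
    rw [show x = ∑ j, a 0 j • y j from hx 0, map_sum]
    exact Finset.sum_eq_zero fun j _ => by rw [LinearMap.map_smulₛₗ, residue_a, zero_smul]
  · intro h
    obtain ⟨y, rfl⟩ := (L.ker x).1 h
    rw [← mul_smul, natCast_mul_natCast, zero_smul]

theorem exists_eq_add {x y : L.carrier} (h : L.proj x = L.proj y) :
    ∃ z, x = y + (p : W₂ p k) • z := by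
  obtain ⟨z, hz⟩ := (L.ker (x - y)).1 (by rw [map_sub, h, sub_self])
  exact ⟨z, sub_eq_iff_eq_add'.1 hz⟩

end Lift

theorem mapRange_residue_eq_zero_iff {p : ℕ} [Fact p.Prime] {k ι : Type*} [CommRing k] [CharP k p]
    [PerfectRing k p] {x : ι →₀ W₂ p k} :
    x.mapRange (residue p k) (map_zero _) = 0 ↔ ∃ y : ι →₀ W₂ p k, x = (p : W₂ p k) • y := by
  constructor
  · intro hx
    refine ⟨x.mapRange (fun w => teich p ((frobeniusEquiv k p).symm (w.coeff 1))) (by simp), ?_⟩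
    ext1 i
    exact eq_natCast_mul_teich (DFunLike.congr_fun hx i)
  · rintro ⟨y, rfl⟩
    ext i
    simp

theorem Lift.nonempty (p : ℕ) [Fact p.Prime] (k : Type u) [Field k] [CharP k p] [PerfectRing k p]
    (V : Type u) [AddCommGroup V] [Module k V] : Nonempty (Lift p k V) := by
  let B := Module.Basis.ofVectorSpace k V
  let reduction : (Module.Basis.ofVectorSpaceIndex k V →₀ W₂ p k) →ₛₗ[residue p k]
      (Module.Basis.ofVectorSpaceIndex k V →₀ k) :=
    { toFun := Finsupp.mapRange (residue p k) (map_zero _)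
      map_add' := Finsupp.mapRange_add (map_add _)
      map_smul' := fun c x => by ext i; simp }
  exact ⟨{
    carrier := Module.Basis.ofVectorSpaceIndex k V →₀ W₂ p k
    flat := inferInstance
    proj := B.repr.symm.toLinearMap.comp reduction
    surjective := B.repr.symm.surjective.comp
      (Finsupp.mapRange_surjective _ (map_zero _) residue_surjective)
    ker := fun _ => (map_eq_zero_iff B.repr.symm B.repr.symm.injective).trans
      mapRange_residue_eq_zero_iff }⟩

/-- A normalized symmetric `2`-cocycle on `V` with values in `N`. -/
structure IsSymmCocycle {V N : Type*} [AddCommGroup V] [AddCommGroup N] (c : V → V → N) :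
    Prop where
  zero_left : ∀ v, c 0 v = 0
  symm : ∀ v w, c v w = c w v
  assoc : ∀ v w x, c v (w + x) + c w x = c (v + w) x + c v w

/-- A normalized symmetric `2`-cocycle that is homogeneous with respect to the units of `k`. These
are the functions `(v, w) ↦ φ [v, w]` given by linear maps `φ` from `V♭₁`. -/
structure IsHomogCocycle (k : Type*) [Ring k] {V N : Type*} [AddCommGroup V] [Module k V]
    [AddCommGroup N] [Module k N] (c : V → V → N) : Prop extends IsSymmCocycle c where
  smul : ∀ (t : kˣ) v w, c ((t : k) • v) ((t : k) • w) = (t : k) • c v w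

namespace IsSymmCocycle

variable {V N : Type*} [AddCommGroup V] [AddCommGroup N] {c : V → V → N}

theorem zero_right (h : IsSymmCocycle c) (v : V) : c v 0 = 0 := by rw [h.symm, h.zero_left]

theorem interchange (h : IsSymmCocycle c) (v w x y : V) :
    c (v + x) (w + y) - c v w - c x y = c (v + w) (x + y) - c v x - c w y := by
  have assoc : ∀ v w x, c (v + w) x = c v (w + x) + c w x - c v w := fun v w x =>
    eq_sub_of_add_eq (h.assoc v w x).symm
  have assoc' : ∀ v w x, c v (w + x) = c (v + w) x + c v w - c w x := fun v w x =>
    eq_sub_of_add_eq (h.assoc v w x)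
  rw [assoc' (v + x) w y, assoc' (v + w) x y, add_right_comm v x w, assoc v x w, assoc v w x,
    h.symm x w, add_comm x w]
  abel

end IsSymmCocycle

theorem IsHomogCocycle.comp {k V N P : Type*} [Ring k] [AddCommGroup V] [Module k V]
    [AddCommGroup N] [Module k N] [AddCommGroup P] [Module k P] {c : V → V → N}
    (h : IsHomogCocycle k c) (φ : N →ₗ[k] P) : IsHomogCocycle k (fun v w => φ (c v w)) where
  zero_left v := by rw [h.zero_left, map_zero]
  symm v w := by rw [h.symm]
  assoc v w x := by rw [← map_add, h.assoc, map_add]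
  smul t v w := by rw [h.smul, map_smul]

/-- The extension of `V` by `N` defined by a symmetric `2`-cocycle. -/
@[ext]
structure CocycleExt {V N : Type*} [AddCommGroup V] [AddCommGroup N] {c : V → V → N}
    (h : IsSymmCocycle c) where
  /-- the component in `N` -/
  fst : N
  /-- the component in `V` -/
  snd : V

namespace CocycleExt

variable {V N : Type*} [AddCommGroup V] [AddCommGroup N] {c : V → V → N} (h : IsSymmCocycle c)

instance : Add (CocycleExt h) := ⟨fun x y => ⟨x.fst + y.fst + c x.snd y.snd, x.snd + y.snd⟩⟩

instance : Zero (CocycleExt h) := ⟨⟨0, 0⟩⟩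

instance : Neg (CocycleExt h) := ⟨fun x => ⟨-x.fst - c (-x.snd) x.snd, -x.snd⟩⟩

@[simp] theorem add_fst (x y : CocycleExt h) : (x + y).fst = x.fst + y.fst + c x.snd y.snd := rfl

@[simp] theorem add_snd (x y : CocycleExt h) : (x + y).snd = x.snd + y.snd := rfl

@[simp] theorem zero_fst : (0 : CocycleExt h).fst = 0 := rfl

@[simp] theorem zero_snd : (0 : CocycleExt h).snd = 0 := rfl

@[simp] theorem neg_fst (x : CocycleExt h) : (-x).fst = -x.fst - c (-x.snd) x.snd := rfl

@[simp] theorem neg_snd (x : CocycleExt h) : (-x).snd = -x.snd := rfl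

instance : AddCommGroup (CocycleExt h) where
  __ := AddGroup.ofLeftAxioms (G := CocycleExt h)
    (fun x y z => by
      ext
      · simp only [add_fst, add_snd]
        rw [eq_sub_of_add_eq (h.assoc x.snd y.snd z.snd)]
        abel
      · exact add_assoc _ _ _)
    (fun x => by ext <;> simp [h.zero_left])
    (fun x => by
      ext
      · simp only [add_fst, neg_fst, neg_snd, zero_fst]
        abel
      · exact neg_add_cancel _)
  add_comm x y := by
    ext
    · simp only [add_fst, h.symm x.snd, add_comm x.fst]
    · exact add_comm _ _

theorem nsmul_mk (n : ℕ) (m : N) (v : V) :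
    n • (⟨m, v⟩ : CocycleExt h) = ⟨n • m + ∑ i ∈ Finset.range n, c (i • v) v, n • v⟩ := by
  induction n with
  | zero => ext <;> simp
  | succ n ih =>
    rw [succ_nsmul, ih]
    ext
    · simp only [add_fst, Finset.sum_range_succ, succ_nsmul]
      abel
    · exact (succ_nsmul v n).symm

/-- The projection of the extension onto `V`. -/
def sndHom : CocycleExt h →+ V where
  toFun := snd
  map_zero' := rfl
  map_add' _ _ := rfl

theorem sndHom_surjective : Function.Surjective (sndHom h) := fun v => ⟨⟨0, v⟩, rfl⟩

end CocycleExt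

theorem exists_section_of_nsmul_eq_zero {p : ℕ} [Fact p.Prime] {E V : Type*} [AddCommGroup E]
    [AddCommGroup V] {f : E →+ V} (hf : Function.Surjective f) (hE : ∀ x : E, p • x = 0) :
    ∃ s : V →+ E, ∀ v, f (s v) = v := by
  have : Module (ZMod p) E := AddCommGroup.zmodModule hE
  have : Module (ZMod p) V := AddCommGroup.zmodModule (hf.forall.2 fun x => by
    rw [← map_nsmul, hE, map_zero])
  obtain ⟨s, hs⟩ := Module.projective_lifting_property (f.toZModLinearMap p) LinearMap.id hf
  exact ⟨s.toAddMonoidHom, LinearMap.congr_fun hs⟩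

theorem charP_nsmul_eq_zero (k : Type*) [Semiring k] (p : ℕ) [CharP k p] {V : Type*}
    [AddCommMonoid V] [Module k V] (v : V) : p • v = 0 := by
  rw [← Nat.cast_smul_eq_nsmul k, CharP.cast_eq_zero, zero_smul]

namespace IsHomogCocycle

variable {k V N : Type*} [Field k] [AddCommGroup V] [Module k V] [AddCommGroup N] [Module k N]
  {c : V → V → N}

/-- Multiplication by the characteristic `p` on the extension defined by a cocycle. It factors as
a map `V → N`, since `V` and `N` are annihilated by `p`. -/
def mulChar (p : ℕ) [CharP k p] (h : IsHomogCocycle k c) : V →ₗ[k] N where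
  toFun v := ∑ i ∈ Finset.range p, c (i • v) v
  map_add' v w := by
    have nsmul_add : p • (⟨c v w, v + w⟩ : CocycleExt h.toIsSymmCocycle) =
        p • ⟨0, v⟩ + p • ⟨0, w⟩ := by
      rw [← nsmul_add]
      congr 1
      ext <;> simp
    simpa [CocycleExt.nsmul_mk, charP_nsmul_eq_zero k p, h.zero_left]
      using congrArg CocycleExt.fst nsmul_add
  map_smul' t v := by
    rw [RingHom.id_apply, Finset.smul_sum]
    refine Finset.sum_congr rfl fun i _ => ?_
    rcases eq_or_ne t 0 with rfl | ht
    · rw [zero_smul, zero_smul, smul_zero, h.zero_left]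
    · rw [smul_comm i t]
      exact h.smul (Units.mk0 t ht) _ _

theorem mulChar_apply (p : ℕ) [CharP k p] (h : IsHomogCocycle k c) (v : V) :
    h.mulChar p v = ∑ i ∈ Finset.range p, c (i • v) v := rfl

theorem exists_coboundary {p : ℕ} [Fact p.Prime] [CharP k p] [Finite k]
    (h : IsHomogCocycle k c) (hp : h.mulChar p = 0) :
    ∃ g : V → N, g 0 = 0 ∧ (∀ (t : kˣ) v, g ((t : k) • v) = (t : k) • g v) ∧
      ∀ v w, c v w = g v + g w - g (v + w) := by
  obtain ⟨s, hs : ∀ v, (s v).snd = v⟩ := exists_section_of_nsmul_eq_zero (p := p)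
    (CocycleExt.sndHom_surjective h.toIsSymmCocycle) fun ⟨m, v⟩ => by
      rw [CocycleExt.nsmul_mk, ← mulChar_apply p h, hp, LinearMap.zero_apply,
        charP_nsmul_eq_zero k p, charP_nsmul_eq_zero k p, add_zero]
      rfl
  let f : V → N := fun v => -(s v).fst
  have coboundary_f : Function.uncurry c =
      f ∘ Prod.fst + f ∘ Prod.snd - f ∘ fun x => x.1 + x.2 := by
    ext ⟨v, w⟩
    simp only [f, Function.uncurry_apply_pair, Pi.sub_apply, Pi.add_apply, Function.comp_apply,
      map_add, CocycleExt.add_fst, hs]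
    abel
  have := Fintype.ofFinite kˣ
  have homogeneous : homogenize (Units.coeHom k) (Function.uncurry c) = Function.uncurry c :=
    homogenize_eq_self _ fun t x => h.smul t x.1 x.2
  refine ⟨homogenize (Units.coeHom k) f, by simp [f, homogenize_apply],
    homogenize_smul (Units.coeHom k) f, fun v w => ?_⟩
  rw [coboundary_f, map_sub, map_add, homogenize_comp _ _ fun _ _ => rfl,
    homogenize_comp _ _ fun _ _ => rfl, homogenize_comp _ _ fun _ _ => (smul_add _ _ _).symm,
    ← coboundary_f] at homogeneous
  exact (congrFun homogeneous (v, w)).symm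

end IsHomogCocycle

section Cubes

variable {V : Type u}

/-- The `1`-cube with values `v` at `0` and `w` at `1`. -/
def pair (v w : V) : Cube V 1 := fun x => bif x 0 then w else v

/-- The `2`-cube whose rows, the faces `x₀ = 0` and `x₀ = 1`, are `(v, w)` and `(x, y)`. -/
def square (v w x y : V) : Cube V 2 := fun q => bif q 0 then pair x y ![q 1] else pair v w ![q 1]

theorem const_eta (f : Cube V 0) : (fun _ => f Fin.elim0) = f :=
  funext fun _ => congrArg f (Subsingleton.elim _ _)

theorem pair_eta (f : Cube V 1) : pair (f fun _ => false) (f fun _ => true) = f := by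
  funext x
  obtain ⟨b, rfl⟩ : ∃ b, x = fun _ => b := ⟨x 0, funext fun i => by rw [Subsingleton.elim i 0]⟩
  cases b <;> rfl

theorem square_eta (f : Cube V 2) :
    square (f ![false, false]) (f ![false, true]) (f ![true, false]) (f ![true, true]) = f := by
  funext q
  obtain ⟨b, c, rfl⟩ : ∃ b c, q = ![b, c] := ⟨q 0, q 1, funext (Fin.forall_fin_two.2 ⟨rfl, rfl⟩)⟩
  cases b <;> cases c <;> rfl

theorem pair_add [AddCommGroup V] (v w v' w' : V) :
    pair v w + pair v' w' = pair (v + v') (w + w') :=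
  (pair_eta _).symm

theorem face_pair (v w : V) (b : Bool) : (pair v w).face 0 b = fun _ => bif b then w else v := rfl

theorem face_zero_square (v w x y : V) (b : Bool) :
    (square v w x y).face 0 b = bif b then pair x y else pair v w := by
  rw [← pair_eta ((square v w x y).face 0 b)]
  cases b <;> rfl

theorem face_one_square (v w x y : V) (b : Bool) :
    (square v w x y).face 1 b = bif b then pair w y else pair v x := by
  rw [← pair_eta ((square v w x y).face 1 b)]
  cases b <;> rfl

end Cubes

namespace QBar

variable {k : Type u} [Field k] {V : Type u} [AddCommGroup V] [Module k V]

theorem d_pair (v w : V) : d k V 0 (mk k (pair v w)) =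
    mk k (fun _ => v) + mk k (fun _ => w) - mk k (fun _ => v + w) := by
  simp only [d, LinearMap.sum_apply, LinearMap.smul_apply, partialD_mk]
  rw [Fin.sum_univ_one, Fin.val_zero, zero_add, pow_one, neg_one_smul, face_pair, face_pair,
    neg_sub, sub_sub_eq_add_sub, add_comm]
  rfl

theorem d_square (v w x y : V) : d k V 1 (mk k (square v w x y)) =
    (mk k (pair (v + w) (x + y)) - mk k (pair v x) - mk k (pair w y)) -
      (mk k (pair (v + x) (w + y)) - mk k (pair v w) - mk k (pair x y)) := by
  simp only [d, LinearMap.sum_apply, LinearMap.smul_apply, partialD_mk]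
  rw [Fin.sum_univ_two]
  simp only [face_zero_square, face_one_square, cond_true, cond_false, pair_add, Fin.val_zero,
    Fin.val_one, zero_add, pow_one, one_add_one_eq_two, neg_one_smul, neg_one_sq, one_smul]
  exact neg_add_eq_sub _ _

end QBar

namespace FlatV

variable {k : Type u} [Field k] {V W N : Type u} [AddCommGroup V] [Module k V]
  [AddCommGroup W] [Module k W] [AddCommGroup N] [Module k N]

/-- The projection `Q̄ₙ(V) → V♭ₙ`. -/
def ofQBar (k : Type u) [Field k] (V : Type u) [AddCommGroup V] [Module k V] (n : ℕ) :
    QBar k V n →ₗ[k] (flatV k V).X n :=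
  (flatSub (QBarCx k V) n).mkQ

/-- The generator `[v]` of `V♭₀`. -/
def gen₀ (k : Type u) [Field k] {V : Type u} [AddCommGroup V] [Module k V] (v : V) :
    (flatV k V).X 0 :=
  ofQBar k V 0 (QBar.mk k fun _ => v)

/-- The generator `[v, w]` of `V♭₁`. -/
def gen₁ (k : Type u) [Field k] {V : Type u} [AddCommGroup V] [Module k V] (v w : V) :
    (flatV k V).X 1 :=
  ofQBar k V 1 (QBar.mk k (pair v w))

theorem d_ofQBar (x : QBar k V 1) :
    ((flatV k V).d 1 0).hom (ofQBar k V 1 x) = ofQBar k V 0 (QBar.d k V 0 x) :=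
  congrArg (ofQBar k V 0) (QBarCx_d_apply k V 0 x)

theorem ofQBar_one_eq_zero_iff {x : QBar k V 1} :
    ofQBar k V 1 x = 0 ↔ ∃ y, QBar.d k V 1 y = x :=
  (Submodule.Quotient.mk_eq_zero _).trans
    ⟨fun ⟨y, hy⟩ => ⟨y, (QBarCx_d_apply k V 1 y).symm.trans hy⟩,
      fun ⟨y, hy⟩ => ⟨y, (QBarCx_d_apply k V 1 y).trans hy⟩⟩

theorem hom_ext₀ {φ ψ : (flatV k V).X 0 →ₗ[k] N} (h : ∀ v, φ (gen₀ k v) = ψ (gen₀ k v)) :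
    φ = ψ := by
  refine Submodule.linearMap_qext (flatSub (QBarCx k V) 0) (QBar.hom_ext (V := V) fun f => ?_)
  rw [← const_eta f]
  exact h _

theorem hom_ext₁ {φ ψ : (flatV k V).X 1 →ₗ[k] N} (h : ∀ v w, φ (gen₁ k v w) = ψ (gen₁ k v w)) :
    φ = ψ := by
  refine Submodule.linearMap_qext (flatSub (QBarCx k V) 1) (QBar.hom_ext (V := V) fun f => ?_)
  rw [← pair_eta f]
  exact h _ _

theorem gen₀_zero : gen₀ k (0 : V) = 0 :=
  (congrArg (ofQBar k V 0) QBar.mk_zero).trans (map_zero _)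

theorem gen₀_smul (c : k) (v : V) : gen₀ k (c • v) = c • gen₀ k v :=
  (congrArg (ofQBar k V 0) (QBar.mk_smul c fun _ => v)).trans (map_smul _ _ _)

theorem gen₁_zero_left (w : V) : gen₁ k 0 w = 0 := by
  rw [gen₁, QBar.mk_slab ⟨0, true, fun x hx => ?_⟩, map_zero]
  rw [pair, Bool.eq_false_of_not_eq_true hx, cond_false]

theorem gen₁_zero_right (v : V) : gen₁ k v 0 = 0 := by
  rw [gen₁, QBar.mk_slab ⟨0, false, fun x hx => ?_⟩, map_zero]
  rw [pair, Bool.eq_true_of_not_eq_false hx, cond_true]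

theorem gen₁_smul (c : k) (v w : V) : gen₁ k (c • v) (c • w) = c • gen₁ k v w := by
  rw [gen₁, gen₁, ← map_smul, ← QBar.mk_smul, ← pair_eta (c • pair v w)]
  rfl

theorem gen₁_interchange (v w x y : V) :
    gen₁ k (v + w) (x + y) - gen₁ k v x - gen₁ k w y =
      gen₁ k (v + x) (w + y) - gen₁ k v w - gen₁ k x y := by
  simp only [gen₁, ← map_sub]
  rw [← sub_eq_zero, ← map_sub, ofQBar_one_eq_zero_iff]
  exact ⟨_, QBar.d_square v w x y⟩

theorem isHomogCocycle_gen₁ (k : Type u) [Field k] (V : Type u) [AddCommGroup V] [Module k V] :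
    IsHomogCocycle k (gen₁ k (V := V)) where
  zero_left := gen₁_zero_left
  symm v w := by
    simpa only [zero_add, add_zero, gen₁_zero_left, gen₁_zero_right, sub_zero]
      using gen₁_interchange (k := k) 0 v w 0
  assoc v w x := by
    rw [← sub_eq_sub_iff_add_eq_add]
    simpa only [zero_add, add_zero, gen₁_zero_left, gen₁_zero_right, sub_zero]
      using (gen₁_interchange (k := k) v w 0 x).symm
  smul t v w := gen₁_smul _ v w

theorem d_gen₁ (v w : V) :
    ((flatV k V).d 1 0).hom (gen₁ k v w) = gen₀ k v + gen₀ k w - gen₀ k (v + w) := by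
  rw [gen₁, d_ofQBar, QBar.d_pair, map_sub, map_add]
  rfl

theorem map_gen₀ (g : V →ₗ[k] W) (v : V) : ((flatVMap g).f 0).hom (gen₀ k v) = gen₀ k (g v) :=
  congrArg (ofQBar k W 0) (QBar.map_mk g _)

theorem map_gen₁ (g : V →ₗ[k] W) (v w : V) :
    ((flatVMap g).f 1).hom (gen₁ k v w) = gen₁ k (g v) (g w) := by
  refine congrArg (ofQBar k W 1) ((QBar.map_mk g (pair v w)).trans ?_)
  rw [← pair_eta (fun x => g (pair v w x))]
  rfl

/-- The universal property of `V♭₀`: it classifies the functions that are homogeneous with respect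
to `kˣ`. -/
def lift₀ (g : V → N) (h0 : g 0 = 0) (hs : ∀ (c : kˣ) v, g ((c : k) • v) = (c : k) • g v) :
    (flatV k V).X 0 →ₗ[k] N :=
  (flatSub (QBarCx k V) 0).liftQ
    (QBar.lift (fun f => g (f Fin.elim0)) h0 (fun _ ⟨i, _⟩ => i.elim0) (fun c _ => hs c _))
    (bot_le (a := LinearMap.ker _))

@[simp]
theorem lift₀_gen (g : V → N) (h0 : g 0 = 0)
    (hs : ∀ (c : kˣ) v, g ((c : k) • v) = (c : k) • g v) (v : V) :
    lift₀ g h0 hs (gen₀ k v) = g v :=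
  QBar.lift_mk (V := V) (n := 0) (fun f => g (f Fin.elim0)) h0 (fun _ ⟨i, _⟩ => i.elim0)
    (fun c _ => hs c _) _

/-- The map `Q̄₁(V) → N` defined by a cocycle. -/
def liftQBar₁ (c : V → V → N) (h : IsHomogCocycle k c) : QBar k V 1 →ₗ[k] N :=
  QBar.lift (fun f => c (f fun _ => false) (f fun _ => true)) (h.zero_left 0)
    (fun f ⟨i, b, hf⟩ => by
      cases b
      · rw [hf (fun _ => true) (by simp), h.zero_right]
      · rw [hf (fun _ => false) (by simp), h.zero_left])
    (fun t f => h.smul t _ _)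

theorem liftQBar₁_mk (c : V → V → N) (h : IsHomogCocycle k c) (v w : V) :
    liftQBar₁ c h (QBar.mk k (pair v w)) = c v w :=
  QBar.lift_mk (fun f : Cube V 1 => c (f fun _ => false) (f fun _ => true)) ..

theorem liftQBar₁_d (c : V → V → N) (h : IsHomogCocycle k c) (x : QBar k V 2) :
    liftQBar₁ c h (QBar.d k V 1 x) = 0 := by
  suffices liftQBar₁ c h ∘ₗ QBar.d k V 1 = 0 from LinearMap.congr_fun this x
  refine QBar.hom_ext fun f => ?_
  rw [← square_eta f, LinearMap.comp_apply, QBar.d_square]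
  simp only [map_sub, liftQBar₁_mk]
  exact sub_eq_zero.2 (h.interchange _ _ _ _)

/-- The universal property of `V♭₁`: it classifies homogeneous symmetric cocycles. -/
def lift₁ (c : V → V → N) (h : IsHomogCocycle k c) : (flatV k V).X 1 →ₗ[k] N :=
  (flatSub (QBarCx k V) 1).liftQ (liftQBar₁ c h) fun _ hx => by
    obtain ⟨y, rfl⟩ := ofQBar_one_eq_zero_iff.1 ((Submodule.Quotient.mk_eq_zero _).2 hx)
    exact liftQBar₁_d c h y

@[simp]
theorem lift₁_gen (c : V → V → N) (h : IsHomogCocycle k c) (v w : V) :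
    lift₁ c h (gen₁ k v w) = c v w :=
  liftQBar₁_mk c h v w

variable (k V) in
/-- The augmentation `V♭₀ → V`, `[v] ↦ v`. -/
def aug : (flatV k V).X 0 →ₗ[k] V := lift₀ id rfl fun _ _ => rfl

theorem aug_gen₀ (v : V) : aug k V (gen₀ k v) = v := lift₀_gen ..

theorem gen₀_injective : Function.Injective (gen₀ k (V := V)) :=
  Function.LeftInverse.injective aug_gen₀

theorem exists_d_eq_of_aug_eq_zero {x : (flatV k V).X 0} (hx : aug k V x = 0) :
    ∃ m, ((flatV k V).d 1 0).hom m = x := by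
  let R := LinearMap.range ((flatV k V).d 1 0).hom
  let g : V →ₗ[k] (flatV k V).X 0 ⧸ R :=
    { toFun := fun v => R.mkQ (gen₀ k v)
      map_add' := fun v w => by
        rw [← map_add, eq_comm, ← sub_eq_zero, ← map_sub, ← d_gen₁]
        exact (Submodule.Quotient.mk_eq_zero R).2 (LinearMap.mem_range_self _ _)
      map_smul' := fun c v => by rw [gen₀_smul, map_smul, RingHom.id_apply] }
  have g_aug : g ∘ₗ aug k V = R.mkQ := hom_ext₀ fun v => congrArg g (aug_gen₀ v)
  have mkQ_eq_zero : R.mkQ x = 0 := by rw [← g_aug, LinearMap.comp_apply, hx, map_zero]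
  exact (Submodule.Quotient.mk_eq_zero R).1 mkQ_eq_zero

/-- Modulo these elements, the universal cocycle `(v, w) ↦ [v, w]` is the coboundary of a
homogeneous function. -/
theorem exists_eq_mulChar (p : ℕ) [Fact p.Prime] [CharP k p] [Finite k] {x : (flatV k V).X 1}
    (hx : ((flatV k V).d 1 0).hom x = 0) : ∃ v, x = (isHomogCocycle_gen₁ k V).mulChar p v := by
  let R := LinearMap.range ((isHomogCocycle_gen₁ k V).mulChar p)
  obtain ⟨g, g0, gs, hg⟩ := ((isHomogCocycle_gen₁ k V).comp R.mkQ).exists_coboundary (p := p) <| by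
    ext v
    rw [IsHomogCocycle.mulChar_apply, ← map_sum,
      ← IsHomogCocycle.mulChar_apply p (isHomogCocycle_gen₁ k V)]
    exact (Submodule.Quotient.mk_eq_zero _).2 ⟨v, rfl⟩
  have factors : lift₀ g g0 gs ∘ₗ ((flatV k V).d 1 0).hom = R.mkQ := by
    refine hom_ext₁ fun v w => ?_
    rw [LinearMap.comp_apply, d_gen₁, map_sub, map_add, lift₀_gen, lift₀_gen, lift₀_gen, ← hg]
  have hxR : R.mkQ x = 0 := by rw [← factors, LinearMap.comp_apply, hx, map_zero]
  obtain ⟨v, hv⟩ := (Submodule.Quotient.mk_eq_zero R).1 hxR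
  exact ⟨v, hv.symm⟩

end FlatV

/- The terms of the complex underlying `A♭` are those of `V♭` for `V = A` only up to unfolding
definitions, so the generators are restated for `flatA`. -/

namespace FlatA

variable {k : Type u} [Field k] {A N : Type u} [Ring A] [Algebra k A] [AddCommGroup N] [Module k N]

/-- The generator `[x]` of the degree `0` part of the DG algebra `A♭`. -/
def gen₀ (k : Type u) [Field k] {A : Type u} [Ring A] [Algebra k A] (x : A) :
    (flatA k A).cx.X 0 :=
  FlatV.gen₀ k x

/-- The generator `[v, w]` of the degree `1` part of the DG algebra `A♭`. -/
def gen₁ (k : Type u) [Field k] {A : Type u} [Ring A] [Algebra k A] (v w : A) :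
    (flatA k A).cx.X 1 :=
  FlatV.gen₁ k v w

theorem gen₀_injective : Function.Injective (gen₀ k (A := A)) := FlatV.gen₀_injective

theorem hom_ext₁ {φ ψ : (flatA k A).cx.X 1 →ₗ[k] N}
    (h : ∀ v w, φ (gen₁ k v w) = ψ (gen₁ k v w)) : φ = ψ :=
  FlatV.hom_ext₁ h

theorem one_eq : (flatA k A).one = gen₀ k (1 : A) := rfl

theorem mul_gen₀_gen₀ (x y : A) :
    (flatA k A).mul (zero_add 0) (gen₀ k x) (gen₀ k y) = gen₀ k (x * y) :=
  congrArg (FlatV.ofQBar k A 0)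
    (QBar.mul_mk (k := k) (zero_add 0) (fun _ => x) (fun _ => y))

theorem mul_gen₀_gen₁ (x v w : A) :
    (flatA k A).mul (zero_add 1) (gen₀ k x) (gen₁ k v w) = gen₁ k (x * v) (x * w) := by
  refine congrArg (FlatV.ofQBar k A 1)
    ((QBar.mul_mk (k := k) (zero_add 1) (fun _ => x) (pair v w)).trans ?_)
  rw [← pair_eta (QBar.Cube.mul _ _ _)]
  rfl

theorem mul_gen₁_gen₀ (x v w : A) :
    (flatA k A).mul (add_zero 1) (gen₁ k v w) (gen₀ k x) = gen₁ k (v * x) (w * x) := by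
  refine congrArg (FlatV.ofQBar k A 1)
    ((QBar.mul_mk (k := k) (add_zero 1) (pair v w) (fun _ => x)).trans ?_)
  rw [← pair_eta (QBar.Cube.mul _ _ _)]
  rfl

end FlatA

theorem IsSplitting.of_ker_le_range {k : Type u} [Field k] {K₁ K₀ K₀₁ : Type u} [AddCommGroup K₁]
    [Module k K₁] [AddCommGroup K₀] [Module k K₀] [AddCommGroup K₀₁] [Module k K₀₁]
    {d : K₁ →ₗ[k] K₀} {a : K₀₁ →ₗ[k] K₀} {b : K₁ →ₗ[k] K₀₁} (ha : Function.Surjective a)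
    (hb : Function.Injective b) (hab : a ∘ₗ b = d) (hker : LinearMap.ker a ≤ LinearMap.range b) :
    IsSplitting d a b where
  surjective := ha
  injective := hb
  comp := hab
  ker := by
    have a_b : ∀ x, a (b x) = d x := LinearMap.congr_fun hab
    refine ⟨fun x hx => (a_b x).trans hx, hb.injOn, fun z hz => ?_⟩
    obtain ⟨x, rfl⟩ := hker hz
    exact ⟨x, (a_b x).symm.trans hz, rfl⟩
  coker := by
    constructor
    · refine (injective_iff_map_eq_zero _).2 ((Submodule.mkQ_surjective _).forall.2 fun z hz => ?_)
      obtain ⟨x, hx : d x = a z⟩ := (Submodule.Quotient.mk_eq_zero _).1 hz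
      have sub_mem_ker : z - b x ∈ LinearMap.ker a := by
        rw [LinearMap.mem_ker, map_sub, ← hx, ← hab, LinearMap.comp_apply, sub_self]
      refine (Submodule.Quotient.mk_eq_zero _).2 ?_
      simpa only [sub_add_cancel] using
        add_mem (hker sub_mem_ker) (LinearMap.mem_range_self b x)
    · exact (Submodule.mkQ_surjective _).forall.2
        (ha.forall.2 fun z => ⟨Submodule.Quotient.mk z, rfl⟩)

namespace Lift

open FlatV

variable {p : ℕ} [Fact p.Prime] {k : Type u} [Field k] {V N : Type u}
  [AddCommGroup V] [Module k V] [AddCommGroup N] [Module k N] (L : Lift p k V)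

/-- The relations between the symbols of the elements of a lifting. -/
def symbRel : Submodule k (L.carrier →₀ k) :=
  Submodule.span k
    ({r | ∃ (c : kˣ) (x : L.carrier), r = Finsupp.single (teich p (c : k) • x) 1 -
        (c : k) • Finsupp.single x 1} ∪
      {r | ∃ x y : L.carrier, r = Finsupp.single (x + (p : W₂ p k) • y) 1 -
        Finsupp.single x 1 - Finsupp.single ((p : W₂ p k) • y) 1})

/-- The `k`-vector space spanned by symbols `[x]`, `x ∈ V'`, modulo the relations
`[τ(c) x] = c [x]` for `c ∈ kˣ` and `[x + p y] = [x] + [p y]`. -/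
def Symb : Type u := (L.carrier →₀ k) ⧸ L.symbRel

instance : AddCommGroup L.Symb := inferInstanceAs (AddCommGroup ((L.carrier →₀ k) ⧸ L.symbRel))

instance : Module k L.Symb := inferInstanceAs (Module k ((L.carrier →₀ k) ⧸ L.symbRel))

/-- The symbol of an element of `V'`. -/
def symb (x : L.carrier) : L.Symb := L.symbRel.mkQ (Finsupp.single x 1)

variable {L} in
theorem Symb.hom_ext {φ ψ : L.Symb →ₗ[k] N} (h : ∀ x, φ (L.symb x) = ψ (L.symb x)) : φ = ψ :=
  Submodule.linearMap_qext L.symbRel (Finsupp.lhom_ext' fun x => LinearMap.ext_ring (h x))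

/-- The universal property of the space of symbols. -/
def symbLift (φ : L.carrier → N) (hs : ∀ (c : kˣ) x, φ (teich p (c : k) • x) = (c : k) • φ x)
    (hp : ∀ x y, φ (x + (p : W₂ p k) • y) = φ x + φ ((p : W₂ p k) • y)) : L.Symb →ₗ[k] N :=
  L.symbRel.liftQ (Finsupp.linearCombination k φ) <| by
    rw [symbRel, Submodule.span_le]
    rintro r (⟨c, x, rfl⟩ | ⟨x, y, rfl⟩)
    · simp [hs]
    · simp [hp]

@[simp]
theorem symbLift_symb (φ : L.carrier → N)
    (hs : ∀ (c : kˣ) x, φ (teich p (c : k) • x) = (c : k) • φ x)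
    (hp : ∀ x y, φ (x + (p : W₂ p k) • y) = φ x + φ ((p : W₂ p k) • y)) (x : L.carrier) :
    L.symbLift φ hs hp (L.symb x) = φ x :=
  (Finsupp.linearCombination_single k 1 x).trans (one_smul k (φ x))

theorem symb_add (x y : L.carrier) :
    L.symb (x + (p : W₂ p k) • y) = L.symb x + L.symb ((p : W₂ p k) • y) := by
  rw [← sub_eq_iff_eq_add', ← sub_eq_zero]
  exact (Submodule.Quotient.mk_eq_zero L.symbRel).2
    (Submodule.subset_span (Or.inr ⟨x, y, rfl⟩))

@[simp]
theorem symb_zero : L.symb 0 = 0 := by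
  simpa using L.symb_add 0 0

theorem symb_smul (c : k) (x : L.carrier) : L.symb (teich p c • x) = c • L.symb x := by
  rcases eq_or_ne c 0 with rfl | hc
  · rw [teich_zero, zero_smul, zero_smul, symb_zero]
  · rw [← sub_eq_zero]
    exact (Submodule.Quotient.mk_eq_zero L.symbRel).2
      (Submodule.subset_span (Or.inl ⟨Units.mk0 c hc, x, rfl⟩))

/-- The map `[x] ↦ [x mod p]`. -/
def symbA : L.Symb →ₗ[k] (flatV k V).X 0 :=
  L.symbLift (fun x => gen₀ k (L.proj x)) (fun c x => by rw [proj_teich_smul, gen₀_smul])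
    (fun x y => by rw [map_add, proj_natCast_smul, add_zero, gen₀_zero, add_zero])

@[simp]
theorem symbA_symb (x : L.carrier) : L.symbA (L.symb x) = gen₀ k (L.proj x) :=
  L.symbLift_symb ..

theorem symbA_surjective : Function.Surjective L.symbA := by
  rw [← LinearMap.range_eq_top, ← top_le_iff]
  have : (LinearMap.range L.symbA).mkQ = 0 := hom_ext₀ fun v => by
    obtain ⟨x, rfl⟩ := L.surjective v
    rw [← symbA_symb]
    exact (Submodule.Quotient.mk_eq_zero _).2 (LinearMap.mem_range_self _ _)
  rw [← Submodule.ker_mkQ (LinearMap.range L.symbA), this, LinearMap.ker_zero]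

/-- A set-theoretic section of the reduction. -/
def sec (v : V) : L.carrier := Function.surjInv L.surjective v

@[simp]
theorem proj_sec (v : V) : L.proj (L.sec v) = v := Function.surjInv_eq L.surjective v

/-- The cocycle that measures the failure of `x ↦ [x]` to be additive. -/
def symbCocycle (v w : V) : L.Symb :=
  L.symb (L.sec v) + L.symb (L.sec w) - L.symb (L.sec v + L.sec w)

theorem symbCocycle_proj (x y : L.carrier) :
    L.symbCocycle (L.proj x) (L.proj y) = L.symb x + L.symb y - L.symb (x + y) := by
  obtain ⟨z, hz⟩ := L.exists_eq_add (L.proj_sec (L.proj x))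
  obtain ⟨t, ht⟩ := L.exists_eq_add (L.proj_sec (L.proj y))
  have e : x + (p : W₂ p k) • z + (y + (p : W₂ p k) • t) =
      x + y + (p : W₂ p k) • z + (p : W₂ p k) • t := by abel
  rw [symbCocycle, hz, ht, e, symb_add, symb_add, symb_add, symb_add]
  abel

theorem isHomogCocycle_symbCocycle : IsHomogCocycle k L.symbCocycle where
  zero_left v := by
    obtain ⟨x, rfl⟩ := L.surjective v
    rw [← map_zero L.proj, symbCocycle_proj, symb_zero, zero_add, zero_add, sub_self]
  symm v w := by
    obtain ⟨x, rfl⟩ := L.surjective v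
    obtain ⟨y, rfl⟩ := L.surjective w
    rw [symbCocycle_proj, symbCocycle_proj, add_comm y x, add_comm (L.symb x)]
  assoc v w t := by
    obtain ⟨x, rfl⟩ := L.surjective v
    obtain ⟨y, rfl⟩ := L.surjective w
    obtain ⟨z, rfl⟩ := L.surjective t
    rw [← map_add, ← map_add, symbCocycle_proj, symbCocycle_proj, symbCocycle_proj,
      symbCocycle_proj, add_assoc x y z]
    abel
  smul c v w := by
    obtain ⟨x, rfl⟩ := L.surjective v
    obtain ⟨y, rfl⟩ := L.surjective w
    rw [← proj_teich_smul, ← proj_teich_smul, symbCocycle_proj, symbCocycle_proj, ← smul_add,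
      symb_smul, symb_smul, symb_smul, smul_sub, smul_add]

/-- The map `[v, w] ↦ [x] + [y] - [x + y]`, where `x` and `y` are liftings of `v` and `w`. -/
def symbB : (flatV k V).X 1 →ₗ[k] L.Symb := lift₁ L.symbCocycle L.isHomogCocycle_symbCocycle

theorem symbB_gen (x y : L.carrier) :
    L.symbB (gen₁ k (L.proj x) (L.proj y)) = L.symb x + L.symb y - L.symb (x + y) := by
  rw [symbB, lift₁_gen, symbCocycle_proj]

theorem symbA_comp_symbB : L.symbA ∘ₗ L.symbB = ((flatV k V).d 1 0).hom := by
  refine hom_ext₁ fun v w => ?_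
  obtain ⟨x, rfl⟩ := L.surjective v
  obtain ⟨y, rfl⟩ := L.surjective w
  rw [LinearMap.comp_apply, symbB_gen, d_gen₁]
  simp

/-- The subspace of the symbols `[p y]`. -/
def symbP : Submodule k L.Symb where
  carrier := {z | ∃ y, z = L.symb ((p : W₂ p k) • y)}
  zero_mem' := ⟨0, by simp⟩
  add_mem' := by
    rintro _ _ ⟨x, rfl⟩ ⟨y, rfl⟩
    exact ⟨x + y, by rw [smul_add, symb_add]⟩
  smul_mem' := by
    rintro c _ ⟨x, rfl⟩
    exact ⟨teich p c • x, by rw [← symb_smul, smul_comm]⟩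

theorem symb_sub_mem {x y : L.carrier} (h : L.proj x = L.proj y) :
    L.symb x - L.symb y ∈ L.symbP := by
  obtain ⟨z, rfl⟩ := L.exists_eq_add h
  exact ⟨z, by rw [symb_add]; abel⟩

theorem mem_symbP_of_symbA_eq_zero {z : L.Symb} (hz : L.symbA z = 0) : z ∈ L.symbP := by
  let g : (flatV k V).X 0 →ₗ[k] L.Symb ⧸ L.symbP :=
    lift₀ (fun v => L.symbP.mkQ (L.symb (L.sec v)))
      (by
        refine (Submodule.Quotient.mk_eq_zero _).2 ?_
        simpa using L.symb_sub_mem (x := L.sec 0) (y := 0) (by simp))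
      (fun c v => by
        rw [← map_smul, ← symb_smul]
        exact (Submodule.Quotient.eq _).2 (L.symb_sub_mem (by simp)))
  have g_symbA : g ∘ₗ L.symbA = L.symbP.mkQ := by
    refine Symb.hom_ext fun x => ?_
    rw [LinearMap.comp_apply, symbA_symb]
    refine (lift₀_gen _ _ _ _).trans ?_
    exact (Submodule.Quotient.eq _).2 (L.symb_sub_mem (by simp))
  rw [← Submodule.Quotient.mk_eq_zero, ← Submodule.mkQ_apply, ← g_symbA, LinearMap.comp_apply, hz,
    map_zero]

theorem exists_symb_eq_of_symbA_eq {z : L.Symb} {v : V} (hz : L.symbA z = gen₀ k v) :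
    ∃ x, L.symb x = z := by
  obtain ⟨x, rfl⟩ := L.surjective v
  obtain ⟨y, hy⟩ := L.mem_symbP_of_symbA_eq_zero (z := z - L.symb x) (by simp [hz])
  exact ⟨x + (p : W₂ p k) • y, by rw [symb_add, ← hy]; abel⟩

section

variable [CharP k p]

theorem exists_add_natCast_smul : ∃ r : L.carrier → V,
    r 0 = 0 ∧ ∀ x z, r (x + (p : W₂ p k) • z) = r x + L.proj z := by
  choose y hy using fun x => L.exists_eq_add (L.proj_sec (L.proj x)).symm
  refine ⟨fun x => L.proj (y x) - L.proj (y 0), sub_self _, fun x z => ?_⟩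
  have proj_eq : L.proj (x + (p : W₂ p k) • z) = L.proj x := by
    rw [map_add, proj_natCast_smul, add_zero]
  have natCast_smul_y : (p : W₂ p k) • (y (x + (p : W₂ p k) • z) - (y x + z)) = 0 := by
    have hxz := hy (x + (p : W₂ p k) • z)
    rw [proj_eq] at hxz
    rw [smul_sub, smul_add, sub_eq_zero]
    refine add_left_cancel (hxz.symm.trans ?_)
    rw [← add_assoc, ← hy]
  rw [natCast_smul_eq_zero_iff, map_sub, map_add, sub_eq_zero] at natCast_smul_y
  exact (congrArg (· - L.proj (y 0)) natCast_smul_y).trans (add_sub_right_comm ..)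

theorem exists_symb_retraction [Finite k] :
    ∃ ρ : L.Symb →ₗ[k] V, ∀ y, ρ (L.symb ((p : W₂ p k) • y)) = L.proj y := by
  obtain ⟨r, r_zero, r_add⟩ := L.exists_add_natCast_smul
  have := Fintype.ofFinite kˣ
  let χ : kˣ →* W₂ p k := (teich p).comp (Units.coeHom k)
  have proj_smul : ∀ (t : kˣ) (x : L.carrier × L.carrier),
      (L.proj ∘ Prod.snd) (χ t • x) = t • (L.proj ∘ Prod.snd) x :=
    fun t x => L.proj_teich_smul t x.2
  let translate : L.carrier × L.carrier → L.carrier := fun x => x.1 + (p : W₂ p k) • x.2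
  have r_translate : r ∘ translate = r ∘ Prod.fst + L.proj ∘ Prod.snd :=
    funext fun x => r_add x.1 x.2
  let φ := homogenize χ r
  have φ_translate : φ ∘ translate = φ ∘ Prod.fst + L.proj ∘ Prod.snd := by
    have translate_smul : ∀ (w : W₂ p k) x, translate (w • x) = w • translate x := fun w x => by
      simp only [translate, Prod.smul_fst, Prod.smul_snd, smul_add, smul_comm w]
    rw [← homogenize_comp χ r translate_smul, r_translate, map_add,
      homogenize_comp χ r fun _ _ => Prod.smul_fst .., homogenize_eq_self χ proj_smul]
  have φ_add : ∀ x z, φ (x + (p : W₂ p k) • z) = φ x + L.proj z := fun x z =>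
    congrFun φ_translate (x, z)
  have φ_natCast_smul : ∀ z, φ ((p : W₂ p k) • z) = L.proj z := fun z => by
    have φ_zero : φ 0 = 0 := by simp [φ, homogenize_apply, r_zero]
    rw [← zero_add ((p : W₂ p k) • z), φ_add, φ_zero, zero_add]
  have φ_smul : ∀ (c : kˣ) x, φ (teich p (c : k) • x) = (c : k) • φ x := homogenize_smul χ r
  exact ⟨L.symbLift φ φ_smul fun x y => by rw [φ_add, φ_natCast_smul],
    fun y => (L.symbLift_symb ..).trans (φ_natCast_smul y)⟩

theorem symbB_mulChar (x : L.carrier) :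
    L.symbB ((isHomogCocycle_gen₁ k V).mulChar p (L.proj x)) = -L.symb ((p : W₂ p k) • x) := by
  have symbB_sum : ∀ n : ℕ, L.symbB (∑ i ∈ Finset.range n, gen₁ k (i • L.proj x) (L.proj x)) =
      n • L.symb x - L.symb (n • x) := by
    intro n
    induction n with
    | zero => simp
    | succ n ih =>
      rw [Finset.sum_range_succ, map_add, ih, ← map_nsmul, symbB_gen, succ_nsmul, succ_nsmul]
      abel
  rw [IsHomogCocycle.mulChar_apply, symbB_sum, charP_nsmul_eq_zero k p, zero_sub,
    Nat.cast_smul_eq_nsmul]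

variable [Finite k]

theorem symb_natCast_smul_eq_zero_iff (y : L.carrier) :
    L.symb ((p : W₂ p k) • y) = 0 ↔ L.proj y = 0 := by
  constructor
  · intro h
    obtain ⟨ρ, hρ⟩ := L.exists_symb_retraction
    rw [← hρ, h, map_zero]
  · intro h
    rw [(L.natCast_smul_eq_zero_iff y).2 h, symb_zero]

theorem symb_injective : Function.Injective L.symb := by
  intro x y h
  have h' : L.proj x = L.proj y := gen₀_injective (k := k) (by
    rw [← symbA_symb, h, symbA_symb])
  obtain ⟨z, rfl⟩ := L.exists_eq_add h'
  rw [symb_add, add_eq_left, symb_natCast_smul_eq_zero_iff] at h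
  rw [(L.natCast_smul_eq_zero_iff z).2 h, add_zero]

theorem symbB_injective : Function.Injective L.symbB := by
  rw [injective_iff_map_eq_zero]
  intro m hm
  obtain ⟨v, rfl⟩ := exists_eq_mulChar (p := p) (x := m) (by
    rw [← L.symbA_comp_symbB, LinearMap.comp_apply, hm, map_zero])
  obtain ⟨x, rfl⟩ := L.surjective v
  rw [symbB_mulChar, neg_eq_zero, symb_natCast_smul_eq_zero_iff] at hm
  rw [hm, map_zero]

theorem isSplitting : IsSplitting ((flatV k V).d 1 0).hom L.symbA L.symbB :=
  IsSplitting.of_ker_le_range L.symbA_surjective L.symbB_injective L.symbA_comp_symbB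
    (fun z hz => by
      obtain ⟨x, rfl⟩ := L.mem_symbP_of_symbA_eq_zero hz
      exact ⟨-(isHomogCocycle_gen₁ k V).mulChar p (L.proj x), by
        rw [map_neg, symbB_mulChar, neg_neg]⟩)

/-- The splitting of `V♭` defined by a lifting of `V`. -/
def toSpl : Spl (flatV k V) where
  carrier := L.Symb
  a := L.symbA
  b := L.symbB
  isSplitting := L.isSplitting

end

end Lift

namespace Spl

variable {k : Type u} [Field k] {C : ChainComplex (ModuleCat.{u} k) ℕ} {S T : Spl C}

theorem a_b (S : Spl C) (m : C.X 1) : S.a (S.b m) = (C.d 1 0).hom m :=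
  LinearMap.congr_fun S.isSplitting.comp m

theorem bijective_of_comm {φ : S.carrier →ₗ[k] T.carrier} (ha : ∀ z, T.a (φ z) = S.a z)
    (hb : ∀ m, φ (S.b m) = T.b m) : Function.Bijective φ := by
  constructor
  · refine (injective_iff_map_eq_zero φ).2 fun z hz => ?_
    obtain ⟨m, -, rfl⟩ := S.isSplitting.ker.surjOn
      (show S.a z = 0 by rw [← ha, hz, map_zero])
    rw [hb, map_eq_zero_iff T.b T.isSplitting.injective] at hz
    rw [hz, map_zero]
  · intro y
    obtain ⟨z, hz⟩ := S.isSplitting.surjective (T.a y)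
    obtain ⟨m, -, hm⟩ := T.isSplitting.ker.surjOn
      (show T.a (y - φ z) = 0 by rw [map_sub, ha, hz, sub_self])
    exact ⟨z + S.b m, by rw [map_add, hb, hm, add_sub_cancel]⟩

/-- An extension of `b` along `b` is corrected by a map that vanishes on the image of `b`. -/
theorem nonempty_hom (S T : Spl C) : Nonempty (S ⟶ T) := by
  obtain ⟨ρ, hρ⟩ := S.b.exists_leftInverse_of_injective
    (LinearMap.ker_eq_bot.2 S.isSplitting.injective)
  obtain ⟨σ, hσ⟩ := T.a.exists_rightInverse_of_surjective
    (LinearMap.range_eq_top.2 T.isSplitting.surjective)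
  have ρ_b : ∀ m, ρ (S.b m) = m := LinearMap.congr_fun hρ
  have a_σ : ∀ x, T.a (σ x) = x := LinearMap.congr_fun hσ
  let φ := T.b ∘ₗ ρ + σ ∘ₗ (S.a - T.a ∘ₗ T.b ∘ₗ ρ)
  have ha : ∀ z, T.a (φ z) = S.a z := fun z => by
    simp only [φ, LinearMap.add_apply, LinearMap.comp_apply, LinearMap.sub_apply, map_add, a_σ,
      add_sub_cancel]
  have hb : ∀ m, φ (S.b m) = T.b m := fun m => by
    simp only [φ, LinearMap.add_apply, LinearMap.comp_apply, LinearMap.sub_apply, ρ_b, a_b,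
      sub_self, map_zero, add_zero]
  exact ⟨Spl.Hom.mk (LinearEquiv.ofBijective φ (bijective_of_comm ha hb)) ha hb⟩

end Spl

namespace Lift

open FlatV

variable {p : ℕ} [Fact p.Prime] {k : Type u} [Field k] {U V W : Type u}
  [AddCommGroup U] [Module k U] [AddCommGroup V] [Module k V] [AddCommGroup W] [Module k W]

section

variable {L : Lift p k V} {M : Lift p k W}

/-- Functoriality of the space of symbols. -/
def symbMap {f : V →ₗ[k] W} (φ : HomOver f L M) : L.Symb →ₗ[k] M.Symb :=
  L.symbLift (fun x => M.symb (φ.φ x)) (fun c x => by rw [map_smul, symb_smul])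
    (fun x y => by rw [map_add, map_smul, symb_add])

@[simp]
theorem symbMap_symb {f : V →ₗ[k] W} (φ : HomOver f L M) (x : L.carrier) :
    symbMap φ (L.symb x) = M.symb (φ.φ x) :=
  L.symbLift_symb ..

theorem symbA_symbMap {f : V →ₗ[k] W} (φ : HomOver f L M) (z : L.Symb) :
    M.symbA (symbMap φ z) = ((flatVMap f).f 0).hom (L.symbA z) := by
  have : M.symbA ∘ₗ symbMap φ = ((flatVMap f).f 0).hom ∘ₗ L.symbA :=
    Symb.hom_ext fun x => by
      simp only [LinearMap.comp_apply, symbMap_symb, symbA_symb, φ.comm]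
      exact (map_gen₀ f _).symm
  exact LinearMap.congr_fun this z

theorem symbMap_symbB {f : V →ₗ[k] W} (φ : HomOver f L M) (m : (flatV k V).X 1) :
    symbMap φ (L.symbB m) = M.symbB (((flatVMap f).f 1).hom m) := by
  have : symbMap φ ∘ₗ L.symbB = M.symbB ∘ₗ ((flatVMap f).f 1).hom := by
    refine hom_ext₁ fun v w => ?_
    obtain ⟨x, rfl⟩ := L.surjective v
    obtain ⟨y, rfl⟩ := L.surjective w
    rw [LinearMap.comp_apply, LinearMap.comp_apply, symbB_gen, map_gen₁, ← φ.comm, ← φ.comm,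
      symbB_gen]
    simp
  exact LinearMap.congr_fun this m

theorem symbMap_comp {K : Lift p k U} {f : U →ₗ[k] V} {g : V →ₗ[k] W} (ψ : HomOver g L M)
    (φ : HomOver f K L) : symbMap (ψ.comp φ) = symbMap ψ ∘ₗ symbMap φ :=
  Symb.hom_ext fun x => by simp [HomOver.comp]

end

variable {L M : Lift p k V}

/-- The isomorphism of the spaces of symbols defined by an isomorphism of liftings. -/
def symbEquiv (g : L ⟶ M) : L.Symb ≃ₗ[k] M.Symb :=
  LinearEquiv.ofLinearMap (symbMap (Hom.toHomOver g)) (symbMap (Hom.toHomOver (Groupoid.inv g)))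
    (Symb.hom_ext fun x => by
      simp only [LinearMap.comp_apply, symbMap_symb, LinearMap.id_apply]
      exact congrArg M.symb (g.e.apply_symm_apply x))
    (Symb.hom_ext fun x => by
      simp only [LinearMap.comp_apply, symbMap_symb, LinearMap.id_apply]
      exact congrArg L.symb (g.e.symm_apply_apply x))

@[simp]
theorem symbEquiv_symb (g : L ⟶ M) (x : L.carrier) : symbEquiv g (L.symb x) = M.symb (g.e x) :=
  symbMap_symb ..

theorem flatVMap_id_apply (n : ℕ) (x : (flatV k V).X n) :
    ((flatVMap (LinearMap.id : V →ₗ[k] V)).f n).hom x = x := by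
  obtain ⟨x, rfl⟩ := Submodule.Quotient.mk_surjective (flatSub (QBarCx k V) n) x
  exact congrArg (Submodule.Quotient.mk (p := flatSub (QBarCx k V) n))
    (LinearMap.congr_fun (QBar.map_id k V n) x)

theorem symbA_symbEquiv (g : L ⟶ M) (z : L.Symb) : M.symbA (symbEquiv g z) = L.symbA z :=
  (symbA_symbMap (Hom.toHomOver g) z).trans (flatVMap_id_apply 0 _)

theorem symbEquiv_symbB (g : L ⟶ M) (m : (flatV k V).X 1) :
    symbEquiv g (L.symbB m) = M.symbB m :=
  (symbMap_symbB (Hom.toHomOver g) m).trans (congrArg M.symbB (flatVMap_id_apply 1 m))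

variable [CharP k p] [Finite k]

/-- The map of splittings defined by a map of liftings. -/
def HomOver.toSpl {f : V →ₗ[k] W} {L : Lift p k V} {M : Lift p k W} (φ : HomOver f L M) :
    Spl.HomOver (flatVMap f) L.toSpl M.toSpl :=
  Spl.HomOver.mk (symbMap φ) (symbA_symbMap φ) (symbMap_symbB φ)

/-- A map `e` commutes with `b`, and `x ↦ [x]` is injective, so the map of liftings that `e` induces
on the symbols is additive. -/
theorem exists_symbMap_eq {f : V →ₗ[k] W} {L : Lift p k V} {M : Lift p k W}
    (e : L.Symb →ₗ[k] M.Symb) (ha : ∀ z, M.symbA (e z) = ((flatVMap f).f 0).hom (L.symbA z))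
    (hb : ∀ m, e (L.symbB m) = M.symbB (((flatVMap f).f 1).hom m)) :
    ∃ φ : HomOver f L M, symbMap φ = e := by
  have symbA_e : ∀ x, M.symbA (e (L.symb x)) = gen₀ k (f (L.proj x)) := fun x => by
    rw [ha, symbA_symb]
    exact map_gen₀ f _
  choose g symb_g using fun x => M.exists_symb_eq_of_symbA_eq (symbA_e x)
  have proj_g : ∀ x, M.proj (g x) = f (L.proj x) := fun x => gen₀_injective (k := k) (by
    rw [← symbA_symb, symb_g, symbA_e])
  have g_add : ∀ x y, g (x + y) = g x + g y := fun x y => by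
    have e_symbB := hb (gen₁ k (L.proj x) (L.proj y))
    rw [map_gen₁, ← proj_g, ← proj_g, symbB_gen, symbB_gen, map_sub, map_add, ← symb_g, ← symb_g,
      ← symb_g] at e_symbB
    exact M.symb_injective (sub_right_injective e_symbB)
  have g_teich_smul : ∀ (c : k) x, g (teich p c • x) = teich p c • g x := fun c x =>
    M.symb_injective (by rw [symb_g, symb_smul, symb_smul, symb_g, map_smul])
  let φ : HomOver f L M :=
    { φ :=
        { toFun := g
          map_add' := g_add
          map_smul' := map_smul_of_map_teich_smul (AddMonoidHom.mk' g g_add) g_teich_smul }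
      comm := proj_g }
  exact ⟨φ, Symb.hom_ext fun x => (symbMap_symb φ x).trans (symb_g x)⟩

theorem exists_symbEquiv_eq (e : L.Symb ≃ₗ[k] M.Symb) (ha : ∀ z, M.symbA (e z) = L.symbA z)
    (hb : ∀ m, e (L.symbB m) = M.symbB m) : ∃ g : L ⟶ M, symbEquiv g = e := by
  obtain ⟨φ, hφ⟩ := exists_symbMap_eq (f := LinearMap.id) e.toLinearMap
    (fun z => (ha z).trans (flatVMap_id_apply 0 _).symm)
    (fun m => (hb m).trans (congrArg M.symbB (flatVMap_id_apply 1 m).symm))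
  have symb_φ : ∀ x, M.symb (φ.φ x) = e (L.symb x) := fun x =>
    (symbMap_symb φ x).symm.trans (LinearMap.congr_fun hφ (L.symb x))
  have φ_injective : Function.Injective φ.φ := fun x y hxy =>
    L.symb_injective (e.injective (by rw [← symb_φ, ← symb_φ, hxy]))
  have φ_surjective : Function.Surjective φ.φ := fun y => by
    obtain ⟨x, hx⟩ := L.exists_symb_eq_of_symbA_eq (z := e.symm (M.symb y)) (v := M.proj y)
      (by rw [← ha, e.apply_symm_apply, symbA_symb])
    exact ⟨x, M.symb_injective (by rw [symb_φ, hx, e.apply_symm_apply])⟩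
  exact ⟨Hom.mk (LinearEquiv.ofBijective φ.φ ⟨φ_injective, φ_surjective⟩) φ.comm,
    LinearEquiv.toLinearMap_injective hφ⟩

variable (p k V) in
/-- The functor from liftings to splittings. -/
def splFunctor : Lift p k V ⥤ Spl (flatV k V) where
  obj L := L.toSpl
  map g := Spl.Hom.mk (symbEquiv g) (symbA_symbEquiv g) (symbEquiv_symbB g)
  map_id L := Spl.Hom.ext (LinearEquiv.toLinearMap_injective (Symb.hom_ext fun x =>
    symbEquiv_symb (𝟙 L) x))
  map_comp g h := Spl.Hom.ext (LinearEquiv.toLinearMap_injective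
    (Symb.hom_ext fun x => (symbEquiv_symb (g ≫ h) x).trans
      ((congrArg (symbEquiv h) (symbEquiv_symb g x)).trans (symbEquiv_symb h _)).symm))

instance : (splFunctor p k V).Faithful where
  map_injective {L M g h} e := by
    refine Hom.ext (LinearEquiv.ext fun x => M.symb_injective ?_)
    rw [← symbEquiv_symb, ← symbEquiv_symb]
    exact LinearEquiv.congr_fun (congrArg Spl.Hom.e e) (L.symb x)

instance : (splFunctor p k V).Full where
  map_surjective e := by
    obtain ⟨g, hg⟩ := exists_symbEquiv_eq e.e e.comm_a e.comm_b
    exact ⟨g, Spl.Hom.ext hg⟩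

instance : (splFunctor p k V).EssSurj where
  mem_essImage S := by
    obtain ⟨L⟩ := Lift.nonempty p k V
    obtain ⟨e⟩ := Spl.nonempty_hom L.toSpl S
    exact ⟨L, ⟨(Groupoid.isoEquivHom _ _).symm e⟩⟩

instance : (splFunctor p k V).IsEquivalence where

end Lift

namespace AlgLift

open FlatA Lift

variable {p : ℕ} [Fact p.Prime] {k : Type u} [Field k] {A : Type u} [Ring A] [Algebra k A]

/-- The underlying lifting of vector spaces. -/
def toLift (L : AlgLift p k A) : Lift p k A := (AlgLift.forget p k A).obj L

variable (L : AlgLift p k A)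

/-- The symbol of an element of `A'`. -/
def symb (x : L.carrier) : L.toLift.Symb := L.toLift.symb x

theorem symb_teich_smul (c : k) (x : L.carrier) : L.symb (teich p c • x) = c • L.symb x :=
  L.toLift.symb_smul c x

theorem symb_add_smul (x y : L.carrier) :
    L.symb (x + (p : W₂ p k) • y) = L.symb x + L.symb ((p : W₂ p k) • y) :=
  L.toLift.symb_add x y

/-- The map `[x] ↦ [x mod p]`, with values in the degree `0` part of the DG algebra `A♭`. -/
def symbA : L.toLift.Symb →ₗ[k] (flatA k A).cx.X 0 := L.toLift.symbA

/-- The map `[v, w] ↦ [x] + [y] - [x + y]` on the degree `1` part of the DG algebra `A♭`. -/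
def symbB : (flatA k A).cx.X 1 →ₗ[k] L.toLift.Symb := L.toLift.symbB

theorem symbA_symb (x : L.carrier) : L.symbA (L.symb x) = gen₀ k (L.proj x) :=
  L.toLift.symbA_symb x

theorem symbB_gen (x y : L.carrier) : L.symbB (gen₁ k (L.proj x) (L.proj y)) =
    L.symb x + L.symb y - L.symb (x + y) :=
  L.toLift.symbB_gen x y

theorem symb_hom_ext {L : AlgLift p k A} {N : Type u} [AddCommGroup N] [Module k N]
    {φ ψ : L.toLift.Symb →ₗ[k] N} (h : ∀ x, φ (L.symb x) = ψ (L.symb x)) : φ = ψ :=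
  Symb.hom_ext h

theorem symb_hom_ext₂ {L : AlgLift p k A} {N : Type u} [AddCommGroup N] [Module k N]
    {φ ψ : L.toLift.Symb →ₗ[k] L.toLift.Symb →ₗ[k] N}
    (h : ∀ x y, φ (L.symb x) (L.symb y) = ψ (L.symb x) (L.symb y)) : φ = ψ :=
  symb_hom_ext fun x => symb_hom_ext (h x)

/-- The universal property of the space of symbols. -/
def symbLift {N : Type u} [AddCommGroup N] [Module k N] (φ : L.carrier → N)
    (hs : ∀ (c : kˣ) x, φ (teich p (c : k) • x) = (c : k) • φ x)
    (hp : ∀ x y, φ (x + (p : W₂ p k) • y) = φ x + φ ((p : W₂ p k) • y)) :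
    L.toLift.Symb →ₗ[k] N :=
  L.toLift.symbLift φ hs hp

theorem symbLift_symb {N : Type u} [AddCommGroup N] [Module k N] (φ : L.carrier → N)
    (hs : ∀ (c : kˣ) x, φ (teich p (c : k) • x) = (c : k) • φ x)
    (hp : ∀ x y, φ (x + (p : W₂ p k) • y) = φ x + φ ((p : W₂ p k) • y)) (x : L.carrier) :
    L.symbLift φ hs hp (L.symb x) = φ x :=
  L.toLift.symbLift_symb φ hs hp x

/-- The product of symbols, `[x] [y] = [x y]`. -/
def symbMul : L.toLift.Symb →ₗ[k] L.toLift.Symb →ₗ[k] L.toLift.Symb :=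
  L.symbLift
    (fun x => L.symbLift (fun y => L.symb (x * y))
      (fun c y => by rw [mul_smul_comm, symb_teich_smul])
      (fun y z => by rw [mul_add, mul_smul_comm, symb_add_smul]))
    (fun c x => symb_hom_ext fun y => by
      rw [LinearMap.smul_apply, symbLift_symb, symbLift_symb, smul_mul_assoc, symb_teich_smul])
    (fun x z => symb_hom_ext fun y => by
      rw [LinearMap.add_apply, symbLift_symb, symbLift_symb, symbLift_symb, add_mul,
        smul_mul_assoc, symb_add_smul])

theorem symbMul_symb (x y : L.carrier) :
    L.symbMul (L.symb x) (L.symb y) = L.symb (x * y) := by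
  rw [symbMul, symbLift_symb, symbLift_symb]

theorem symbMul_assoc (x y z : L.toLift.Symb) :
    L.symbMul (L.symbMul x y) z = L.symbMul x (L.symbMul y z) := by
  have : L.symbMul.compr₂ L.symbMul =
      (LinearMap.mul k (Module.End k L.toLift.Symb)).compl₁₂ L.symbMul L.symbMul :=
    symb_hom_ext₂ fun x y => symb_hom_ext fun z => by
      simp only [LinearMap.compr₂_apply, LinearMap.compl₁₂_apply, LinearMap.mul_apply',
        Module.End.mul_apply, symbMul_symb, mul_assoc]
  exact LinearMap.congr_fun (LinearMap.congr_fun₂ this x y) z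

theorem symb_one_symbMul (x : L.toLift.Symb) : L.symbMul (L.symb 1) x = x := by
  have : L.symbMul (L.symb 1) = LinearMap.id := symb_hom_ext fun x => by
    rw [symbMul_symb, one_mul, LinearMap.id_apply]
  exact LinearMap.congr_fun this x

theorem symbMul_symb_one (x : L.toLift.Symb) : L.symbMul x (L.symb 1) = x := by
  have : L.symbMul.flip (L.symb 1) = LinearMap.id := symb_hom_ext fun x => by
    rw [LinearMap.flip_apply, symbMul_symb, mul_one, LinearMap.id_apply]
  exact LinearMap.congr_fun this x

instance : Ring L.toLift.Symb where
  __ := (inferInstance : AddCommGroup L.toLift.Symb)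
  mul x y := L.symbMul x y
  one := L.symb 1
  left_distrib x y z := map_add (L.symbMul x) y z
  right_distrib x y z := LinearMap.map_add₂ L.symbMul x y z
  zero_mul x := LinearMap.map_zero₂ L.symbMul x
  mul_zero x := map_zero (L.symbMul x)
  mul_assoc := L.symbMul_assoc
  one_mul := L.symb_one_symbMul
  mul_one := L.symbMul_symb_one

instance : Algebra k L.toLift.Symb :=
  Algebra.ofModule (fun c x y => LinearMap.map_smul₂ L.symbMul c x y)
    (fun c x y => map_smul (L.symbMul x) c y)

theorem symb_mul (x y : L.carrier) : L.symb (x * y) = L.symb x * L.symb y :=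
  (L.symbMul_symb x y).symm

theorem symb_one : L.symb 1 = 1 := rfl

theorem map_mul_of_map_symb_mul {B : Type u} [Ring B] [Algebra k B] {φ : L.toLift.Symb →ₗ[k] B}
    (h : ∀ x y, φ (L.symb (x * y)) = φ (L.symb x) * φ (L.symb y)) (x y : L.toLift.Symb) :
    φ (x * y) = φ x * φ y := by
  have : L.symbMul.compr₂ φ = (LinearMap.mul k B).compl₁₂ φ φ := symb_hom_ext₂ fun x y => by
    rw [LinearMap.compr₂_apply, LinearMap.compl₁₂_apply, LinearMap.mul_apply', symbMul_symb, h]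
  exact LinearMap.congr_fun₂ this x y

theorem symbA_one : L.symbA 1 = (flatA k A).one := by
  rw [← symb_one, symbA_symb, map_one, one_eq]

theorem symbA_mul (x y : L.toLift.Symb) :
    L.symbA (x * y) = (flatA k A).mul (zero_add 0) (L.symbA x) (L.symbA y) := by
  have : L.symbMul.compr₂ L.symbA = ((flatA k A).mul (zero_add 0)).compl₁₂ L.symbA L.symbA :=
    symb_hom_ext₂ fun x y => by
      rw [LinearMap.compr₂_apply, LinearMap.compl₁₂_apply, symbMul_symb, symbA_symb, symbA_symb,
        symbA_symb, map_mul, mul_gen₀_gen₀]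
  exact LinearMap.congr_fun₂ this x y

theorem symbB_left (x : L.toLift.Symb) (m : (flatA k A).cx.X 1) :
    L.symbB ((flatA k A).mul (zero_add 1) (L.symbA x) m) = x * L.symbB m := by
  have : ((flatA k A).mul (zero_add 1)).compr₂ L.symbB ∘ₗ L.symbA = L.symbMul.compl₂ L.symbB := by
    refine symb_hom_ext fun x => hom_ext₁ fun v w => ?_
    obtain ⟨y, rfl⟩ := L.surjective v
    obtain ⟨z, rfl⟩ := L.surjective w
    rw [LinearMap.comp_apply, LinearMap.compr₂_apply, LinearMap.compl₂_apply, symbA_symb,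
      mul_gen₀_gen₁, ← map_mul, ← map_mul, symbB_gen, symbB_gen, map_sub, map_add, symbMul_symb,
      symbMul_symb, symbMul_symb, mul_add]
  exact LinearMap.congr_fun₂ this x m

theorem symbB_right (x : L.toLift.Symb) (m : (flatA k A).cx.X 1) :
    L.symbB ((flatA k A).mul (add_zero 1) m (L.symbA x)) = L.symbB m * x := by
  have : ((flatA k A).mul (add_zero 1)).flip.compr₂ L.symbB ∘ₗ L.symbA =
      L.symbMul.flip.compl₂ L.symbB := by
    refine symb_hom_ext fun x => hom_ext₁ fun v w => ?_
    obtain ⟨y, rfl⟩ := L.surjective v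
    obtain ⟨z, rfl⟩ := L.surjective w
    rw [LinearMap.comp_apply, LinearMap.compr₂_apply, LinearMap.compl₂_apply, symbA_symb,
      LinearMap.flip_apply, mul_gen₁_gen₀, ← map_mul, ← map_mul, symbB_gen, symbB_gen, map_sub,
      map_add, LinearMap.flip_apply, LinearMap.flip_apply, LinearMap.flip_apply, symbMul_symb,
      symbMul_symb, symbMul_symb, add_mul]
  exact LinearMap.congr_fun₂ this x m

section

variable {L} {B : Type u} [Ring B] [Algebra k B] {M : AlgLift p k B} {f : A →ₗ[k] B}

/-- Functoriality of the algebra of symbols. -/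
def symbAlgHom (φ : L.carrier →ₐ[W₂ p k] M.carrier) (hφ : ∀ x, M.proj (φ x) = f (L.proj x)) :
    L.toLift.Symb →ₐ[k] M.toLift.Symb :=
  let φ' : Lift.HomOver f L.toLift M.toLift := ⟨φ.toLinearMap, hφ⟩
  have symbMap_symb' : ∀ x : L.carrier, symbMap φ' (L.symb x) = M.symb (φ x) := symbMap_symb φ'
  AlgHom.ofLinearMap (symbMap φ') (by rw [← symb_one, symbMap_symb', map_one, symb_one])
    (L.map_mul_of_map_symb_mul fun x y => by
      rw [symbMap_symb', symbMap_symb', symbMap_symb', map_mul, symb_mul])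

theorem symbAlgHom_symb (φ : L.carrier →ₐ[W₂ p k] M.carrier)
    (hφ : ∀ x, M.proj (φ x) = f (L.proj x)) (x : L.carrier) :
    symbAlgHom φ hφ (L.symb x) = M.symb (φ x) :=
  symbMap_symb (L := L.toLift) (M := M.toLift) (f := f) ⟨φ.toLinearMap, hφ⟩ x

theorem algEquiv_ext {e e' : L.toLift.Symb ≃ₐ[k] B} (h : ∀ x, e (L.symb x) = e' (L.symb x)) :
    e = e' :=
  AlgEquiv.ext fun z => LinearMap.congr_fun
    (symb_hom_ext (φ := e.toLinearMap) (ψ := e'.toLinearMap) h) z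

end

/-- The isomorphism of the algebras of symbols defined by an isomorphism of algebra liftings. -/
def symbAlgEquiv {L M : AlgLift p k A} (g : L ⟶ M) : L.toLift.Symb ≃ₐ[k] M.toLift.Symb :=
  AlgEquiv.ofLinearEquiv (symbEquiv ((AlgLift.forget p k A).map g))
    (map_one (symbAlgHom (f := LinearMap.id) g.e.toAlgHom g.comm))
    (map_mul (symbAlgHom (f := LinearMap.id) g.e.toAlgHom g.comm))

theorem symbAlgEquiv_symb {L M : AlgLift p k A} (g : L ⟶ M) (x : L.carrier) :
    symbAlgEquiv g (L.symb x) = M.symb (g.e x) :=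
  symbEquiv_symb ((AlgLift.forget p k A).map g) x

variable [CharP k p] [Finite k]

theorem symb_injective : Function.Injective L.symb := L.toLift.symb_injective

/-- The multiplicative splitting of `A♭` defined by an algebra lifting of `A`. -/
def toMulSpl : MulSpl (flatA k A) where
  carrier := L.toLift.Symb
  a := L.symbA
  b := L.symbB
  isSplitting := L.toLift.isSplitting
  map_one := L.symbA_one
  map_mul := L.symbA_mul
  left := L.symbB_left
  right := L.symbB_right

variable (p k A) in
/-- The functor from algebra liftings to multiplicative splittings. -/
def mulSplFunctor : AlgLift p k A ⥤ MulSpl (flatA k A) where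
  obj L := L.toMulSpl
  map g := MulSpl.Hom.mk (symbAlgEquiv g)
    (fun z => symbA_symbEquiv ((AlgLift.forget p k A).map g) z)
    (fun m => symbEquiv_symbB ((AlgLift.forget p k A).map g) m)
  map_id L := MulSpl.Hom.ext (algEquiv_ext fun x => symbAlgEquiv_symb (𝟙 L) x)
  map_comp g h := MulSpl.Hom.ext (algEquiv_ext fun x => (symbAlgEquiv_symb (g ≫ h) x).trans
    ((congrArg (symbAlgEquiv h) (symbAlgEquiv_symb g x)).trans (symbAlgEquiv_symb h _)).symm)

variable (p k A) in
/-- The two functors from liftings to splittings are compatible. -/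
def forgetIso : mulSplFunctor p k A ⋙ forgetFlat k A ≅
    AlgLift.forget p k A ⋙ splFunctor p k A :=
  NatIso.ofComponents (fun L => (Groupoid.isoEquivHom _ _).symm
      (Spl.Hom.mk (LinearEquiv.refl k L.toLift.Symb) (fun _ => rfl) (fun _ => rfl)))
    (fun _ => rfl)

instance : (mulSplFunctor p k A).Faithful where
  map_injective {L M g h} e := by
    refine Hom.ext (AlgEquiv.ext fun x => M.symb_injective ?_)
    rw [← symbAlgEquiv_symb, ← symbAlgEquiv_symb]
    exact AlgEquiv.congr_fun (congrArg MulSpl.Hom.e e) (L.symb x)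

instance : (mulSplFunctor p k A).Full where
  map_surjective {L M} e := by
    let e' : L.toLift.Symb ≃ₐ[k] M.toLift.Symb := e.e
    obtain ⟨g, hg⟩ := exists_symbEquiv_eq e'.toLinearEquiv e.comm_a e.comm_b
    let g' : L.carrier ≃ₗ[W₂ p k] M.carrier := g.e
    have symb_g : ∀ x : L.carrier, M.symb (g' x) = e' (L.symb x) := fun x =>
      (symbEquiv_symb g x).symm.trans (LinearEquiv.congr_fun hg (L.symb x))
    have g_one : g' 1 = 1 := M.symb_injective (by
      rw [symb_g, symb_one, symb_one, map_one])
    have g_mul : ∀ x y, g' (x * y) = g' x * g' y := fun x y => M.symb_injective (by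
      rw [symb_g, symb_mul, symb_mul, symb_g, symb_g, map_mul])
    let G : L ⟶ M := Hom.mk (AlgEquiv.ofLinearEquiv g' g_one g_mul) g.comm
    exact ⟨G, MulSpl.Hom.ext (algEquiv_ext fun x => (symbAlgEquiv_symb G x).trans (symb_g x))⟩

section Transport

variable {S : MulSpl (flatA k A)} {L : Lift p k A} {e : L.Symb ≃ₗ[k] S.carrier}
  (ha : ∀ z, S.a (e z) = L.symbA z) (hb : ∀ m : (flatA k A).cx.X 1, e (L.symbB m) = S.b m)

theorem apply_symb_injective (e : L.Symb ≃ₗ[k] S.carrier) :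
    Function.Injective fun x => e (L.symb x) :=
  e.injective.comp L.symb_injective

section

omit [CharP k p] [Finite k]

include hb in
theorem b_gen₁ (x y : L.carrier) : S.b (gen₁ k (L.proj x) (L.proj y)) =
    e (L.symb x) + e (L.symb y) - e (L.symb (x + y)) := by
  rw [← map_add, ← map_sub]
  exact (hb _).symm.trans (congrArg e (L.symbB_gen x y))

include ha

theorem a_apply_symb (x : L.carrier) : S.a (e (L.symb x)) = gen₀ k (L.proj x) :=
  (ha _).trans (L.symbA_symb x)

theorem a_apply_symb_mul (x y : L.carrier) :
    S.a (e (L.symb x) * e (L.symb y)) = gen₀ k (L.proj x * L.proj y) := by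
  rw [S.map_mul, a_apply_symb ha, a_apply_symb ha, mul_gen₀_gen₀]

theorem exists_apply_symb_eq {z : S.carrier} {v : A} (hz : S.a z = gen₀ k v) :
    ∃ x, L.proj x = v ∧ e (L.symb x) = z := by
  obtain ⟨t, rfl⟩ := e.surjective z
  obtain ⟨x, rfl⟩ := L.exists_symb_eq_of_symbA_eq ((ha t).symm.trans hz)
  exact ⟨x, gen₀_injective (k := k) ((a_apply_symb ha x).symm.trans hz), rfl⟩

/-- The element of a lifting of `A` that corresponds to the unit of a splitting. -/
def transportOne : L.carrier :=
  (exists_apply_symb_eq ha (S.map_one.trans one_eq)).choose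

theorem proj_transportOne : L.proj (transportOne ha) = 1 :=
  (exists_apply_symb_eq ha (S.map_one.trans one_eq)).choose_spec.1

theorem apply_symb_transportOne : e (L.symb (transportOne ha)) = 1 :=
  (exists_apply_symb_eq ha (S.map_one.trans one_eq)).choose_spec.2

end

include ha hb in
/-- The additivity of the product amounts to `b` being a map of bimodules. -/
theorem exists_apply_symb_mul_eq :
    ∃ m : L.carrier →ₗ[W₂ p k] L.carrier →ₗ[W₂ p k] L.carrier, ∀ x y,
      L.proj (m x y) = L.proj x * L.proj y ∧ e (L.symb (m x y)) = e (L.symb x) * e (L.symb y) := by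
  choose m m_proj m_symb using fun x y => exists_apply_symb_eq ha (a_apply_symb_mul ha x y)
  have inj := apply_symb_injective e
  have m_add : ∀ x y z, m x (y + z) = m x y + m x z := fun x y z => by
    have b_left := S.left (e (L.symb x)) (gen₁ k (L.proj y) (L.proj z))
    rw [a_apply_symb ha, mul_gen₀_gen₁, ← m_proj, ← m_proj, b_gen₁ hb, b_gen₁ hb, mul_sub,
      mul_add, ← m_symb, ← m_symb, ← m_symb] at b_left
    exact (inj (sub_right_injective b_left)).symm
  have add_m : ∀ x y z, m (x + y) z = m x z + m y z := fun x y z => by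
    have b_right := S.right (e (L.symb z)) (gen₁ k (L.proj x) (L.proj y))
    rw [a_apply_symb ha, mul_gen₁_gen₀, ← m_proj, ← m_proj, b_gen₁ hb, b_gen₁ hb, sub_mul,
      add_mul, ← m_symb, ← m_symb, ← m_symb] at b_right
    exact (inj (sub_right_injective b_right)).symm
  have smul_m : ∀ (w : W₂ p k) x y, m (w • x) y = w • m x y := fun w x y =>
    map_smul_of_map_teich_smul (AddMonoidHom.mk' (m · y) (add_m · · y))
      (fun c x => inj (by
        simp only [AddMonoidHom.mk'_apply, m_symb, symb_smul, map_smul, smul_mul_assoc])) w x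
  have m_smul : ∀ (w : W₂ p k) x y, m x (w • y) = w • m x y := fun w x y =>
    map_smul_of_map_teich_smul (AddMonoidHom.mk' (m x) (m_add x))
      (fun c y => inj (by
        simp only [AddMonoidHom.mk'_apply, m_symb, symb_smul, map_smul, mul_smul_comm])) w y
  exact ⟨LinearMap.mk₂ _ m add_m smul_m m_add m_smul, fun x y => ⟨m_proj x y, m_symb x y⟩⟩

/-- The product on a lifting of `A` that corresponds to the product on a splitting. -/
def transportMul : L.carrier →ₗ[W₂ p k] L.carrier →ₗ[W₂ p k] L.carrier :=
  (exists_apply_symb_mul_eq ha hb).choose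

theorem proj_transportMul (x y : L.carrier) :
    L.proj (transportMul ha hb x y) = L.proj x * L.proj y :=
  ((exists_apply_symb_mul_eq ha hb).choose_spec x y).1

theorem apply_symb_transportMul (x y : L.carrier) :
    e (L.symb (transportMul ha hb x y)) = e (L.symb x) * e (L.symb y) :=
  ((exists_apply_symb_mul_eq ha hb).choose_spec x y).2

/-- The ring structure on a lifting of `A` that corresponds to the product on a splitting. -/
abbrev transportRing : Ring L.carrier where
  __ := L.addCommGroup
  mul x y := transportMul ha hb x y
  one := transportOne ha
  left_distrib x := map_add (transportMul ha hb x)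
  right_distrib := LinearMap.map_add₂ (transportMul ha hb)
  zero_mul := LinearMap.map_zero₂ (transportMul ha hb)
  mul_zero x := map_zero (transportMul ha hb x)
  mul_assoc x y z := apply_symb_injective e (by
    change e (L.symb (transportMul ha hb (transportMul ha hb x y) z)) =
      e (L.symb (transportMul ha hb x (transportMul ha hb y z)))
    simp only [apply_symb_transportMul, mul_assoc])
  one_mul x := apply_symb_injective e (by
    change e (L.symb (transportMul ha hb (transportOne ha) x)) = e (L.symb x)
    rw [apply_symb_transportMul, apply_symb_transportOne, one_mul])
  mul_one x := apply_symb_injective e (by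
    change e (L.symb (transportMul ha hb x (transportOne ha))) = e (L.symb x)
    rw [apply_symb_transportMul, apply_symb_transportOne, mul_one])

/-- The `W₂(k)`-algebra structure on a lifting of `A` that corresponds to the product on a
splitting. -/
abbrev transportAlgebra : letI := transportRing ha hb; Algebra (W₂ p k) L.carrier :=
  @Algebra.ofModule (W₂ p k) L.carrier _ (transportRing ha hb).toSemiring L.module
    (LinearMap.map_smul₂ (transportMul ha hb)) fun w x y => map_smul (transportMul ha hb x) w y

/-- The projection of a lifting to `A`, as a homomorphism for the product `transportMul`. -/
abbrev transportProj : letI := transportRing ha hb; L.carrier →+* A :=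
  letI := transportRing ha hb
  { toFun := L.proj
    map_add' := map_add L.proj
    map_zero' := map_zero L.proj
    map_one' := proj_transportOne ha
    map_mul' := proj_transportMul ha hb }

/-- The algebra lifting that corresponds to a multiplicative splitting. -/
def ofSplIso : AlgLift p k A where
  carrier := L.carrier
  ring := transportRing ha hb
  algebra := transportAlgebra ha hb
  flat := L.flat
  proj := transportProj ha hb
  proj_algebraMap w := by
    change L.proj (w • transportOne ha) = _
    rw [LinearMap.map_smulₛₗ, proj_transportOne, Algebra.algebraMap_eq_smul_one]
  surjective := L.surjective
  ker := L.ker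

/-- The splitting defined by `ofSplIso` is the given one. -/
def toMulSplOfSplIso : (ofSplIso ha hb).toMulSpl ⟶ S :=
  let e' : (ofSplIso ha hb).toLift.Symb ≃ₗ[k] S.carrier := e
  MulSpl.Hom.mk
    (AlgEquiv.ofLinearEquiv e' (apply_symb_transportOne ha)
      ((ofSplIso ha hb).map_mul_of_map_symb_mul (φ := e'.toLinearMap)
        (apply_symb_transportMul ha hb)))
    ha hb

end Transport

instance : (mulSplFunctor p k A).EssSurj where
  mem_essImage S := by
    obtain ⟨L⟩ := Lift.nonempty p k A
    obtain ⟨e⟩ := Spl.nonempty_hom L.toSpl ((forgetFlat k A).obj S)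
    exact ⟨ofSplIso e.comm_a e.comm_b,
      ⟨(Groupoid.isoEquivHom _ _).symm (toMulSplOfSplIso e.comm_a e.comm_b)⟩⟩

instance : (mulSplFunctor p k A).IsEquivalence where

end AlgLift

namespace DGAlg

variable {k : Type u} [Field k]

/-- A replacement of the degree `0` part of a DG algebra `B`: an algebra `K` with an algebra map
`a : K → B₀` through which the differential `B₁ → B₀` factors by a map of `K`-bimodules
`b : B₁ → K` that vanishes on boundaries. -/
structure Replacement (B : DGAlg k) where
  /-- the algebra `K` -/
  carrier : Type u
  [ring : Ring carrier]
  [algebra : Algebra k carrier]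
  /-- the map `K → B₀` -/
  a : carrier →ₗ[k] B.cx.X 0
  /-- the map `B₁ → K` -/
  b : B.cx.X 1 →ₗ[k] carrier
  comp : ∀ m, a (b m) = (B.cx.d 1 0).hom m
  b_d : ∀ x, b ((B.cx.d 2 1).hom x) = 0
  map_one : a 1 = B.one
  map_mul : ∀ x y, a (x * y) = B.mul (zero_add 0) (a x) (a y)
  left : ∀ x m, b (B.mul (zero_add 1) (a x) m) = x * b m
  right : ∀ x m, b (B.mul (add_zero 1) m (a x)) = b m * x

attribute [instance] Replacement.ring Replacement.algebra

namespace Replacement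

variable {B C : DGAlg k} (R : Replacement B) (S : Replacement C)

/-- The terms of the modified DG algebra. -/
def X : ℕ → ModuleCat.{u} k
  | 0 => ModuleCat.of k R.carrier
  | n + 1 => B.cx.X (n + 1)

/-- The projection to the original DG algebra. -/
def toTerm : ∀ n : ℕ, R.X n →ₗ[k] B.cx.X n
  | 0 => R.a
  | n + 1 => (LinearMap.id : B.cx.X (n + 1) →ₗ[k] B.cx.X (n + 1))

/-- The differential. -/
def δ : ∀ n : ℕ, R.X (n + 1) →ₗ[k] R.X n
  | 0 => R.b
  | n + 1 => (B.cx.d (n + 2) (n + 1)).hom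

/-- The product. -/
def product : ∀ i j n : ℕ, i + j = n → (R.X i →ₗ[k] R.X j →ₗ[k] R.X n)
  | 0, 0, 0, _ => LinearMap.mul k R.carrier
  | i, j, _ + 1, h => (B.mul h).compl₁₂ (R.toTerm i) (R.toTerm j)
  | _ + 1, _, 0, _ => 0
  | 0, _ + 1, 0, _ => 0

theorem toTerm_injective (n : ℕ) : Function.Injective (R.toTerm (n + 1)) := fun _ _ h => h

theorem toTerm_δ (n : ℕ) (x : R.X (n + 1)) :
    R.toTerm n (R.δ n x) = (B.cx.d (n + 1) n).hom (R.toTerm (n + 1) x) := by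
  cases n with
  | zero => exact R.comp x
  | succ n => rfl

theorem toTerm_product {i j n : ℕ} (h : i + j = n) (x : R.X i) (y : R.X j) :
    R.toTerm n (R.product i j n h x y) = B.mul h (R.toTerm i x) (R.toTerm j y) := by
  cases n with
  | zero =>
    obtain ⟨rfl, rfl⟩ : i = 0 ∧ j = 0 := by omega
    exact R.map_mul x y
  | succ n =>
    rcases i with _ | i
    · rcases j with _ | j <;> rfl
    · rfl

theorem δ_δ (n : ℕ) (x : R.X (n + 2)) : R.δ n (R.δ (n + 1) x) = 0 := by
  cases n with
  | zero => exact R.b_d x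
  | succ n => exact d_d_apply B.cx _ _ _ x

/-- The differential, as a morphism. -/
def δHom (n : ℕ) : R.X (n + 1) ⟶ R.X n := ModuleCat.ofHom (R.δ n)

/-- The complex of the modified DG algebra. -/
def cx : ChainComplex (ModuleCat.{u} k) ℕ :=
  ChainComplex.of R.X R.δHom
    (fun n => ModuleCat.hom_ext (LinearMap.ext fun x => R.δ_δ n x))

theorem cx_d (n : ℕ) : R.cx.d (n + 1) n = R.δHom n :=
  ChainComplex.of_d R.X R.δHom n

theorem cx_d_apply (n : ℕ) (x : R.X (n + 1)) : (R.cx.d (n + 1) n).hom x = R.δ n x := by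
  rw [cx_d]
  rfl

theorem product_assoc {i j l ij jl n : ℕ} (h₁ : i + j = ij) (h₂ : j + l = jl) (h₃ : ij + l = n)
    (h₄ : i + jl = n) (x : R.X i) (y : R.X j) (z : R.X l) :
    R.product ij l n h₃ (R.product i j ij h₁ x y) z =
      R.product i jl n h₄ x (R.product j l jl h₂ y z) := by
  cases n with
  | zero =>
    obtain ⟨rfl, rfl⟩ : ij = 0 ∧ l = 0 := by omega
    obtain ⟨rfl, rfl⟩ : i = 0 ∧ j = 0 := by omega
    obtain rfl : jl = 0 := by omega
    exact _root_.mul_assoc (G := R.carrier) x y z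
  | succ n =>
    apply R.toTerm_injective
    simp only [toTerm_product]
    exact B.mul_assoc h₁ h₂ h₃ h₄ _ _ _

theorem δ_product {i j n : ℕ} (h : i + 1 + (j + 1) = n + 1) (h₁ : i + (j + 1) = n)
    (h₂ : i + 1 + j = n) (x : R.X (i + 1)) (y : R.X (j + 1)) :
    R.δ n (R.product (i + 1) (j + 1) (n + 1) h x y) =
      R.product i (j + 1) n h₁ (R.δ i x) y +
        (-1 : k) ^ (i + 1) • R.product (i + 1) j n h₂ x (R.δ j y) := by
  obtain ⟨n, rfl⟩ : ∃ m, n = m + 1 := ⟨i + j, by omega⟩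
  apply R.toTerm_injective
  simp only [map_add, map_smul, toTerm_product, toTerm_δ]
  exact B.d_mul h h₁ h₂ _ _

theorem δ_product_zero {i n : ℕ} (h : i + 1 + 0 = n + 1) (h' : i + 0 = n) (x : R.X (i + 1))
    (y : R.X 0) : R.δ n (R.product (i + 1) 0 (n + 1) h x y) = R.product i 0 n h' (R.δ i x) y := by
  cases n with
  | zero =>
    obtain rfl : i = 0 := by omega
    exact R.right y x
  | succ n =>
    apply R.toTerm_injective
    simp only [toTerm_product, toTerm_δ]
    exact B.d_mul_zero h h' _ _

theorem δ_zero_product {j n : ℕ} (h : 0 + (j + 1) = n + 1) (h' : 0 + j = n) (x : R.X 0)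
    (y : R.X (j + 1)) : R.δ n (R.product 0 (j + 1) (n + 1) h x y) =
      R.product 0 j n h' x (R.δ j y) := by
  cases n with
  | zero =>
    obtain rfl : j = 0 := by omega
    exact R.left x y
  | succ n =>
    apply R.toTerm_injective
    simp only [toTerm_product, toTerm_δ]
    exact B.d_zero_mul h h' _ _

theorem one_product {n : ℕ} (h : 0 + n = n) (x : R.X n) :
    R.product 0 n n h (1 : R.carrier) x = x := by
  cases n with
  | zero => exact _root_.one_mul (M := R.carrier) x
  | succ n =>
    apply R.toTerm_injective
    refine (R.toTerm_product h _ x).trans ?_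
    exact (congrArg (fun t => B.mul h t _) R.map_one).trans (B.one_mul h _)

theorem product_one {n : ℕ} (h : n + 0 = n) (x : R.X n) :
    R.product n 0 n h x (1 : R.carrier) = x := by
  cases n with
  | zero => exact _root_.mul_one (M := R.carrier) x
  | succ n =>
    apply R.toTerm_injective
    refine (R.toTerm_product h x _).trans ?_
    exact (congrArg (B.mul h _) R.map_one).trans (B.mul_one h _)

/-- The DG algebra with the replaced degree `0` part. -/
def dgAlg : DGAlg k where
  cx := R.cx
  one := (1 : R.carrier)
  mul {i j n} h := R.product i j n h
  one_mul h x := R.one_product h x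
  mul_one h x := R.product_one h x
  mul_assoc h₁ h₂ h₃ h₄ x y z := R.product_assoc h₁ h₂ h₃ h₄ x y z
  d_mul h h₁ h₂ x y := by
    rw [cx_d, cx_d, cx_d]
    exact R.δ_product h h₁ h₂ x y
  d_mul_zero h h' x y := by
    rw [cx_d, cx_d]
    exact R.δ_product_zero h h' x y
  d_zero_mul h h' x y := by
    rw [cx_d, cx_d]
    exact R.δ_zero_product h h' x y

/-- The projection of the modified DG algebra to the original one. -/
def proj : R.dgAlg ⟶ B :=
  Hom.mk
    { f := fun n => ModuleCat.ofHom (R.toTerm n)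
      comm' := fun i j h => by
        obtain rfl : j + 1 = i := h
        refine ModuleCat.hom_ext (LinearMap.ext fun x => ?_)
        exact (R.toTerm_δ j x).symm.trans (congrArg (R.toTerm j) (R.cx_d_apply j x).symm) }
    R.map_one
    (fun h x y => R.toTerm_product h x y)

variable {R S}

/-- The terms of the map of modified DG algebras. -/
def mapTerm (φ : B ⟶ C) (f : R.carrier →ₐ[k] S.carrier) : ∀ n : ℕ, R.X n →ₗ[k] S.X n
  | 0 => f.toLinearMap
  | n + 1 => (φ.f.f (n + 1)).hom

theorem toTerm_mapTerm (φ : B ⟶ C) (f : R.carrier →ₐ[k] S.carrier)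
    (ha : ∀ x, S.a (f x) = (φ.f.f 0).hom (R.a x)) (n : ℕ) (x : R.X n) :
    S.toTerm n (mapTerm φ f n x) = (φ.f.f n).hom (R.toTerm n x) := by
  cases n with
  | zero => exact ha x
  | succ n => rfl

theorem mapTerm_product (φ : B ⟶ C) (f : R.carrier →ₐ[k] S.carrier)
    (ha : ∀ x, S.a (f x) = (φ.f.f 0).hom (R.a x)) {i j n : ℕ} (h : i + j = n) (x : R.X i)
    (y : R.X j) :
    mapTerm φ f n (R.product i j n h x y) =
      S.product i j n h (mapTerm φ f i x) (mapTerm φ f j y) := by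
  cases n with
  | zero =>
    obtain ⟨rfl, rfl⟩ : i = 0 ∧ j = 0 := by omega
    have hf : ∀ x y : R.carrier, f (x * y) = f x * f y := _root_.map_mul f
    exact hf x y
  | succ n =>
    apply S.toTerm_injective
    rw [toTerm_mapTerm φ f ha, toTerm_product, toTerm_product, toTerm_mapTerm φ f ha,
      toTerm_mapTerm φ f ha]
    exact φ.map_mul h _ _

theorem mapTerm_δ (φ : B ⟶ C) (f : R.carrier →ₐ[k] S.carrier)
    (hb : ∀ m, f (R.b m) = S.b ((φ.f.f 1).hom m)) (n : ℕ) (x : R.X (n + 1)) :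
    S.δ n (mapTerm φ f (n + 1) x) = mapTerm φ f n (R.δ n x) := by
  cases n with
  | zero => exact (hb x).symm
  | succ n => exact congrArg (fun g => g.hom x) (φ.f.comm (n + 2) (n + 1))

/-- Functoriality of the modified DG algebra. -/
def map (φ : B ⟶ C) (f : R.carrier →ₐ[k] S.carrier)
    (ha : ∀ x, S.a (f x) = (φ.f.f 0).hom (R.a x))
    (hb : ∀ m, f (R.b m) = S.b ((φ.f.f 1).hom m)) : R.dgAlg ⟶ S.dgAlg :=
  Hom.mk
    { f := fun n => ModuleCat.ofHom (mapTerm φ f n)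
      comm' := fun i j h => by
        obtain rfl : j + 1 = i := h
        refine ModuleCat.hom_ext (LinearMap.ext fun x => ?_)
        exact (S.cx_d_apply j _).trans ((mapTerm_δ φ f hb j x).trans
          (congrArg (mapTerm φ f j) (R.cx_d_apply j x).symm)) }
    (_root_.map_one f)
    (fun h x y => mapTerm_product φ f ha h x y)

theorem map_proj (φ : B ⟶ C) (f : R.carrier →ₐ[k] S.carrier)
    (ha : ∀ x, S.a (f x) = (φ.f.f 0).hom (R.a x))
    (hb : ∀ m, f (R.b m) = S.b ((φ.f.f 1).hom m)) : map φ f ha hb ≫ S.proj = R.proj ≫ φ :=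
  hom_ext (HomologicalComplex.hom_ext _ _ fun n => ModuleCat.hom_ext (LinearMap.ext fun x =>
    toTerm_mapTerm φ f ha n x))

theorem exists_δ_eq (hone : ∀ m, R.b m = 0 → ∃ x, (B.cx.d 2 1).hom x = m)
    (hexact : ∀ n (x : B.cx.X (n + 2)), (B.cx.d (n + 2) (n + 1)).hom x = 0 →
      ∃ y, (B.cx.d (n + 3) (n + 2)).hom y = x) (n : ℕ) {x : R.X (n + 1)} (hx : R.δ n x = 0) :
    ∃ y, R.δ (n + 1) y = x := by
  cases n with
  | zero => exact hone x hx
  | succ n => exact hexact n x hx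

section

variable {A : Type u} [Ring A] [Algebra k A] {q : B ⟶ single k A}
  (hsurj : ∀ y : A, ∃ x, (q.f.f 0).hom (R.a x) = y)
  (hker : ∀ x, (q.f.f 0).hom (R.a x) = (0 : A) → ∃ m, R.b m = x)

include hsurj

theorem proj_comp_surjective (n : ℕ) : Function.Surjective ((R.proj ≫ q).f.f n).hom := by
  cases n with
  | zero => exact hsurj
  | succ n => exact fun y => ⟨0, Subsingleton.elim (α := singleX k A (n + 1)) _ _⟩

include hker

theorem quasiIsoAt_zero : QuasiIsoAt (R.proj ≫ q).f 0 := by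
  rw [quasiIsoAt_iff' _ 1 0 0 (by simp) (by simp), ShortComplex.quasiIso_iff_of_zeros'
    _ (R.dgAlg.cx.shape 0 0 (by simp)) rfl rfl]
  refine ⟨?_, (ModuleCat.epi_iff_surjective _).2 (proj_comp_surjective hsurj 0)⟩
  rw [ShortComplex.moduleCat_exact_iff]
  intro x hx
  obtain ⟨m, hm⟩ := hker x hx
  exact ⟨m, (R.cx_d_apply 0 m).trans hm⟩

omit hsurj hker

theorem quasiIsoAt_succ {n : ℕ} (hexact : ∀ x, R.δ n x = 0 → ∃ y, R.δ (n + 1) y = x) :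
    QuasiIsoAt (R.proj ≫ q).f (n + 1) := by
  rw [quasiIsoAt_iff_exactAt', HomologicalComplex.exactAt_iff' _ (n + 2) (n + 1) n (by simp)
    (by simp), ShortComplex.moduleCat_exact_iff]
  · intro x hx
    obtain ⟨y, hy⟩ := hexact x ((R.cx_d_apply n x).symm.trans hx)
    exact ⟨y, (R.cx_d_apply (n + 1) y).trans hy⟩
  · rw [HomologicalComplex.exactAt_iff' _ (n + 2) (n + 1) n (by simp) (by simp),
      ShortComplex.moduleCat_exact_iff]
    exact fun x _ => ⟨0, Subsingleton.elim (α := singleX k A (n + 1)) _ _⟩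

include hsurj hker

theorem isDGSplitting (hone : ∀ m, R.b m = 0 → ∃ x, (B.cx.d 2 1).hom x = m)
    (hexact : ∀ n (x : B.cx.X (n + 2)), (B.cx.d (n + 2) (n + 1)).hom x = 0 →
      ∃ y, (B.cx.d (n + 3) (n + 2)).hom y = x) :
    IsDGSplitting R.proj q := by
  refine ⟨proj_comp_surjective hsurj, (quasiIso_iff _).2 fun n => ?_⟩
  cases n with
  | zero => exact quasiIsoAt_zero hsurj hker
  | succ n => exact quasiIsoAt_succ fun _ => exists_δ_eq hone hexact n

end

end Replacement

end DGAlg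

section Truncation

variable (k : Type u) [Field k] (A : Type u) [Ring A] [Algebra k A]

/-- The projection `Q̄_{≤ 1}(A) → A♭`. -/
def truncToFlat : (QBarAlg k A).trunc 1 ⟶ flatA k A :=
  DGAlg.quotMap (𝟙 (QBarAlg k A)) ((QBarAlg k A).truncIdeal 1) (QBarAlg k A).flatIdeal
    (fun n x hx => by
      rcases n with _ | _ | n
      · exact hx
      · have hx0 : x = 0 := hx
        subst hx0
        exact Submodule.zero_mem _
      · trivial)

variable {k A}

theorem truncToFlat_surjective (n : ℕ) :
    Function.Surjective ((truncToFlat k A).f.f n).hom := by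
  intro y
  obtain ⟨y, rfl⟩ := Submodule.Quotient.mk_surjective (flatSub (QBarCx k A) n) y
  exact ⟨Submodule.Quotient.mk (p := truncSub (QBarCx k A) 1 n) y, rfl⟩

theorem truncToFlat_injective :
    Function.Injective ((truncToFlat k A).f.f 0).hom := by
  rw [injective_iff_map_eq_zero]
  intro x hx
  obtain ⟨x, rfl⟩ := Submodule.Quotient.mk_surjective (truncSub (QBarCx k A) 1 0) x
  exact (Submodule.Quotient.mk_eq_zero _).2
    ((Submodule.Quotient.mk_eq_zero (flatSub (QBarCx k A) 0)).1 hx)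

/-- The projection `Q̄_{≤ 1}(A) → A♭` in degree `0`, where it is an isomorphism. -/
def truncEquivFlat : ((QBarAlg k A).trunc 1).cx.X 0 ≃ₗ[k] (flatA k A).cx.X 0 :=
  LinearEquiv.ofBijective ((truncToFlat k A).f.f 0).hom
    ⟨truncToFlat_injective, truncToFlat_surjective 0⟩

theorem truncToFlat_d (x : ((QBarAlg k A).trunc 1).cx.X 2) :
    ((truncToFlat k A).f.f 1).hom ((((QBarAlg k A).trunc 1).cx.d 2 1).hom x) = 0 := by
  obtain ⟨x, rfl⟩ := Submodule.Quotient.mk_surjective (truncSub (QBarCx k A) 1 2) x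
  exact (Submodule.Quotient.mk_eq_zero (flatSub (QBarCx k A) 1)).2 ⟨x, rfl⟩

theorem exists_d_eq_of_truncToFlat {x : ((QBarAlg k A).trunc 1).cx.X 1}
    (hx : ((truncToFlat k A).f.f 1).hom x = 0) :
    ∃ y, (((QBarAlg k A).trunc 1).cx.d 2 1).hom y = x := by
  obtain ⟨x, rfl⟩ := Submodule.Quotient.mk_surjective (truncSub (QBarCx k A) 1 1) x
  obtain ⟨y, rfl⟩ : x ∈ LinearMap.range ((QBarCx k A).d 2 1).hom :=
    (Submodule.Quotient.mk_eq_zero (flatSub (QBarCx k A) 1)).1 hx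
  exact ⟨Submodule.Quotient.mk (p := truncSub (QBarCx k A) 1 2) y, rfl⟩

theorem eq_zero_of_trunc_d {n : ℕ} {x : ((QBarAlg k A).trunc 1).cx.X (n + 2)}
    (hx : (((QBarAlg k A).trunc 1).cx.d (n + 2) (n + 1)).hom x = 0) : x = 0 := by
  obtain ⟨x, rfl⟩ := Submodule.Quotient.mk_surjective (truncSub (QBarCx k A) 1 (n + 2)) x
  refine (Submodule.Quotient.mk_eq_zero (truncSub (QBarCx k A) 1 (n + 2))).2 ?_
  cases n with
  | zero => exact (Submodule.Quotient.mk_eq_zero (truncSub (QBarCx k A) 1 1)).1 hx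
  | succ n => trivial

theorem truncToFlat_naturality {A B : AlgCat.{u} k} (g : A ⟶ B) (n : ℕ)
    (x : ((QBarAlg k A).trunc 1).cx.X n) :
    ((truncToFlat k B).f.f n).hom ((((QBarLE k 1).map g).f.f n).hom x) =
      ((flatVMap g.hom.toLinearMap).f n).hom (((truncToFlat k A).f.f n).hom x) := by
  obtain ⟨x, rfl⟩ := Submodule.Quotient.mk_surjective (truncSub (QBarCx k A) 1 n) x
  rfl

theorem aug_truncToFlat (x : ((QBarAlg k A).trunc 1).cx.X 0) :
    FlatV.aug k A (((truncToFlat k A).f.f 0).hom x) = ((augLE k 1 A).f.f 0).hom x := by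
  obtain ⟨x, rfl⟩ := Submodule.Quotient.mk_surjective (truncSub (QBarCx k A) 1 0) x
  rfl

end Truncation

namespace AlgLift

variable {p : ℕ} [Fact p.Prime] {k : Type u} [Field k] {A : Type u} [Ring A] [Algebra k A]
  (L : AlgLift p k A)

/-- The map `[x] ↦ [x mod p]` with values in `Q̄_{≤ 1}(A)`. -/
def truncA : L.toLift.Symb →ₗ[k] ((QBarAlg k A).trunc 1).cx.X 0 :=
  truncEquivFlat.symm.toLinearMap ∘ₗ L.symbA

theorem truncToFlat_truncA (z : L.toLift.Symb) :
    ((truncToFlat k A).f.f 0).hom (L.truncA z) = L.symbA z :=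
  truncEquivFlat.apply_symm_apply (L.symbA z)

theorem aug_truncA (z : L.toLift.Symb) :
    ((augLE k 1 A).f.f 0).hom (L.truncA z) = FlatV.aug k A (L.symbA z) :=
  (aug_truncToFlat (A := A) _).symm.trans (congrArg (FlatV.aug k A) (L.truncToFlat_truncA z))

/-- The map `Q̄₁(A) → A♭₁ → K₀₁`. -/
def truncB : ((QBarAlg k A).trunc 1).cx.X 1 →ₗ[k] L.toLift.Symb :=
  L.symbB ∘ₗ ((truncToFlat k A).f.f 1).hom

theorem symbA_symbB (m : (flatA k A).cx.X 1) :
    L.symbA (L.symbB m) = ((flatA k A).cx.d 1 0).hom m :=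
  LinearMap.congr_fun L.toLift.symbA_comp_symbB m

/-- The algebra of symbols as a replacement of the degree `0` part of `Q̄_{≤ 1}(A)`. -/
def replacement : DGAlg.Replacement ((QBarAlg k A).trunc 1) where
  carrier := L.toLift.Symb
  a := L.truncA
  b := L.truncB
  comp m := truncToFlat_injective <| by
    rw [truncToFlat_truncA, truncB, LinearMap.comp_apply, symbA_symbB]
    exact congrArg (fun g => g.hom m) ((truncToFlat k A).f.comm 1 0)
  b_d x := by
    rw [truncB, LinearMap.comp_apply, truncToFlat_d, map_zero]
  map_one := truncToFlat_injective <| by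
    rw [truncToFlat_truncA, symbA_one]
    exact (truncToFlat k A).map_one.symm
  map_mul x y := truncToFlat_injective <| by
    rw [truncToFlat_truncA, symbA_mul, (truncToFlat k A).map_mul, truncToFlat_truncA,
      truncToFlat_truncA]
  left x m := by
    rw [truncB, LinearMap.comp_apply, (truncToFlat k A).map_mul, truncToFlat_truncA, symbB_left]
    rfl
  right x m := by
    rw [truncB, LinearMap.comp_apply, (truncToFlat k A).map_mul, truncToFlat_truncA, symbB_right]
    rfl

section

variable [CharP k p] [Finite k]

theorem exists_truncB_eq {z : L.toLift.Symb}
    (hz : ((augLE k 1 A).f.f 0).hom (L.truncA z) = (0 : A)) : ∃ m, L.truncB m = z := by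
  obtain ⟨m, hm⟩ := FlatV.exists_d_eq_of_aug_eq_zero (V := A) ((L.aug_truncA z).symm.trans hz)
  have symbA_sub : L.toLift.symbA (z - L.toLift.symbB m) = 0 := by
    rw [map_sub]
    exact sub_eq_zero.2 (hm.symm.trans (L.symbA_symbB m).symm)
  obtain ⟨m', -, hm'⟩ := L.toLift.isSplitting.ker.surjOn symbA_sub
  obtain ⟨t, ht⟩ := truncToFlat_surjective (k := k) (A := A) 1 (m' + m)
  refine ⟨t, (congrArg L.symbB ht).trans ((map_add L.toLift.symbB m' m).trans ?_)⟩
  rw [hm', sub_add_cancel]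

theorem isDGSplitting_replacement :
    DGAlg.IsDGSplitting L.replacement.proj (augLE k 1 A) := by
  refine DGAlg.Replacement.isDGSplitting (fun y => ?_) (fun z hz => L.exists_truncB_eq hz)
    (fun m hm => exists_d_eq_of_truncToFlat (L.toLift.symbB_injective
      (hm.trans (map_zero _).symm)))
    (fun n x hx => ⟨0, by rw [map_zero, eq_zero_of_trunc_d hx]⟩)
  obtain ⟨x, rfl⟩ := L.surjective y
  refine ⟨L.symb x, (L.aug_truncA _).trans ?_⟩
  rw [symbA_symb]
  exact FlatV.aug_gen₀ (L.proj x)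

end

end AlgLift

namespace AlgWithLift

variable {p : ℕ} [Fact p.Prime] {k : Type u} [Field k]

section

variable {X Y : AlgWithLift p k} (φ : X ⟶ Y)

/-- The map of algebras of symbols defined by a map of algebras with liftings. -/
def symbAlgHom : X.lift.toLift.Symb →ₐ[k] Y.lift.toLift.Symb :=
  AlgLift.symbAlgHom (f := φ.base.hom.toLinearMap) φ.lift φ.comm

theorem symbAlgHom_symb (x : X.lift.carrier) :
    symbAlgHom φ (X.lift.symb x) = Y.lift.symb (φ.lift x) :=
  AlgLift.symbAlgHom_symb φ.lift φ.comm x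

theorem truncA_symbAlgHom (z : X.lift.toLift.Symb) : Y.lift.truncA (symbAlgHom φ z) =
    (((QBarLE k 1).map φ.base).f.f 0).hom (X.lift.truncA z) := by
  apply truncToFlat_injective
  refine (Y.lift.truncToFlat_truncA _).trans ?_
  refine (Lift.symbA_symbMap (L := X.lift.toLift) (M := Y.lift.toLift)
    (f := φ.base.hom.toLinearMap) ⟨φ.lift.toLinearMap, φ.comm⟩ z).trans ?_
  refine Eq.trans ?_ (truncToFlat_naturality φ.base 0 _).symm
  exact congrArg ((flatVMap φ.base.hom.toLinearMap).f 0).hom (X.lift.truncToFlat_truncA z).symm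

theorem symbAlgHom_truncB (m : ((QBarAlg k X.base).trunc 1).cx.X 1) :
    symbAlgHom φ (X.lift.truncB m) =
      Y.lift.truncB ((((QBarLE k 1).map φ.base).f.f 1).hom m) := by
  refine (Lift.symbMap_symbB (L := X.lift.toLift) (M := Y.lift.toLift)
    (f := φ.base.hom.toLinearMap) ⟨φ.lift.toLinearMap, φ.comm⟩ _).trans ?_
  exact congrArg Y.lift.symbB (truncToFlat_naturality φ.base 1 m).symm

end

variable (p k) in
/-- The functorial DG algebra `A_•` associated to an algebra with a flat lifting. -/
def resolution : AlgWithLift p k ⥤ DGAlg k where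
  obj X := X.lift.replacement.dgAlg
  map {X Y} φ := DGAlg.Replacement.map (R := X.lift.replacement) (S := Y.lift.replacement)
    ((QBarLE k 1).map φ.base) (symbAlgHom φ) (truncA_symbAlgHom φ) (symbAlgHom_truncB φ)
  map_id X := by
    refine DGAlg.hom_ext (HomologicalComplex.hom_ext _ _ fun n => ModuleCat.hom_ext ?_)
    cases n with
    | zero => exact AlgLift.symb_hom_ext (L := X.lift) fun x => symbAlgHom_symb (𝟙 X) x
    | succ n =>
      exact congrArg (fun g => (g.f.f (n + 1)).hom) ((QBarLE k 1).map_id X.base)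
  map_comp {X Y Z} φ ψ := by
    refine DGAlg.hom_ext (HomologicalComplex.hom_ext _ _ fun n => ModuleCat.hom_ext ?_)
    cases n with
    | zero =>
      exact AlgLift.symb_hom_ext (L := X.lift) fun x => (symbAlgHom_symb (φ ≫ ψ) x).trans
        ((congrArg (symbAlgHom ψ) (symbAlgHom_symb φ x)).trans (symbAlgHom_symb ψ _)).symm
    | succ n =>
      exact congrArg (fun g => (g.f.f (n + 1)).hom) ((QBarLE k 1).map_comp φ.base ψ.base)

variable (p k) in
/-- The functorial map `A_• → Q̄_{≤ 1}(A)`. -/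
def resolutionProj : resolution p k ⟶ toAlg p k ⋙ QBarLE k 1 where
  app X := X.lift.replacement.proj
  naturality X Y φ := DGAlg.Replacement.map_proj (R := X.lift.replacement)
    (S := Y.lift.replacement) ((QBarLE k 1).map φ.base) (symbAlgHom φ) (truncA_symbAlgHom φ)
    (symbAlgHom_truncB φ)

end AlgWithLift

end CubeConstruction

end

theorem lemma3p11 (p : ℕ) [Fact p.Prime] (k : Type u) [Field k] [Finite k] [CharP k p] :
    (∃ (e : ∀ (V : Type u) [AddCommGroup V] [Module k V],
          CubeConstruction.Lift p k V ≌ CubeConstruction.Spl (CubeConstruction.flatV k V))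
      (t : ∀ {V W : Type u} [AddCommGroup V] [Module k V] [AddCommGroup W] [Module k W]
          (f : V →ₗ[k] W) {L : CubeConstruction.Lift p k V} {M : CubeConstruction.Lift p k W},
          CubeConstruction.Lift.HomOver f L M →
            CubeConstruction.Spl.HomOver (CubeConstruction.flatVMap f)
              ((e V).functor.obj L) ((e W).functor.obj M)),
      -- the equivalences `e V` are functorial in `V`
      (∀ (V : Type u) [AddCommGroup V] [Module k V] {L M : CubeConstruction.Lift p k V}
          (g : L ⟶ M),
          (t LinearMap.id (CubeConstruction.Lift.Hom.toHomOver g)).φ =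
            ((e V).functor.map g).e.toLinearMap) ∧
      (∀ {U V W : Type u} [AddCommGroup U] [Module k U] [AddCommGroup V] [Module k V]
          [AddCommGroup W] [Module k W] (f : U →ₗ[k] V) (g : V →ₗ[k] W)
          {L : CubeConstruction.Lift p k U} {M : CubeConstruction.Lift p k V}
          {N : CubeConstruction.Lift p k W} (φ : CubeConstruction.Lift.HomOver f L M)
          (ψ : CubeConstruction.Lift.HomOver g M N),
          (t (g ∘ₗ f) (ψ.comp φ)).φ = (t g ψ).φ ∘ₗ (t f φ).φ) ∧
      -- for an algebra, they identify algebra liftings with multiplicative splittings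
      (∀ (A : Type u) [Ring A] [Algebra k A],
          ∃ e' : CubeConstruction.AlgLift p k A ≌
              CubeConstruction.MulSpl (CubeConstruction.flatA k A),
            Nonempty (e'.functor ⋙ CubeConstruction.forgetFlat k A ≅
              CubeConstruction.AlgLift.forget p k A ⋙ (e A).functor))) ∧
    -- a functorial DG splitting of `Q̄_{≤ 1}(A) → A` for every algebra with a flat lifting
    (∃ (D : CubeConstruction.AlgWithLift p k ⥤ CubeConstruction.DGAlg k)
      (s : D ⟶ CubeConstruction.AlgWithLift.toAlg p k ⋙ CubeConstruction.QBarLE k 1),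
      ∀ X : CubeConstruction.AlgWithLift p k,
        CubeConstruction.DGAlg.IsDGSplitting (s.app X)
          (CubeConstruction.augLE k 1 X.base)) := by
  refine ⟨⟨fun V _ _ => (CubeConstruction.Lift.splFunctor p k V).asEquivalence,
    fun f _ _ φ => CubeConstruction.Lift.HomOver.toSpl φ, fun V _ _ L M g => rfl,
    fun f g L M N φ ψ => CubeConstruction.Lift.symbMap_comp ψ φ,
    fun A _ _ => ⟨(CubeConstruction.AlgLift.mulSplFunctor p k A).asEquivalence,
      ⟨CubeConstruction.AlgLift.forgetIso p k A⟩⟩⟩,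
    CubeConstruction.AlgWithLift.resolution p k, CubeConstruction.AlgWithLift.resolutionProj p k,
    fun X => X.lift.isDGSplitting_replacement⟩
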